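/- **Setting.** Let $\beta,h\in\mathbb R$. For $N\ge 1$ let $(J_{ij})_{1\le i<j\le N}$ be independent standard Gaussian variables, with expectation $\mathbb E$, and let $$Z_N(\beta,h;J)=\sum_{\sigma\in\{-1,1\}^N}\exp\Big(\frac{\beta}{\sqrt N}\sum_{i<j}J_{ij}\sigma_i\sigma_j+\beta h\sum_i\sigma_i\Big),\qquad \varphi_N(n,\beta,h)=\frac1{Nn}\log\mathbb E\big(Z_N(\beta,h;J)^n\big),\quad n\in(0,1].$$ For $n\in[0,1]$ let $\chi_n$ be the set of nondecreasing functions $x:(0,1]\to[n,1]$ for which there are $K\ge1$ and $0=q_0\le q_1\le\dots\le q_K=1$ such that $x$ is constant on each interval $(q_{a-1},q_a]$; write $\chi=\chi_0$. For $x\in\chi$ let $f(q,y;x,\beta)$ be the solution on $[0,1]\times\mathbb R$ of the Parisi equation $$\partial_qf+\tfrac12\partial_y^2f+\tfrac12x(q)(\partial_yf)^2=0,\qquad f(1,y)=\log\cosh(\beta y),$$ that is, the continuous function on $[0,1]\times\mathbb R$, Lipschitz in $y$ uniformly in $q$, which is $C^2$ in $y$, differentiable in $q$ and satisfies the equation at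 each $q\in(0,1)$ that is not a jump of $x$, and which has the given values at $q=1$. For $x_n\in\chi_n$ put $$\alpha_P(\beta,h,x_n)=\log2+\frac{n\beta^2}{4}+f(0,h;x_n,\beta)-\frac{\beta^2}{2}\int_0^1q\,x_n(q)\,dq ,$$ where for $n=0$ this is the Parisi functional $\alpha_P(\beta,h,x)$, $x\in\chi$ (the term $n\beta^2/4$ depends on the $n$ for which $x_n$ is considered as an element of $\chi_n$), and let $\alpha_P(\beta,h)=\inf_{x\in\chi}\alpha_P(\beta,h,x)$. **Theorem.** For all $\beta,h\in\mathbb R$ these objects are well defined: for each $x\in\chi$ the solution $f$ exists and is unique, and for each $n\in[0,1]$ the set $\chi_n$ is nonempty and $\alpha_P(\beta,h,\cdot)$ is bounded below on it. Moreover: 1. For every $n\in(0,1]$ the limit $\varphi(n,\beta,h)=\lim_{N\to\infty}\varphi_N(n,\beta,h)$ exists, and $\varphi(n,\beta,h)\le\alpha_P(\beta,h,x_n)$ for every $x_n\in\chi_n$; hence $$\varphi(n,\beta,h)\le\inf_{x_n\in\chi_n}\alpha_P(\beta,h,x_n).$$ 2. The limits as $n\to0^+$ exist, and $$\lim_{n\to0^+}\varphi(n,\beta,h)\le\lim_{n\to0^+}\inf_{x_n\in\chi_n}\alpha_P(\beta,h,x_n)=\alpha_P(\beta,h).$$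 3. If $x\in\chi$ and $x_n\in\chi_n$ for $n\in(0,1]$ are such that $\int_0^1|x_n(q)-x(q)|\,dq\to0$ as $n\to0^+$, then $\lim_{n\to0^+}\alpha_P(\beta,h,x_n)=\alpha_P(\beta,h,x)$. -/

import Mathlib

open MeasureTheory ProbabilityTheory Filter Topology Set

noncomputable section

namespace SKReplica

/-- The set of pairs of sites `i < j` among `N` sites. -/
abbrev Pair (N : ℕ) : Type := {p : Fin N × Fin N // p.1 < p.2}

/-- The law of the disorder: independent standard Gaussian couplings, one for each pair of sites. -/
def disorder (N : ℕ) : Measure (Pair N → ℝ) :=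
  Measure.pi fun _ => gaussianReal 0 1

/-- The value `±1` of an Ising spin, as a real number. -/
def spin (s : ℤˣ) : ℝ := ((s : ℤ) : ℝ)

/-- The Sherrington-Kirkpatrick Hamiltonian
`H_N(σ, h; J) = -N^{-1/2} ∑_{i<j} J_ij σ_i σ_j - h ∑_i σ_i`. -/
def hamiltonian (N : ℕ) (h : ℝ) (J : Pair N → ℝ) (σ : Fin N → ℤˣ) : ℝ :=
  -(1 / Real.sqrt N) * (∑ p : Pair N, J p * spin (σ p.1.1) * spin (σ p.1.2))
    - h * ∑ i, spin (σ i)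

/-- The partition function `Z_N(β, h; J) = ∑_σ exp(-β H_N(σ, h; J))`. -/
def partitionFunction (N : ℕ) (β h : ℝ) (J : Pair N → ℝ) : ℝ :=
  ∑ σ : Fin N → ℤˣ, Real.exp (-β * hamiltonian N h J σ)

/-- `φ_N(n, β, h) = (N n)⁻¹ log E[Z_N(β, h; J)^n]`, with a real exponent `n`. -/
def phiN (N : ℕ) (n β h : ℝ) : ℝ :=
  1 / (N * n) * Real.log (∫ J, partitionFunction N β h J ^ n ∂(disorder N))

/-- The space `χ_n` of functional order parameters: the nondecreasing piecewise constant functions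
from `(0, 1]` to `[n, 1]`, with `x q = m_a` for `q_{a-1} < q ≤ q_a`, where
`0 = q_0 ≤ q_1 ≤ ⋯ ≤ q_K = 1`. The functions are total, only their values on `(0, 1]` matter. The
space `χ` of the Parisi formula is `χ_0`. -/
def chi (n : ℝ) : Set (ℝ → ℝ) :=
  {x | ∃ (K : ℕ) (q : Fin (K + 1) → ℝ) (m : Fin K → ℝ),
    Monotone q ∧ q 0 = 0 ∧ q (Fin.last K) = 1 ∧
    Monotone m ∧ (∀ a, m a ∈ Icc n 1) ∧
    ∀ a : Fin K, ∀ s ∈ Ioc (q a.castSucc) (q a.succ), x s = m a}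

/-- `f` is a solution on `[0, 1] × ℝ` of the Parisi equation
`∂_q f + (1/2) ∂_y² f + (1/2) x(q) (∂_y f)² = 0` with final condition `f(1, y) = log cosh (β y)`:
it is continuous, Lipschitz in `y` uniformly in `q` (the usual class for uniqueness), and satisfies
the equation pointwise at each `q ∈ (0, 1)` that is not a jump of `x`. -/
structure IsParisiSolution (β : ℝ) (x : ℝ → ℝ) (f : ℝ → ℝ → ℝ) : Prop where
  continuousOn : ContinuousOn (fun p : ℝ × ℝ => f p.1 p.2) (Icc 0 1 ×ˢ univ)
  final : ∀ y, f 1 y = Real.log (Real.cosh (β * y))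
  lipschitz : ∃ C : NNReal, ∀ q ∈ Icc (0 : ℝ) 1, LipschitzWith C (f q)
  contDiff : ∀ q ∈ Ioo (0 : ℝ) 1, ContinuousAt x q → ContDiff ℝ 2 (f q)
  equation : ∀ q ∈ Ioo (0 : ℝ) 1, ContinuousAt x q → ∀ y,
    DifferentiableAt ℝ (fun s => f s y) q ∧
    deriv (fun s => f s y) q + 1 / 2 * deriv (deriv (f q)) y
      + 1 / 2 * x q * (deriv (f q) y) ^ 2 = 0

open Classical in
/-- The solution `f(q, y; x, β)` of the Parisi equation (and `0` if there is none). -/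
def parisiSolution (β : ℝ) (x : ℝ → ℝ) : ℝ → ℝ → ℝ :=
  if hf : ∃ f, IsParisiSolution β x f then hf.choose else 0

/-- The functional `α_P(β, h, x_n)` of `x_n ∈ χ_n`, with its explicit dependence on `n`:
`log 2 + n β²/4 + f(0, h; x_n, β) - (β²/2) ∫₀¹ q x_n(q) dq`.
For `n = 0` it is the Parisi functional `α_P(β, h, x)`, `x ∈ χ`. -/
def alphaP (n β h : ℝ) (x : ℝ → ℝ) : ℝ :=
  Real.log 2 + n * β ^ 2 / 4 + parisiSolution β x 0 h - β ^ 2 / 2 * ∫ q in (0 : ℝ)..1, q * x q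

/-- `inf_{x_n ∈ χ_n} α_P(β, h, x_n)`; for `n = 0` it is the Parisi value `α_P(β, h)`. -/
def infAlphaP (n β h : ℝ) : ℝ := sInf (alphaP n β h '' chi n)

end SKReplica

end

/-!
The theorem rests on Gaussian interpolation at a real number `n ∈ (0, 1]` of replicas.

*Interpolation.* Both the existence of the limit and its upper bound compare two Gaussian systems on
the same finite set of configurations. All pressures involved are obtained from
`y ↦ log ∑ exp (y σ)` by finitely many averages `F ↦ m⁻¹ log E exp (m F(y + c z v))` over one
standard Gaussian `z` each (`Pressure.step`), where `c` is `sin θ` for the energies of the target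
system and `cos θ` for those of the reference system, and `θ` runs from `0` to `π / 2`. By Gaussian
integration by parts such an average contributes `± sin θ cos θ ⟨v, (H + m P Pᵀ) v⟩` to the
derivative in `θ`, where `P`, a probability vector, and `H` are the gradient and the Hessian of `F`.
`Pressure.RateBound` is the resulting differential inequality, in a form which passes through each
average: the average moves `± v vᵀ` from the covariance `D` still to be averaged to the part already
averaged (`RateBound.step`), a change of the exponent costs the form `∑ D σ τ P σ P τ ≥ min D`
(`RateBound.weaken`), and for `log ∑ exp` only the diagonal of `D` and its minimum enter
(`gibbs_rateBound`). No Poisson-Dirichlet cascades are needed.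

*Thermodynamic limit.* With the couplings of the whole system as reference and those of two
non-interacting subsystems as target, convexity of the square gives
`E Z_{N₁}ⁿ · E Z_{N₂}ⁿ ≤ E Z_{N₁+N₂}ⁿ` (`moment_mul_le`), and the limit exists by Fekete's lemma.

*Upper bound.* With the couplings as target and, as reference, independent fields of variance
`q_a - q_{a-1}` at each site averaged with exponent `m_a`, the reference pressure decouples into the
Parisi recursion at each site. The rates at the level `q` are bounded below by completing a square
in the overlap, and their sum telescopes to `∫ q x(q) dq` (`exists_guerra_pressure`). This is
Guerra's bound in finite volume (`phiN_le_alphaP`).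

*The Parisi equation.* For piecewise constant `x` the solution is built by the recursion, since one
step solves the equation by the Cole-Hopf transform (`exists_isParisiFlow`). A maximum principle for
functions of linear growth gives `|f - g| ≤ C² / 2 · ∫ |x - x'|` for the solutions with parameters
`x` and `x'`, where `C` is the Lipschitz constant of only one of them (`IsParisiSolution.sub_le`).
This contains uniqueness and the convergence of the functional along `L¹`-convergent parameters.

*Zero replicas.* By Jensen's inequality `φ_N`, and hence `φ`, increases with `n`, and `φ` is bounded
below by the value of `φ_1`, which does not depend on `n`; so `φ` has a limit at `0⁺`. Replacing
`x ∈ χ` by `max x n ∈ χ_n` moves it by at most `n` in `L¹`, so that the infima over `χ_n` converge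
to the infimum over `χ`.
-/

noncomputable section

namespace SKReplica

/-! ### Gaussian averages of functions of exponential growth -/

/-- A function on a normed space has exponential growth if `‖G e‖ ≤ A exp (B ‖e‖)` for some
constants `A` and `B`. -/
def ExpGrowth {E F : Type*} [Norm E] [Norm F] (G : E → F) : Prop :=
  ∃ A B : ℝ, 0 ≤ A ∧ 0 ≤ B ∧ ∀ e, ‖G e‖ ≤ A * Real.exp (B * ‖e‖)

namespace ExpGrowth

variable {E F : Type*} [NormedAddCommGroup E] [NormedAddCommGroup F]

lemma of_bounded {G : E → F} (C : ℝ) (h : ∀ e, ‖G e‖ ≤ C) : ExpGrowth G := by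
  refine ⟨C, 0, (norm_nonneg _).trans (h 0), le_rfl, fun e => ?_⟩
  simpa using h e

lemma mono {F' : Type*} [NormedAddCommGroup F'] {G : E → F} {G' : E → F'} (hG : ExpGrowth G)
    (C : ℝ) (hC : 0 ≤ C) (h : ∀ e, ‖G' e‖ ≤ C * ‖G e‖) : ExpGrowth G' := by
  obtain ⟨A, B, hA, hB, hb⟩ := hG
  refine ⟨C * A, B, by positivity, hB, fun e => (h e).trans ?_⟩
  rw [mul_assoc]
  exact mul_le_mul_of_nonneg_left (hb e) hC

lemma add {G G' : E → F} (hG : ExpGrowth G) (hG' : ExpGrowth G') :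
    ExpGrowth (fun e => G e + G' e) := by
  obtain ⟨A, B, hA, hB, hb⟩ := hG
  obtain ⟨A', B', hA', hB', hb'⟩ := hG'
  refine ⟨A + A', max B B', by positivity, le_max_of_le_left hB, fun e => ?_⟩
  refine (norm_add_le _ _).trans ?_
  rw [add_mul]
  gcongr
  · refine (hb e).trans ?_
    gcongr
    exact le_max_left _ _
  · refine (hb' e).trans ?_
    gcongr
    exact le_max_right _ _

lemma sum {ι : Type*} (s : Finset ι) {G : ι → E → F} (hG : ∀ i ∈ s, ExpGrowth (G i)) :
    ExpGrowth (fun e => ∑ i ∈ s, G i e) := by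
  classical
  induction s using Finset.induction_on with
  | empty => exact of_bounded 0 (by simp)
  | insert a s ha ih =>
    simp only [Finset.sum_insert ha]
    exact (hG a (by simp)).add (ih fun i hi => hG i (by simp [hi]))

lemma mul {G G' : E → ℝ} (hG : ExpGrowth G) (hG' : ExpGrowth G') :
    ExpGrowth (fun e => G e * G' e) := by
  obtain ⟨A, B, hA, hB, hb⟩ := hG
  obtain ⟨A', B', hA', hB', hb'⟩ := hG'
  refine ⟨A * A', B + B', by positivity, by positivity, fun e => ?_⟩
  rw [norm_mul, add_mul, Real.exp_add, mul_mul_mul_comm]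
  exact mul_le_mul (hb e) (hb' e) (norm_nonneg _) (by positivity)

lemma const_mul {G : E → ℝ} (hG : ExpGrowth G) (c : ℝ) : ExpGrowth (fun e => c * G e) :=
  hG.mono |c| (abs_nonneg _) fun e => by rw [norm_mul, Real.norm_eq_abs]

lemma exp_of_le {G : E → ℝ} (A B : ℝ) (hB : 0 ≤ B) (h : ∀ e, G e ≤ A + B * ‖e‖) :
    ExpGrowth (fun e => Real.exp (G e)) := by
  refine ⟨Real.exp A, B, by positivity, hB, fun e => ?_⟩
  rw [Real.norm_eq_abs, Real.abs_exp, ← Real.exp_add]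
  exact Real.exp_le_exp.2 (h e)

lemma id_real : ExpGrowth (fun z : ℝ => z) := by
  refine ⟨1, 1, zero_le_one, zero_le_one, fun e => ?_⟩
  rw [one_mul, one_mul]
  linarith [Real.add_one_le_exp ‖e‖]

/-- Exponential growth is inherited along an affine line. -/
lemma comp_line [NormedSpace ℝ E] {G : E → F} (hG : ExpGrowth G) (a b : E) :
    ExpGrowth (fun z : ℝ => G (a + z • b)) := by
  obtain ⟨A, B, hA, hB, hb⟩ := hG
  refine ⟨A * Real.exp (B * ‖a‖), B * ‖b‖, by positivity, by positivity, fun z => ?_⟩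
  refine (hb _).trans ?_
  rw [mul_assoc, ← Real.exp_add]
  gcongr
  have h1 : ‖a + z • b‖ ≤ ‖a‖ + ‖z‖ * ‖b‖ := (norm_add_le _ _).trans (by rw [norm_smul])
  nlinarith [mul_le_mul_of_nonneg_left h1 hB]

end ExpGrowth

lemma integrable_exp_mul_abs_gaussianReal (B : ℝ) :
    Integrable (fun z : ℝ => Real.exp (B * |z|)) (gaussianReal 0 1) := by
  refine Integrable.mono' ((integrable_exp_mul_gaussianReal (μ := 0) (v := 1) B).add
    (integrable_exp_mul_gaussianReal (μ := 0) (v := 1) (-B))) (by fun_prop)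
    (Eventually.of_forall fun z => ?_)
  rw [Real.norm_eq_abs, Real.abs_exp]
  simp only [Pi.add_apply]
  rcases abs_cases z with ⟨h, _⟩ | ⟨h, _⟩ <;> rw [h]
  · linarith [Real.exp_pos (-B * z)]
  · have : B * -z = -B * z := by ring
    rw [this]
    linarith [Real.exp_pos (B * z)]

lemma ExpGrowth.integrable {F : Type*} [NormedAddCommGroup F] {G : ℝ → F} (hG : ExpGrowth G)
    (hm : AEStronglyMeasurable G (gaussianReal 0 1)) : Integrable G (gaussianReal 0 1) := by
  obtain ⟨A, B, -, -, hb⟩ := hG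
  exact Integrable.mono' ((integrable_exp_mul_abs_gaussianReal B).const_mul A) hm
    (Eventually.of_forall hb)

/-- Gaussian integration by parts: `E[z F(z)] = E[F'(z)]` for a standard Gaussian `z`. -/
lemma integral_mul_gaussianReal {F F' : ℝ → ℝ} (hF : ∀ z, HasDerivAt F (F' z) z)
    (hF'c : Continuous F') (hg : ExpGrowth F) (hg' : ExpGrowth F') :
    ∫ z, z * F z ∂(gaussianReal 0 1) = ∫ z, F' z ∂(gaussianReal 0 1) := by
  have hFc : Continuous F := continuous_iff_continuousAt.2 fun z => (hF z).continuousAt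
  have hp : ∀ z, HasDerivAt (gaussianPDFReal 0 1) (-z * gaussianPDFReal 0 1 z) z := by
    intro z
    have h1 : HasDerivAt (fun z : ℝ => -(z - 0) ^ 2 / (2 * ((1 : NNReal) : ℝ))) (-z) z := by
      have := (((hasDerivAt_id z).sub_const 0).pow 2).neg.div_const (2 * ((1 : NNReal) : ℝ))
      refine this.congr_deriv ?_
      simp; ring
    have h2 := h1.exp.const_mul ((Real.sqrt (2 * Real.pi * (1 : NNReal)))⁻¹)
    rw [gaussianPDFReal_def]
    refine h2.congr_deriv ?_
    ring
  have key : ∀ G : ℝ → ℝ, Continuous G → ExpGrowth G →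
      Integrable (fun z => gaussianPDFReal 0 1 z * G z) := by
    intro G hGc hGg
    have := hGg.integrable hGc.aestronglyMeasurable
    rw [gaussianReal_of_var_ne_zero 0 one_ne_zero,
      integrable_withDensity_iff_integrable_smul₀'
        (measurable_gaussianPDF 0 1).aemeasurable
        (Eventually.of_forall fun _ => gaussianPDF_lt_top)] at this
    simpa [toReal_gaussianPDF] using this
  have hi1 := key F' hF'c hg'
  have hi2 := key (fun z => z * F z) (by fun_prop) (ExpGrowth.id_real.mul hg)
  have h0 := integral_eq_zero_of_hasDerivAt_of_integrable
    (f := fun z => gaussianPDFReal 0 1 z * F z)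
    (f' := fun z => gaussianPDFReal 0 1 z * F' z - gaussianPDFReal 0 1 z * (z * F z))
    (fun z => ((hp z).mul (hF z)).congr_deriv (by ring)) (hi1.sub hi2) (key F hFc hg)
  rw [integral_sub hi1 hi2] at h0
  simp only [integral_gaussianReal_eq_integral_smul (one_ne_zero : (1 : NNReal) ≠ 0),
    smul_eq_mul]
  linarith

section Parameter

variable {E H : Type*} [NormedAddCommGroup E] [NormedSpace ℝ E]

/-- Continuity in the parameter of a Gaussian average. -/
lemma continuous_gaussian_avg {X : Type*} [TopologicalSpace X] [FirstCountableTopology X]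
    {G : E → ℝ} (hG : Continuous G) (hg : ExpGrowth G) {a b : X → E} (ha : Continuous a)
    (hb : Continuous b) :
    Continuous (fun p => ∫ z, G (a p + z • b p) ∂(gaussianReal 0 1)) := by
  obtain ⟨A, B, hA, hB, hbd⟩ := hg
  refine continuous_iff_continuousAt.2 fun p0 => ?_
  have e1 : ∀ᶠ p in 𝓝 p0, ‖a p‖ < ‖a p0‖ + 1 :=
    ha.norm.continuousAt.eventually_lt_const (by linarith)
  have e2 : ∀ᶠ p in 𝓝 p0, ‖b p‖ < ‖b p0‖ + 1 :=
    hb.norm.continuousAt.eventually_lt_const (by linarith)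
  refine continuousAt_of_dominated
    (bound := fun z => A * Real.exp (B * (‖a p0‖ + 1)) * Real.exp (B * (‖b p0‖ + 1) * |z|))
    (Eventually.of_forall fun p =>
      (hG.comp (by fun_prop : Continuous fun z : ℝ => a p + z • b p)).aestronglyMeasurable) ?_
    ((integrable_exp_mul_abs_gaussianReal _).const_mul _) (Eventually.of_forall fun z => ?_)
  · filter_upwards [e1, e2] with p h1 h2
    refine Eventually.of_forall fun z => (hbd _).trans ?_
    rw [mul_assoc, ← Real.exp_add]
    have h3 : ‖a p + z • b p‖ ≤ (‖a p0‖ + 1) + (‖b p0‖ + 1) * |z| := by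
      refine (norm_add_le _ _).trans ?_
      rw [norm_smul, mul_comm ‖z‖]
      exact add_le_add h1.le (mul_le_mul_of_nonneg_right h2.le (norm_nonneg z))
    gcongr
    nlinarith [mul_le_mul_of_nonneg_left h3 hB]
  · exact (hG.comp (by fun_prop : Continuous fun p => a p + z • b p)).continuousAt

variable [NormedAddCommGroup H] [NormedSpace ℝ H]

/-- The integrand of the derivative of a Gaussian average. -/
lemma integrable_fderiv_gaussian_avg {G' : E → E →L[ℝ] ℝ} (hg' : ExpGrowth G') (a b : E)
    (a' b' : H →L[ℝ] E)
    (hmeas : AEStronglyMeasurable (fun z : ℝ => G' (a + z • b)) (gaussianReal 0 1)) :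
    Integrable (fun z : ℝ => (G' (a + z • b)).comp (a' + z • b')) (gaussianReal 0 1) := by
  have hc : Continuous (fun z : ℝ => a' + z • b') := by fun_prop
  refine ExpGrowth.integrable ?_ ?_
  · have h1 : ExpGrowth fun z : ℝ => ‖a'‖ + |z| * ‖b'‖ := by
      refine (ExpGrowth.of_bounded (‖a'‖) (G := fun _ : ℝ => ‖a'‖) (by simp)).add ?_
      exact ExpGrowth.id_real.mono ‖b'‖ (norm_nonneg _) fun e => by
        simp [mul_comm]
    have h2 : ExpGrowth fun z : ℝ => ‖G' (a + z • b)‖ :=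
      (hg'.comp_line a b).mono 1 zero_le_one fun e => by simp
    refine (h2.mul h1).mono 1 zero_le_one fun z => ?_
    refine (ContinuousLinearMap.opNorm_comp_le _ _).trans ?_
    rw [one_mul, norm_mul, norm_norm, Real.norm_of_nonneg (by positivity)]
    gcongr
    refine (norm_add_le _ _).trans ?_
    rw [norm_smul, Real.norm_eq_abs]
  · exact (ContinuousLinearMap.compL ℝ H E ℝ).aestronglyMeasurable_comp₂ hmeas
      hc.aestronglyMeasurable

/-- Differentiation under a Gaussian average `p ↦ ∫ G (a p + z b p) dγ(z)`. -/
lemma hasFDerivAt_gaussian_avg {G : E → ℝ} {G' : E → E →L[ℝ] ℝ}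
    (hG : ∀ e, HasFDerivAt G (G' e) e) (hg : ExpGrowth G) (hg' : ExpGrowth G')
    {a b : H → E} {a' b' : H → H →L[ℝ] E} {p0 : H}
    (ha : ∀ᶠ p in 𝓝 p0, HasFDerivAt a (a' p) p) (hb : ∀ᶠ p in 𝓝 p0, HasFDerivAt b (b' p) p)
    (ha' : ContinuousAt a' p0) (hb' : ContinuousAt b' p0)
    (hmeas : AEStronglyMeasurable (fun z : ℝ => G' (a p0 + z • b p0)) (gaussianReal 0 1)) :
    HasFDerivAt (fun p => ∫ z, G (a p + z • b p) ∂(gaussianReal 0 1))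
      (∫ z, (G' (a p0 + z • b p0)).comp (a' p0 + z • b' p0) ∂(gaussianReal 0 1)) p0 := by
  have hGc : Continuous G := continuous_iff_continuousAt.2 fun e => (hG e).continuousAt
  obtain ⟨A, B, hA, hB, hbd⟩ := hg'
  have e1 : ∀ᶠ p in 𝓝 p0, ‖a p‖ < ‖a p0‖ + 1 :=
    ha.self_of_nhds.continuousAt.norm.eventually_lt_const (by linarith)
  have e2 : ∀ᶠ p in 𝓝 p0, ‖b p‖ < ‖b p0‖ + 1 :=
    hb.self_of_nhds.continuousAt.norm.eventually_lt_const (by linarith)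
  have e3 : ∀ᶠ p in 𝓝 p0, ‖a' p‖ < ‖a' p0‖ + 1 :=
    ha'.norm.eventually_lt_const (by linarith)
  have e4 : ∀ᶠ p in 𝓝 p0, ‖b' p‖ < ‖b' p0‖ + 1 :=
    hb'.norm.eventually_lt_const (by linarith)
  have hs := (ha.and (hb.and (e1.and (e2.and (e3.and e4)))))
  refine hasFDerivAt_integral_of_dominated_of_fderiv_le (s := {p | _}) hs
    (F' := fun p z => (G' (a p + z • b p)).comp (a' p + z • b' p))
    (bound := fun z => (A * Real.exp (B * (‖a p0‖ + 1)) * Real.exp (B * (‖b p0‖ + 1) * |z|)) *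
      ((‖a' p0‖ + 1) + (‖b' p0‖ + 1) * |z|))
    (Eventually.of_forall fun p =>
      (hGc.comp (by fun_prop : Continuous fun z : ℝ => a p + z • b p)).aestronglyMeasurable)
    ((hg.comp_line _ _).integrable
      (hGc.comp (by fun_prop : Continuous fun z : ℝ => a p0 + z • b p0)).aestronglyMeasurable)
    ?_ (Eventually.of_forall fun z p hp => ?_) ?_ (Eventually.of_forall fun z p hp => ?_)
  · exact (integrable_fderiv_gaussian_avg ⟨A, B, hA, hB, hbd⟩ _ _ _ _ hmeas).aestronglyMeasurable
  · obtain ⟨-, -, h1, h2, h3, h4⟩ := hp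
    refine (ContinuousLinearMap.opNorm_comp_le _ _).trans ?_
    gcongr
    · refine (hbd _).trans ?_
      rw [mul_assoc, ← Real.exp_add]
      have h3 : ‖a p + z • b p‖ ≤ (‖a p0‖ + 1) + (‖b p0‖ + 1) * |z| := by
        refine (norm_add_le _ _).trans ?_
        rw [norm_smul, mul_comm ‖z‖]
        exact add_le_add h1.le (mul_le_mul_of_nonneg_right h2.le (norm_nonneg z))
      gcongr
      nlinarith [mul_le_mul_of_nonneg_left h3 hB]
    · refine (norm_add_le _ _).trans ?_
      rw [norm_smul, mul_comm ‖z‖]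
      exact add_le_add h3.le (mul_le_mul_of_nonneg_right h4.le (norm_nonneg z))
  · refine ExpGrowth.integrable ?_ (by fun_prop)
    have h1 : ExpGrowth fun z : ℝ => Real.exp (B * (‖b p0‖ + 1) * |z|) :=
      ExpGrowth.exp_of_le 0 (B * (‖b p0‖ + 1)) (by positivity) fun z => by simp
    have h2 : ExpGrowth fun z : ℝ => (‖a' p0‖ + 1) + (‖b' p0‖ + 1) * |z| := by
      refine (ExpGrowth.of_bounded (‖a' p0‖ + 1) (G := fun _ : ℝ => ‖a' p0‖ + 1) ?_).add ?_
      · intro e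
        rw [Real.norm_of_nonneg (by positivity)]
      · refine ExpGrowth.const_mul ?_ _
        exact ExpGrowth.id_real.mono 1 zero_le_one fun e => by simp
    exact (h1.const_mul _).mul h2
  · obtain ⟨h1, h2, -⟩ := hp
    exact (hG _).comp p (h1.add (h2.const_smul z))

/-- The case of `hasFDerivAt_gaussian_avg` of a real parameter. -/
lemma hasDerivAt_gaussian_avg {G : E → ℝ} {G' : E → E →L[ℝ] ℝ}
    (hG : ∀ e, HasFDerivAt G (G' e) e) (hg : ExpGrowth G) (hg' : ExpGrowth G')
    {a b a' b' : ℝ → E} {p0 : ℝ}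
    (ha : ∀ᶠ p in 𝓝 p0, HasDerivAt a (a' p) p) (hb : ∀ᶠ p in 𝓝 p0, HasDerivAt b (b' p) p)
    (ha' : ContinuousAt a' p0) (hb' : ContinuousAt b' p0)
    (hmeas : AEStronglyMeasurable (fun z : ℝ => G' (a p0 + z • b p0)) (gaussianReal 0 1)) :
    HasDerivAt (fun p => ∫ z, G (a p + z • b p) ∂(gaussianReal 0 1))
      (∫ z, G' (a p0 + z • b p0) (a' p0 + z • b' p0) ∂(gaussianReal 0 1)) p0 := by
  let L := ContinuousLinearMap.toSpanSingletonCLE (𝕜 := ℝ) (E := E)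
  have hL : Continuous fun e : E => ContinuousLinearMap.toSpanSingleton ℝ e := L.continuous
  have h := hasFDerivAt_gaussian_avg hG hg hg'
    (a' := fun p => ContinuousLinearMap.toSpanSingleton ℝ (a' p))
    (b' := fun p => ContinuousLinearMap.toSpanSingleton ℝ (b' p))
    (ha.mono fun p hp => hp.hasFDerivAt) (hb.mono fun p hp => hp.hasFDerivAt)
    (hL.continuousAt.comp ha') (hL.continuousAt.comp hb') hmeas
  refine h.hasDerivAt.congr_deriv ?_
  rw [ContinuousLinearMap.integral_apply
    (integrable_fderiv_gaussian_avg hg' _ _ _ _ hmeas)]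
  simp

end Parameter

/-! ### Functional order parameters -/

lemma exists_mem_Ioc_of_partition {K : ℕ} {q : Fin (K + 1) → ℝ} {s : ℝ} (h0 : q 0 < s)
    (i : Fin (K + 1)) (hi : s ≤ q i) : ∃ a : Fin K, s ∈ Ioc (q a.castSucc) (q a.succ) := by
  induction i using Fin.induction with
  | zero => exact absurd hi (not_le.2 h0)
  | succ i ih =>
    by_cases h : s ≤ q i.castSucc
    · exact ih h
    · exact ⟨i, not_le.1 h, hi⟩

lemma chi_mem_Icc {n : ℝ} {x : ℝ → ℝ} (hx : x ∈ chi n) {s : ℝ} (hs : s ∈ Ioc (0 : ℝ) 1) :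
    x s ∈ Icc n 1 := by
  obtain ⟨K, q, m, -, h0, h1, -, hm, hx⟩ := hx
  obtain ⟨a, ha⟩ := exists_mem_Ioc_of_partition (q := q) (by rw [h0]; exact hs.1) (Fin.last K)
    (by rw [h1]; exact hs.2)
  rw [hx a s ha]
  exact hm a

lemma chi_monotoneOn {n : ℝ} {x : ℝ → ℝ} (hx : x ∈ chi n) : MonotoneOn x (Ioc 0 1) := by
  obtain ⟨K, q, m, hq, h0, h1, hmm, -, hx⟩ := hx
  intro s hs t ht hst
  obtain ⟨a, ha⟩ := exists_mem_Ioc_of_partition (q := q) (by rw [h0]; exact hs.1) (Fin.last K)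
    (by rw [h1]; exact hs.2)
  obtain ⟨b, hb⟩ := exists_mem_Ioc_of_partition (q := q) (by rw [h0]; exact ht.1) (Fin.last K)
    (by rw [h1]; exact ht.2)
  rw [hx a s ha, hx b t hb]
  refine hmm ?_
  by_contra hab
  have h2 : q b.succ ≤ q a.castSucc := hq (by
    rw [Fin.le_def]; simp only [Fin.val_succ, Fin.val_castSucc]; exact not_le.1 hab)
  linarith [ha.1, hb.2]

/-- The jumps of an order parameter form a finite set. -/
lemma chi_continuousAt {n : ℝ} {x : ℝ → ℝ} (hx : x ∈ chi n) :
    ∃ F : Finset ℝ, ∀ s ∈ Ioo (0 : ℝ) 1, s ∉ F → ContinuousAt x s := by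
  obtain ⟨K, q, m, -, h0, h1, -, -, hx⟩ := hx
  refine ⟨Finset.univ.image q, fun s hs hsF => ?_⟩
  obtain ⟨a, ha⟩ := exists_mem_Ioc_of_partition (q := q) (by rw [h0]; exact hs.1) (Fin.last K)
    (by rw [h1]; exact hs.2.le)
  have hne : s ≠ q a.succ := fun h => hsF (by rw [h]; simp)
  have hev : x =ᶠ[𝓝 s] fun _ => m a := by
    filter_upwards [Ioo_mem_nhds ha.1 (lt_of_le_of_ne ha.2 hne)] with t ht
    exact hx a t (Ioo_subset_Ioc_self ht)
  exact continuousAt_const.congr hev.symm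

lemma chi_integrableOn {n : ℝ} {x : ℝ → ℝ} (hn : 0 ≤ n) (hx : x ∈ chi n) :
    IntegrableOn x (Ioc 0 1) := by
  have h := (chi_monotoneOn hx)
  refine Integrable.mono' (g := fun _ => 1) (by simp)
    (aemeasurable_restrict_of_monotoneOn measurableSet_Ioc h).aestronglyMeasurable ?_
  filter_upwards [ae_restrict_mem measurableSet_Ioc] with s hs
  have := chi_mem_Icc hx hs
  rw [Real.norm_of_nonneg (hn.trans this.1)]
  exact this.2

lemma chi_intervalIntegrable {n : ℝ} {x : ℝ → ℝ} (hn : 0 ≤ n) (hx : x ∈ chi n) {a b : ℝ}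
    (ha : a ∈ Icc (0 : ℝ) 1) (hb : b ∈ Icc (0 : ℝ) 1) : IntervalIntegrable x volume a b := by
  rw [intervalIntegrable_iff]
  refine (chi_integrableOn hn hx).mono_set ?_
  rw [uIoc]
  exact Ioc_subset_Ioc (le_min ha.1 hb.1) (max_le ha.2 hb.2)

lemma chi_mono {n n' : ℝ} (h : n ≤ n') : chi n' ⊆ chi n := by
  rintro x ⟨K, q, m, hq, h0, h1, hmm, hm, hx⟩
  exact ⟨K, q, m, hq, h0, h1, hmm, fun a => ⟨h.trans (hm a).1, (hm a).2⟩, hx⟩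

lemma one_mem_chi {n : ℝ} (hn : n ≤ 1) : (fun _ => (1 : ℝ)) ∈ chi n := by
  refine ⟨1, ![0, 1], fun _ => 1, ?_, rfl, rfl, monotone_const, fun _ => ⟨hn, le_rfl⟩,
    fun _ _ _ => rfl⟩
  rw [Fin.monotone_iff_le_succ]
  intro i
  fin_cases i
  simp

lemma max_mem_chi {n : ℝ} (hn : n ≤ 1) {x : ℝ → ℝ} (hx : x ∈ chi 0) :
    (fun q => max (x q) n) ∈ chi n := by
  obtain ⟨K, q, m, hq, h0, h1, hmm, hm, hx⟩ := hx
  exact ⟨K, q, fun a => max (m a) n, hq, h0, h1, fun a b hab => max_le_max (hmm hab) le_rfl,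
    fun a => ⟨le_max_right _ _, max_le (hm a).2 hn⟩, fun a s hs => by simp only [hx a s hs]⟩

/-! ### A maximum principle and the stability of the Parisi equation -/

lemma deriv_deriv_nonpos_of_isLocalMax {g : ℝ → ℝ} {y : ℝ} (hg : ContDiff ℝ 2 g)
    (h : IsLocalMax g y) : deriv (deriv g) y ≤ 0 := by
  by_contra! hpos
  have hmin := isLocalMin_of_deriv_deriv_pos hpos h.deriv_eq_zero hg.continuous.continuousAt
  have hc : g =ᶠ[𝓝 y] fun _ => g y := by
    filter_upwards [h, hmin] with z h1 h2 using le_antisymm h1 h2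
  have hd : deriv g =ᶠ[𝓝 y] fun _ => 0 := by
    filter_upwards [hc.deriv] with z hz
    simpa using hz
  have := hd.deriv_eq
  simp at this
  linarith

lemma deriv_nonpos_of_le_right {g : ℝ → ℝ} {q b : ℝ} (hqb : q < b) (hg : DifferentiableAt ℝ g q)
    (h : ∀ s ∈ Ioo q b, g s ≤ g q) : deriv g q ≤ 0 := by
  have h1 := (hasDerivWithinAt_iff_tendsto_slope' (s := Ioi q) self_notMem_Ioi).1
    hg.hasDerivAt.hasDerivWithinAt
  refine le_of_tendsto h1 ?_
  filter_upwards [Ioo_mem_nhdsGT hqb] with s hs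
  rw [slope_def_field]
  exact div_nonpos_of_nonpos_of_nonneg (sub_nonpos.2 (h s hs)) (sub_nonneg.2 hs.1.le)

/-- A maximum principle for subsolutions of at most linear growth of a backward parabolic
inequality with bounded drift. -/
lemma parabolic_max_principle {w : ℝ → ℝ → ℝ} {a b A B M : ℝ} (hA : 0 ≤ A) (hB : 0 ≤ B)
    (hc : ContinuousOn (fun p : ℝ × ℝ => w p.1 p.2) (Icc a b ×ˢ univ))
    (hgr : ∀ q ∈ Icc a b, ∀ y, w q y ≤ A * (1 + |y|))
    (hC : ∀ q ∈ Ioo a b, ContDiff ℝ 2 (w q))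
    (hd : ∀ q ∈ Ioo a b, ∀ y, DifferentiableAt ℝ (fun s => w s y) q)
    (heq : ∀ q ∈ Ioo a b, ∀ y, 0 ≤ deriv (fun s => w s y) q + 1 / 2 * deriv (deriv (w q)) y
      + B * |deriv (w q) y|)
    (hM : ∀ y, w b y ≤ M) : ∀ q ∈ Icc a b, ∀ y, w q y ≤ M := by
  have main : ∀ q ∈ Ioo a b, ∀ y, w q y ≤ M := by
    intro q0 hq0 y0
    by_contra! hlt
    set K : ℝ := 2 + B with hK
    -- the barrier `ε exp(K (b - q)) (1 + y²)` is a strict supersolution dominating `w` at infinity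
    obtain ⟨ε, hε, hεlt⟩ : ∃ ε > 0, ε * (Real.exp (K * (b - q0)) * (1 + y0 ^ 2)) < w q0 y0 - M := by
      have hpos : 0 < Real.exp (K * (b - q0)) * (1 + y0 ^ 2) := by positivity
      refine ⟨(w q0 y0 - M) / (2 * (Real.exp (K * (b - q0)) * (1 + y0 ^ 2))),
        div_pos (by linarith) (by positivity), ?_⟩
      rw [div_mul_eq_mul_div, div_lt_iff₀ (by positivity)]
      nlinarith [mul_pos hpos (sub_pos.2 hlt)]
    set v : ℝ × ℝ → ℝ := fun p => w p.1 p.2 - ε * (Real.exp (K * (b - p.1)) * (1 + p.2 ^ 2))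
      with hv
    have hv0 : M < v (q0, y0) := by simp only [hv]; linarith
    set R : ℝ := 1 + |y0| + 2 / ε * (A + A ^ 2 / (2 * ε) + |M|) with hR
    have hRy : |y0| ≤ R := by
      have : 0 ≤ 2 / ε * (A + A ^ 2 / (2 * ε) + |M|) := by positivity
      linarith
    have hR1 : 1 ≤ R := by
      have : 0 ≤ 2 / ε * (A + A ^ 2 / (2 * ε) + |M|) := by positivity
      linarith [abs_nonneg y0]
    have hfar : ∀ q ∈ Icc a b, ∀ y, R ≤ |y| → v (q, y) ≤ M := by
      intro q hq y hy
      have h1 := hgr q hq y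
      have h2 : 1 ≤ Real.exp (K * (b - q)) :=
        Real.one_le_exp (mul_nonneg (by linarith) (by linarith [hq.2]))
      have h3 : ε * (1 + y ^ 2) ≤ ε * (Real.exp (K * (b - q)) * (1 + y ^ 2)) := by
        gcongr
        nlinarith [sq_nonneg y]
      have h4 : A * |y| ≤ ε * y ^ 2 / 2 + A ^ 2 / (2 * ε) := by
        have h5 : 0 ≤ (ε * |y| - A) ^ 2 / (2 * ε) := by positivity
        have h6 : (ε * |y| - A) ^ 2 / (2 * ε) = ε * y ^ 2 / 2 + A ^ 2 / (2 * ε) - A * |y| := by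
          rw [← sq_abs y]; field_simp; ring
        linarith
      have h7 : |y| ≤ y ^ 2 := by
        rw [← sq_abs y]; nlinarith
      have h8 : A + A ^ 2 / (2 * ε) + |M| ≤ ε / 2 * y ^ 2 := by
        have h9 : 2 / ε * (A + A ^ 2 / (2 * ε) + |M|) ≤ y ^ 2 := by
          linarith [abs_nonneg y0]
        calc _ = ε / 2 * (2 / ε * (A + A ^ 2 / (2 * ε) + |M|)) := by field_simp
          _ ≤ _ := by gcongr
      simp only [hv]
      linarith [neg_abs_le M]
    have hcv : ContinuousOn v (Icc q0 b ×ˢ Icc (-R) R) := by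
      refine ContinuousOn.sub (hc.mono ?_) (by fun_prop)
      exact prod_mono (Icc_subset_Icc hq0.1.le le_rfl) (subset_univ _)
    obtain ⟨⟨q, y⟩, ⟨hqm, hym⟩, hmax⟩ := (isCompact_Icc.prod isCompact_Icc).exists_isMaxOn
      ⟨(q0, y0), ⟨⟨le_rfl, hq0.2.le⟩, abs_le.1 hRy⟩⟩ hcv
    have hvM : M < v (q, y) := hv0.trans_le (hmax ⟨⟨le_rfl, hq0.2.le⟩, abs_le.1 hRy⟩)
    simp only at hqm hym
    have hqab : q ∈ Icc a b := ⟨hq0.1.le.trans hqm.1, hqm.2⟩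
    have hqb : q < b := by
      refine lt_of_le_of_ne hqm.2 fun h => ?_
      have h1 := hM y
      have h2 : 0 ≤ ε * (Real.exp (K * (b - q)) * (1 + y ^ 2)) := by positivity
      simp only [hv] at hvM
      rw [h] at hvM h2
      linarith
    have hyR : |y| < R := by
      by_contra! h
      linarith [hfar q hqab y h]
    have hqI : q ∈ Ioo a b := ⟨hq0.1.trans_le hqm.1, hqb⟩
    set c : ℝ := ε * Real.exp (K * (b - q)) with hcdef
    have hcpos : 0 < c := by positivity
    have hw2 := hC q hqI
    have hw1d : Differentiable ℝ (w q) := hw2.differentiable (by norm_num)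
    have hw2d : Differentiable ℝ (deriv (w q)) := by
      have := hw2.iterate_deriv' 1 1
      exact this.differentiable (by norm_num)
    have hpoly : ∀ z, HasDerivAt (fun z : ℝ => c * (1 + z ^ 2)) (2 * c * z) z := by
      intro z
      have := (((hasDerivAt_id z).pow 2).const_add 1).const_mul c
      refine this.congr_deriv ?_
      simp; ring
    have hder1 : deriv (fun z => w q z - c * (1 + z ^ 2)) = fun z => deriv (w q) z - 2 * c * z := by
      ext z
      exact ((hw1d z).hasDerivAt.sub (hpoly z)).deriv
    have hder2 : deriv (fun z => deriv (w q) z - 2 * c * z) y = deriv (deriv (w q)) y - 2 * c := by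
      have := ((hw2d y).hasDerivAt.sub ((hasDerivAt_id y).const_mul (2 * c)))
      rw [mul_one] at this
      exact this.deriv
    have hloc : IsLocalMax (fun z => w q z - c * (1 + z ^ 2)) y := by
      filter_upwards [Ioo_mem_nhds (abs_lt.1 hyR).1 (abs_lt.1 hyR).2] with z hz
      have := hmax (show (q, z) ∈ Icc q0 b ×ˢ Icc (-R) R from ⟨hqm, hz.1.le, hz.2.le⟩)
      simp only [hv, mem_ofPred_eq] at this
      simp only [hcdef]
      linarith
    have hy1 : deriv (w q) y = 2 * c * y := by
      have := hloc.deriv_eq_zero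
      rw [hder1] at this
      linarith
    have hy2 : deriv (deriv (w q)) y ≤ 2 * c := by
      have := deriv_deriv_nonpos_of_isLocalMax (hw2.sub (by fun_prop)) hloc
      rw [hder1, hder2] at this
      linarith
    have hexp : HasDerivAt (fun s => ε * (Real.exp (K * (b - s)) * (1 + y ^ 2)))
        (-K * c * (1 + y ^ 2)) q := by
      have := ((((hasDerivAt_id q).const_sub b).const_mul K).exp.mul_const (1 + y ^ 2)).const_mul ε
      refine this.congr_deriv ?_
      simp [hcdef]; ring
    have hq1 : deriv (fun s => w s y) q ≤ -K * c * (1 + y ^ 2) := by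
      have h1 := (hd q hqI y).hasDerivAt.sub hexp
      have h2 := deriv_nonpos_of_le_right hqb h1.differentiableAt (fun s hs => by
        have := hmax (show (s, y) ∈ Icc q0 b ×ˢ Icc (-R) R from
          ⟨⟨hqm.1.trans hs.1.le, hs.2.le⟩, hym⟩)
        exact this)
      rw [h1.deriv] at h2
      linarith
    have hfin := heq q hqI y
    rw [hy1, abs_mul, abs_of_pos (by positivity : 0 < 2 * c)] at hfin
    have h5 : 2 * |y| ≤ 1 + y ^ 2 := by
      rw [← sq_abs y]; nlinarith [sq_nonneg (|y| - 1)]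
    have h6 : B * (2 * c * |y|) ≤ B * c * (1 + y ^ 2) := by
      have := mul_le_mul_of_nonneg_left h5 (mul_nonneg hB hcpos.le)
      linarith
    have h7 : -K * c * (1 + y ^ 2) + 1 / 2 * (2 * c) + B * c * (1 + y ^ 2) < 0 := by
      rw [hK]
      nlinarith [mul_nonneg hcpos.le (sq_nonneg y)]
    linarith
  intro q hq y
  rcases eq_or_lt_of_le hq.2 with h | hqb
  · rw [h]; exact hM y
  rcases eq_or_lt_of_le hq.1 with h | haq
  swap
  · exact main q ⟨haq, hqb⟩ y
  subst h
  have h1 : Tendsto (fun s => w s y) (𝓝[Icc a b] a) (𝓝 (w a y)) := by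
    have h2 := hc (a, y) ⟨hq, mem_univ _⟩
    have h3 : ContinuousWithinAt (fun s : ℝ => (s, y)) (Icc a b) a := by fun_prop
    exact ContinuousWithinAt.comp (t := Icc a b ×ˢ univ) (f := fun s : ℝ => (s, y)) h2 h3
      (fun s hs => ⟨hs, mem_univ _⟩)
  have h4 : (𝓝[Ioo a b] a).NeBot := left_nhdsWithin_Ioo_neBot hqb
  refine le_of_tendsto (h1.mono_left (nhdsWithin_mono a Ioo_subset_Icc_self)) ?_
  filter_upwards [self_mem_nhdsWithin] with s hs
  exact main s hs y

/-- The maximum principle when the differential inequality fails at finitely many times. -/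
lemma parabolic_max_principle_of_finite {w : ℝ → ℝ → ℝ} {A B : ℝ} (hA : 0 ≤ A) (hB : 0 ≤ B)
    (F : Finset ℝ) {a b M : ℝ}
    (hc : ContinuousOn (fun p : ℝ × ℝ => w p.1 p.2) (Icc a b ×ˢ univ))
    (hgr : ∀ q ∈ Icc a b, ∀ y, w q y ≤ A * (1 + |y|))
    (hC : ∀ q ∈ Ioo a b, q ∉ F → ContDiff ℝ 2 (w q))
    (hd : ∀ q ∈ Ioo a b, q ∉ F → ∀ y, DifferentiableAt ℝ (fun s => w s y) q)
    (heq : ∀ q ∈ Ioo a b, q ∉ F → ∀ y, 0 ≤ deriv (fun s => w s y) q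
      + 1 / 2 * deriv (deriv (w q)) y + B * |deriv (w q) y|)
    (hM : ∀ y, w b y ≤ M) : ∀ q ∈ Icc a b, ∀ y, w q y ≤ M := by
  induction F using Finset.induction_on generalizing a b M with
  | empty =>
    exact parabolic_max_principle hA hB hc hgr (fun q hq => hC q hq (by simp))
      (fun q hq => hd q hq (by simp)) (fun q hq => heq q hq (by simp)) hM
  | insert c F _ ih =>
    by_cases hcI : c ∈ Ioo a b
    · have hr : ∀ q ∈ Icc c b, ∀ y, w q y ≤ M := by
        have hsub : Icc c b ⊆ Icc a b := Icc_subset_Icc hcI.1.le le_rfl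
        have hsub' : Ioo c b ⊆ Ioo a b := Ioo_subset_Ioo hcI.1.le le_rfl
        have hnot : ∀ q ∈ Ioo c b, q ∉ F → q ∉ insert c F := fun q hq hF h => by
          rcases Finset.mem_insert.1 h with rfl | h
          exacts [lt_irrefl _ hq.1, hF h]
        exact ih (hc.mono (prod_mono hsub le_rfl)) (fun q hq => hgr q (hsub hq))
          (fun q hq hF => hC q (hsub' hq) (hnot q hq hF))
          (fun q hq hF => hd q (hsub' hq) (hnot q hq hF))
          (fun q hq hF => heq q (hsub' hq) (hnot q hq hF)) hM
      have hl : ∀ q ∈ Icc a c, ∀ y, w q y ≤ M := by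
        have hsub : Icc a c ⊆ Icc a b := Icc_subset_Icc le_rfl hcI.2.le
        have hsub' : Ioo a c ⊆ Ioo a b := Ioo_subset_Ioo le_rfl hcI.2.le
        have hnot : ∀ q ∈ Ioo a c, q ∉ F → q ∉ insert c F := fun q hq hF h => by
          rcases Finset.mem_insert.1 h with rfl | h
          exacts [lt_irrefl _ hq.2, hF h]
        exact ih (hc.mono (prod_mono hsub le_rfl)) (fun q hq => hgr q (hsub hq))
          (fun q hq hF => hC q (hsub' hq) (hnot q hq hF))
          (fun q hq hF => hd q (hsub' hq) (hnot q hq hF))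
          (fun q hq hF => heq q (hsub' hq) (hnot q hq hF)) (hr c ⟨le_rfl, hcI.2.le⟩)
      intro q hq y
      rcases le_total q c with h | h
      · exact hl q ⟨hq.1, h⟩ y
      · exact hr q ⟨h, hq.2⟩ y
    · have hnot : ∀ q ∈ Ioo a b, q ∉ F → q ∉ insert c F := fun q hq hF h => by
        rcases Finset.mem_insert.1 h with rfl | h
        exacts [hcI hq, hF h]
      exact ih hc hgr (fun q hq hF => hC q hq (hnot q hq hF))
        (fun q hq hF => hd q hq (hnot q hq hF))
        (fun q hq hF => heq q hq (hnot q hq hF)) hM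

namespace IsParisiSolution

variable {β : ℝ} {x x' : ℝ → ℝ} {f g : ℝ → ℝ → ℝ}

/-- A solution grows at most linearly in `y`, uniformly in `q`. -/
lemma abs_le_linear (hf : IsParisiSolution β x f) :
    ∃ A, 0 ≤ A ∧ ∀ q ∈ Icc (0 : ℝ) 1, ∀ y, |f q y| ≤ A * (1 + |y|) := by
  obtain ⟨C, hC⟩ := hf.lipschitz
  have hc : ContinuousOn (fun q => f q 0) (Icc 0 1) := by
    have h3 : ContinuousOn (fun s : ℝ => (s, (0 : ℝ))) (Icc 0 1) := by fun_prop
    exact hf.continuousOn.comp h3 (fun s hs => ⟨hs, mem_univ _⟩)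
  obtain ⟨M, hM⟩ := isCompact_Icc.exists_bound_of_continuousOn hc
  refine ⟨C + |M|, by positivity, fun q hq y => ?_⟩
  have h1 := (hC q hq).dist_le_mul y 0
  rw [Real.dist_eq, Real.dist_eq, sub_zero] at h1
  have h2 : |f q 0| ≤ |M| := (hM q hq).trans (le_abs_self M)
  have h3 : |f q y| ≤ |f q y - f q 0| + |f q 0| := by
    simpa using abs_add_le (f q y - f q 0) (f q 0)
  nlinarith [abs_nonneg y, abs_nonneg M, C.coe_nonneg]

lemma abs_deriv_le (hf : IsParisiSolution β x f) :
    ∃ C, 0 ≤ C ∧ ∀ q ∈ Icc (0 : ℝ) 1, ∀ y, |deriv (f q) y| ≤ C := by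
  obtain ⟨C, hC⟩ := hf.lipschitz
  exact ⟨C, C.coe_nonneg, fun q hq y => norm_deriv_le_of_lipschitz (hC q hq)⟩

/-- Stability of the Parisi equation in `L¹`: the difference `f - g` of two solutions satisfies a
linear inequality with drift `x' (∂_y f + ∂_y g) / 2` and source `(x - x') (∂_y f)² / 2`, so that
only the Lipschitz constant of one of them enters. -/
lemma sub_le (hf : IsParisiSolution β x f) (hx : x ∈ chi 0) {C : ℝ}
    (hC : ∀ q ∈ Icc (0 : ℝ) 1, ∀ y, |deriv (f q) y| ≤ C) (hg : IsParisiSolution β x' g)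
    (hx' : x' ∈ chi 0) {q : ℝ} (hq : q ∈ Icc (0 : ℝ) 1) (y : ℝ) :
    |f q y - g q y| ≤ C ^ 2 / 2 * ∫ s in q..1, |x s - x' s| := by
  obtain ⟨A, hA, hAf⟩ := hf.abs_le_linear
  obtain ⟨A', hA', hAg⟩ := hg.abs_le_linear
  obtain ⟨C', hC'0, hC'⟩ := hg.abs_deriv_le
  have hC0 : 0 ≤ C := (abs_nonneg _).trans (hC 0 (by simp) 0)
  obtain ⟨F, hF⟩ := chi_continuousAt hx
  obtain ⟨F', hF'⟩ := chi_continuousAt hx'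
  set I : ℝ → ℝ := fun q => C ^ 2 / 2 * ∫ s in q..1, |x s - x' s| with hI
  have hint : ∀ a ∈ Icc (0 : ℝ) 1, ∀ b ∈ Icc (0 : ℝ) 1,
      IntervalIntegrable (fun s => |x s - x' s|) volume a b := fun a ha b hb =>
    ((chi_intervalIntegrable le_rfl hx ha hb).sub (chi_intervalIntegrable le_rfl hx' ha hb)).abs
  have hIc : ContinuousOn I (Icc 0 1) := by
    have h1 := intervalIntegral.continuousOn_primitive_interval_left
      (f := fun s => |x s - x' s|) (μ := volume) (a := (0 : ℝ)) (b := 1)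
      (by
        have := (hint 0 (by simp) 1 (by simp))
        rw [uIcc_of_le zero_le_one, integrableOn_Icc_iff_integrableOn_Ioc]
        exact (intervalIntegrable_iff_integrableOn_Ioc_of_le zero_le_one).1 this)
    rw [uIcc_of_le zero_le_one] at h1
    exact h1.const_smul (C ^ 2 / 2)
  have hI0 : ∀ q ∈ Icc (0 : ℝ) 1, 0 ≤ I q := fun q hq =>
    mul_nonneg (by positivity)
      (intervalIntegral.integral_nonneg hq.2 fun s _ => abs_nonneg _)
  have hId : ∀ q ∈ Ioo (0 : ℝ) 1, q ∉ F ∪ F' →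
      HasDerivAt I (-(C ^ 2 / 2 * |x q - x' q|)) q := by
    intro q hq hqF
    have hqF1 : q ∉ F := fun h => hqF (Finset.mem_union_left _ h)
    have hqF2 : q ∉ F' := fun h => hqF (Finset.mem_union_right _ h)
    have h1 : StronglyMeasurableAtFilter (fun s => |x s - x' s|) (𝓝 q) volume :=
      ⟨Ioc 0 1, Ioc_mem_nhds hq.1 hq.2,
        (((chi_integrableOn le_rfl hx).sub (chi_integrableOn le_rfl hx')).abs).aestronglyMeasurable⟩
    have h2 : ContinuousAt (fun s => |x s - x' s|) q :=
      ((hF q hq hqF1).sub (hF' q hq hqF2)).abs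
    have h3 := intervalIntegral.integral_hasDerivAt_left
      (hint q (Ioo_subset_Icc_self hq) 1 (by simp)) h1 h2
    refine (h3.const_mul (C ^ 2 / 2)).congr_deriv (by ring)
  -- one-sided bound for both signs `σ = ±1`
  have key : ∀ σ : ℝ, (σ = 1 ∨ σ = -1) → ∀ q ∈ Icc (0 : ℝ) 1, ∀ y,
      σ * (f q y - g q y) - I q ≤ 0 := by
    intro σ hσ
    have hσ1 : |σ| = 1 := by rcases hσ with rfl | rfl <;> simp
    refine parabolic_max_principle_of_finite (A := A + A') (B := (C + C') / 2)
      (w := fun q y => σ * (f q y - g q y) - I q) (by positivity) (by positivity) (F ∪ F') ?_ ?_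
      ?_ ?_ ?_ ?_
    · refine ((hf.continuousOn.sub hg.continuousOn).const_smul σ).sub ?_
      exact hIc.comp continuous_fst.continuousOn (fun p hp => hp.1)
    · intro q hq y
      have h1 : σ * (f q y - g q y) ≤ |f q y| + |g q y| := by
        refine (le_abs_self _).trans ?_
        rw [abs_mul, hσ1, one_mul]
        exact abs_sub _ _
      linarith [hAf q hq y, hAg q hq y, hI0 q hq]
    · intro q hq hqF
      have h1 := hf.contDiff q hq (hF q hq fun h => hqF (Finset.mem_union_left _ h))
      have h2 := hg.contDiff q hq (hF' q hq fun h => hqF (Finset.mem_union_right _ h))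
      exact (contDiff_const.mul (h1.sub h2)).sub contDiff_const
    · intro q hq hqF y
      have h1 := (hf.equation q hq (hF q hq fun h => hqF (Finset.mem_union_left _ h)) y).1
      have h2 := (hg.equation q hq (hF' q hq fun h => hqF (Finset.mem_union_right _ h)) y).1
      exact ((h1.sub h2).const_mul σ).sub (hId q hq hqF).differentiableAt
    · intro q hq hqF y
      have hxc := hF q hq fun h => hqF (Finset.mem_union_left _ h)
      have hxc' := hF' q hq fun h => hqF (Finset.mem_union_right _ h)
      have f2 := hf.contDiff q hq hxc
      have g2 := hg.contDiff q hq hxc'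
      have f1d : Differentiable ℝ (f q) := f2.differentiable (by norm_num)
      have g1d : Differentiable ℝ (g q) := g2.differentiable (by norm_num)
      have f2d : Differentiable ℝ (deriv (f q)) :=
        (f2.iterate_deriv' 1 1).differentiable (by norm_num)
      have g2d : Differentiable ℝ (deriv (g q)) :=
        (g2.iterate_deriv' 1 1).differentiable (by norm_num)
      obtain ⟨fq, feq⟩ := hf.equation q hq hxc y
      obtain ⟨gq, geq⟩ := hg.equation q hq hxc' y
      have d1 : deriv (fun y => σ * (f q y - g q y) - I q)
          = fun y => σ * (deriv (f q) y - deriv (g q) y) := by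
        ext z
        exact ((((f1d z).hasDerivAt.sub (g1d z).hasDerivAt).const_mul σ).sub_const (I q)).deriv
      have d2 : deriv (fun y => σ * (deriv (f q) y - deriv (g q) y)) y
          = σ * (deriv (deriv (f q)) y - deriv (deriv (g q)) y) :=
        (((f2d y).hasDerivAt.sub (g2d y).hasDerivAt).const_mul σ).deriv
      have d3 : deriv (fun s => σ * (f s y - g s y) - I s) q
          = σ * (deriv (fun s => f s y) q - deriv (fun s => g s y) q)
            - -(C ^ 2 / 2 * |x q - x' q|) :=
        (((fq.hasDerivAt.sub gq.hasDerivAt).const_mul σ).sub (hId q hq hqF)).deriv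
      rw [d1, d2, d3]
      have hqI : q ∈ Icc (0 : ℝ) 1 := Ioo_subset_Icc_self hq
      set p := deriv (f q) y with hp
      set r := deriv (g q) y with hr
      have hp1 : |p| ≤ C := hC q hqI y
      have hr1 : |r| ≤ C' := hC' q hqI y
      have hx1 := chi_mem_Icc hx' (Ioo_subset_Ioc_self hq)
      have e1 : σ * (x q - x' q) * p ^ 2 ≤ C ^ 2 * |x q - x' q| := by
        refine (le_abs_self _).trans ?_
        rw [abs_mul, abs_mul, hσ1, one_mul, abs_of_nonneg (sq_nonneg p), mul_comm]
        exact mul_le_mul_of_nonneg_right (sq_le_sq' (neg_le_of_abs_le hp1) (le_of_abs_le hp1))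
          (abs_nonneg _)
      have e2 : σ * x' q * (p + r) * (p - r) ≤ (C + C') * |σ * (p - r)| := by
        have : σ * x' q * (p + r) * (p - r) = x' q * (p + r) * (σ * (p - r)) := by ring
        rw [this]
        refine (le_abs_self _).trans ?_
        rw [abs_mul, abs_mul, abs_of_nonneg hx1.1]
        gcongr
        calc x' q * |p + r| ≤ 1 * (|p| + |r|) := by
              gcongr
              exacts [hx1.2, abs_add_le _ _]
          _ ≤ C + C' := by linarith
      have e3 : σ * (deriv (fun s => f s y) q - deriv (fun s => g s y) q)
          + 1 / 2 * (σ * (deriv (deriv (f q)) y - deriv (deriv (g q)) y))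
          = -(1 / 2) * (σ * (x q - x' q) * p ^ 2 + σ * x' q * (p + r) * (p - r)) := by
        linear_combination σ * feq - σ * geq
      linarith
    · intro y
      simp [hI, hf.final y, hg.final y]
  rw [abs_le]
  have h1 := key 1 (Or.inl rfl) q hq y
  have h2 := key (-1) (Or.inr rfl) q hq y
  simp only [hI] at h1 h2
  constructor <;> linarith

lemma unique (hx : x ∈ chi 0) (hf : IsParisiSolution β x f) (hg : IsParisiSolution β x g)
    {q : ℝ} (hq : q ∈ Icc (0 : ℝ) 1) (y : ℝ) : f q y = g q y := by
  obtain ⟨C, -, hC⟩ := hf.abs_deriv_le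
  have h := hf.sub_le hx hC hg hx hq y
  simp only [sub_self, abs_zero, intervalIntegral.integral_zero, mul_zero] at h
  exact sub_eq_zero.1 (abs_nonpos_iff.1 h)

/-- By the maximum principle, since `-f` is a subsolution of the backward heat equation. -/
lemma nonneg (hx : x ∈ chi 0) (hf : IsParisiSolution β x f) {q : ℝ}
    (hq : q ∈ Icc (0 : ℝ) 1) (y : ℝ) : 0 ≤ f q y := by
  obtain ⟨A, hA, hAf⟩ := hf.abs_le_linear
  obtain ⟨F, hF⟩ := chi_continuousAt hx
  have key : ∀ q ∈ Icc (0 : ℝ) 1, ∀ y, -f q y ≤ 0 := by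
    refine parabolic_max_principle_of_finite (w := fun q y => -f q y) hA le_rfl F
      hf.continuousOn.neg (fun q hq y => (neg_le_abs _).trans (hAf q hq y))
      (fun q hq hqF => (hf.contDiff q hq (hF q hq hqF)).neg)
      (fun q hq hqF y => ((hf.equation q hq (hF q hq hqF) y).1).neg) ?_ ?_
    · intro q hq hqF y
      have h1 := (hf.equation q hq (hF q hq hqF) y).2
      have h2 := (chi_mem_Icc hx (Ioo_subset_Ioc_self hq)).1
      have d1 : deriv (fun s => -f s y) q = -deriv (fun s => f s y) q := deriv.fun_neg
      have d2 : deriv (fun z => -f q z) = fun z => -deriv (f q) z := by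
        ext z; exact deriv.fun_neg
      have d3 : deriv (fun z => -deriv (f q) z) y = -deriv (deriv (f q)) y := deriv.fun_neg
      rw [d1, d2, d3]
      have h3 : 0 ≤ 1 / 2 * x q * deriv (f q) y ^ 2 := by positivity
      linarith
    · intro y
      rw [hf.final y, neg_nonpos]
      exact Real.log_nonneg (Real.one_le_cosh _)
  linarith [key q hq y]

end IsParisiSolution

/-! ### The Parisi recursion and existence of solutions -/

section HeatFlow

variable {G G' G'' : ℝ → ℝ}

lemma integrable_gaussian_line (hc : Continuous G) (hg : ExpGrowth G) (y c : ℝ) :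
    Integrable (fun z => G (y + z * c)) (gaussianReal 0 1) :=
  (hg.comp_line y c).integrable
    (hc.comp (by fun_prop : Continuous fun z : ℝ => y + z • c)).aestronglyMeasurable

lemma hasFDerivAt_of_hasDerivAt (hG : ∀ z, HasDerivAt G (G' z) z) (z : ℝ) :
    HasFDerivAt G (ContinuousLinearMap.toSpanSingleton ℝ (G' z)) z := (hG z).hasFDerivAt

lemma expGrowth_toSpanSingleton (hg : ExpGrowth G) :
    ExpGrowth fun z => ContinuousLinearMap.toSpanSingleton ℝ (G z) :=
  hg.mono 1 zero_le_one fun e => by simp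

lemma continuous_toSpanSingleton (hc : Continuous G) :
    Continuous fun z => ContinuousLinearMap.toSpanSingleton ℝ (G z) :=
  (ContinuousLinearMap.toSpanSingletonCLE (𝕜 := ℝ) (E := ℝ)).continuous.comp hc

lemma hasDerivAt_gaussian_line_space (hG : ∀ z, HasDerivAt G (G' z) z) (hc' : Continuous G')
    (hg : ExpGrowth G) (hg' : ExpGrowth G') (c y : ℝ) :
    HasDerivAt (fun y => ∫ z, G (y + z * c) ∂(gaussianReal 0 1))
      (∫ z, G' (y + z * c) ∂(gaussianReal 0 1)) y := by
  have h := hasDerivAt_gaussian_avg (hasFDerivAt_of_hasDerivAt hG) hg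
    (expGrowth_toSpanSingleton hg') (a := fun y => y) (b := fun _ => c) (a' := fun _ => 1)
    (b' := fun _ => 0) (p0 := y)
    (Eventually.of_forall fun p => hasDerivAt_id p)
    (Eventually.of_forall fun p => hasDerivAt_const p c) continuousAt_const continuousAt_const
    ((continuous_toSpanSingleton hc').comp
      (by fun_prop : Continuous fun z : ℝ => y + z • c)).aestronglyMeasurable
  simpa using h

/-- The Gaussian average `s ↦ E G(y + √s z)` satisfies the heat equation. -/
lemma hasDerivAt_gaussian_line_time (hG : ∀ z, HasDerivAt G (G' z) z)
    (hG' : ∀ z, HasDerivAt G' (G'' z) z) (hc'' : Continuous G'')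
    (hg : ExpGrowth G) (hg' : ExpGrowth G') (hg'' : ExpGrowth G'') {s : ℝ} (hs : 0 < s) (y : ℝ) :
    HasDerivAt (fun s => ∫ z, G (y + z * √s) ∂(gaussianReal 0 1))
      (1 / 2 * ∫ z, G'' (y + z * √s) ∂(gaussianReal 0 1)) s := by
  have hc' : Continuous G' := continuous_iff_continuousAt.2 fun z => (hG' z).continuousAt
  have h := hasDerivAt_gaussian_avg (hasFDerivAt_of_hasDerivAt hG) hg
    (expGrowth_toSpanSingleton hg') (a := fun _ => y) (b := fun s => √s) (a' := fun _ => 0)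
    (b' := fun s => 1 / (2 * √s)) (p0 := s)
    (Eventually.of_forall fun p => hasDerivAt_const p y)
    (by
      filter_upwards [Ioi_mem_nhds hs] with p hp
      exact Real.hasDerivAt_sqrt (ne_of_gt hp)) continuousAt_const
    (by
      have : √s ≠ 0 := (Real.sqrt_pos.2 hs).ne'
      fun_prop (disch := simpa))
    ((continuous_toSpanSingleton hc').comp
      (by fun_prop : Continuous fun z : ℝ => y + z • √s)).aestronglyMeasurable
  refine h.congr_deriv ?_
  have hibp := integral_mul_gaussianReal (F := fun z => G' (y + z * √s))
    (F' := fun z => √s * G'' (y + z * √s))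
    (fun z => by
      have h1 : HasDerivAt (fun z : ℝ => y + z * √s) (√s) z := by
        simpa using ((hasDerivAt_id z).mul_const (√s)).const_add y
      exact ((hG' (y + z * √s)).comp z h1).congr_deriv (mul_comm _ _)) (by fun_prop)
    (hg'.comp_line y (√s)) ((hg''.comp_line y (√s)).const_mul _)
  rw [integral_const_mul] at hibp
  have h2 : ∀ z : ℝ, (ContinuousLinearMap.toSpanSingleton ℝ (G' (y + z • √s)))
      (0 + z • (1 / (2 * √s))) = 1 / (2 * √s) * (z * G' (y + z * √s)) := by
    intro z
    simp only [ContinuousLinearMap.toSpanSingleton_apply, smul_eq_mul, zero_add]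
    ring
  simp only [h2]
  rw [integral_const_mul, hibp]
  have : √s ≠ 0 := (Real.sqrt_pos.2 hs).ne'
  field_simp

/-- The semigroup property of Gaussian averages. -/
lemma gaussian_line_semigroup (hc : Continuous G) (hg : ExpGrowth G) {s t : ℝ} (hs : 0 ≤ s)
    (ht : 0 ≤ t) (y : ℝ) :
    ∫ z, (∫ z', G (y + z * √s + z' * √t) ∂(gaussianReal 0 1)) ∂(gaussianReal 0 1)
      = ∫ z, G (y + z * √(s + t)) ∂(gaussianReal 0 1) := by
  have hmap : ∀ r : ℝ, 0 ≤ r →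
      (gaussianReal 0 1).map (fun z => z * √r) = gaussianReal 0 r.toNNReal := by
    intro r hr
    rw [gaussianReal_map_mul_const]
    congr 1
    · simp
    · ext
      simp [Real.sq_sqrt hr, Real.coe_toNNReal _ hr]
  have hint : ∀ (r : ℝ), 0 ≤ r → ∀ F : ℝ → ℝ, Continuous F →
      ∫ z, F (z * √r) ∂(gaussianReal 0 1) = ∫ w, F w ∂(gaussianReal 0 r.toNNReal) := by
    intro r hr F hF
    rw [← hmap r hr, integral_map (by fun_prop) hF.aestronglyMeasurable]
  have hcont : Continuous fun y => ∫ z', G (y + z' * √t) ∂(gaussianReal 0 1) :=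
    continuous_gaussian_avg hc hg continuous_id continuous_const
  rw [hint s hs (fun w => ∫ z', G (y + w + z' * √t) ∂(gaussianReal 0 1))
      (hcont.comp (by fun_prop : Continuous fun w => y + w)),
    hint (s + t) (by positivity) (fun w => G (y + w)) (by fun_prop)]
  have h1 : ∀ w, ∫ z', G (y + w + z' * √t) ∂(gaussianReal 0 1)
      = ∫ w', G (y + (w + w')) ∂(gaussianReal 0 t.toNNReal) := by
    intro w
    rw [hint t ht (fun w' => G (y + w + w')) (by fun_prop)]
    simp only [add_assoc]
  simp only [h1]
  have hconv := gaussianReal_conv_gaussianReal (m₁ := 0) (m₂ := 0) (v₁ := s.toNNReal)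
    (v₂ := t.toNNReal)
  rw [add_zero, ← Real.toNNReal_add hs ht] at hconv
  have hi : Integrable (fun w => G (y + w)) (gaussianReal 0 (s + t).toNNReal) := by
    rw [← hmap _ (by positivity), integrable_map_measure (by fun_prop) (by fun_prop)]
    exact integrable_gaussian_line hc hg y _
  rw [← hconv, Measure.conv] at hi ⊢
  rw [integrable_map_measure (by fun_prop) (by fun_prop)] at hi
  rw [integral_map (by fun_prop) (by fun_prop)]
  exact (integral_prod _ hi).symm

end HeatFlow

/-- One step of the Parisi recursion: `(T g)(y) = m⁻¹ log E exp(m g(y + √d z))` with a standard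
Gaussian `z`, read as `E g(y + √d z)` for `m = 0`. -/
def parisiStep (m d : ℝ) (g : ℝ → ℝ) (y : ℝ) : ℝ :=
  if m = 0 then ∫ z, g (y + z * √d) ∂(gaussianReal 0 1)
  else 1 / m * Real.log (∫ z, Real.exp (m * g (y + z * √d)) ∂(gaussianReal 0 1))

/-- `C²` functions with `|g'| ≤ L` and `|g''| ≤ M`. -/
structure HasC2Bounds (L M : ℝ) (g : ℝ → ℝ) : Prop where
  contDiff : ContDiff ℝ 2 g
  deriv_le : ∀ y, |deriv g y| ≤ L
  deriv2_le : ∀ y, |deriv (deriv g) y| ≤ M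

lemma contDiff_two_of_hasDerivAt {g g' g'' : ℝ → ℝ} (h : ∀ y, HasDerivAt g (g' y) y)
    (h' : ∀ y, HasDerivAt g' (g'' y) y) (hc : Continuous g'') :
    ContDiff ℝ 2 g ∧ deriv g = g' ∧ deriv (deriv g) = g'' := by
  have e1 : deriv g = g' := funext fun y => (h y).deriv
  have e2 : deriv g' = g'' := funext fun y => (h' y).deriv
  refine ⟨?_, e1, by rw [e1, e2]⟩
  rw [show (2 : WithTop ℕ∞) = 1 + 1 by norm_num, contDiff_succ_iff_deriv]
  refine ⟨fun y => (h y).differentiableAt, by simp, ?_⟩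
  rw [e1, contDiff_one_iff_deriv]
  exact ⟨fun y => (h' y).differentiableAt, by rwa [e2]⟩

namespace HasC2Bounds

variable {L M : ℝ} {g : ℝ → ℝ}

lemma continuous (hg : HasC2Bounds L M g) : Continuous g := hg.contDiff.continuous

lemma hasDerivAt (hg : HasC2Bounds L M g) (y : ℝ) : HasDerivAt g (deriv g y) y :=
  (hg.contDiff.differentiable (by norm_num) y).hasDerivAt

lemma hasDerivAt_deriv (hg : HasC2Bounds L M g) (y : ℝ) :
    HasDerivAt (deriv g) (deriv (deriv g) y) y :=
  ((hg.contDiff.iterate_deriv' 1 1).differentiable (by norm_num) y).hasDerivAt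

lemma continuous_deriv2 (hg : HasC2Bounds L M g) : Continuous (deriv (deriv g)) :=
  (hg.contDiff.iterate_deriv' 0 2).continuous

lemma continuous_deriv (hg : HasC2Bounds L M g) : Continuous (deriv g) :=
  (hg.contDiff.iterate_deriv' 1 1).continuous

lemma nonneg (hg : HasC2Bounds L M g) : 0 ≤ L := (abs_nonneg _).trans (hg.deriv_le 0)

lemma lipschitz (hg : HasC2Bounds L M g) : LipschitzWith ⟨L, hg.nonneg⟩ g :=
  lipschitzWith_of_nnnorm_deriv_le (hg.contDiff.differentiable (by norm_num))
    fun y => hg.deriv_le y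

lemma abs_le (hg : HasC2Bounds L M g) (y : ℝ) : |g y| ≤ |g 0| + L * |y| := by
  have h := hg.lipschitz.dist_le_mul y 0
  rw [Real.dist_eq, Real.dist_eq, sub_zero] at h
  have h3 : |g y| ≤ |g y - g 0| + |g 0| := by
    simpa using abs_add_le (g y - g 0) (g 0)
  have h4 : |g y - g 0| ≤ L * |y| := h
  linarith

lemma expGrowth (hg : HasC2Bounds L M g) : ExpGrowth g := by
  have h : ExpGrowth fun y : ℝ => |g 0| + L * |y| :=
    (ExpGrowth.of_bounded (|g 0|) (G := fun _ : ℝ => |g 0|) (by simp)).add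
      ((ExpGrowth.id_real.mono 1 zero_le_one fun e => by simp).const_mul L)
  refine h.mono 1 zero_le_one fun y => ?_
  rw [one_mul, Real.norm_of_nonneg
    (add_nonneg (abs_nonneg _) (mul_nonneg hg.nonneg (abs_nonneg _)))]
  exact hg.abs_le y

lemma expGrowth_exp (hg : HasC2Bounds L M g) {m : ℝ} (hm : 0 ≤ m) :
    ExpGrowth fun y => Real.exp (m * g y) := by
  refine ExpGrowth.exp_of_le (m * |g 0|) (m * L) (mul_nonneg hm hg.nonneg) fun y => ?_
  have := mul_le_mul_of_nonneg_left ((le_abs_self _).trans (hg.abs_le y)) hm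
  rw [Real.norm_eq_abs]
  linarith

lemma integral_exp_pos (hg : HasC2Bounds L M g) {m : ℝ} (hm : 0 ≤ m) (y c : ℝ) :
    0 < ∫ z, Real.exp (m * g (y + z * c)) ∂(gaussianReal 0 1) :=
  MeasureTheory.integral_exp_pos (integrable_gaussian_line (G := fun y => Real.exp (m * g y))
    (by have := hg.continuous; fun_prop) (hg.expGrowth_exp hm) y c)

/-- Regularity of one step of the Parisi recursion, with first and second derivatives `u1` and `u2`
in `y`, and the equation that it satisfies in the variance `d`: the Cole-Hopf transform turns the
heat equation for `exp (m u)` into the Parisi equation. -/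
lemma exists_parisiStep_deriv (hg : HasC2Bounds L M g) {m : ℝ} (hm : m ∈ Icc (0 : ℝ) 1) :
    ∃ u1 u2 : ℝ → ℝ → ℝ, ∀ d y,
      HasDerivAt (parisiStep m d g) (u1 d y) y ∧ HasDerivAt (u1 d) (u2 d y) y ∧
      Continuous (u2 d) ∧ |u1 d y| ≤ L ∧ |u2 d y| ≤ M + 2 * L ^ 2 ∧
      (0 < d → HasDerivAt (fun d => parisiStep m d g y)
        (1 / 2 * u2 d y + 1 / 2 * m * u1 d y ^ 2) d) := by
  have hL := hg.nonneg
  have cg := hg.continuous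
  have cg1 := hg.continuous_deriv
  have cg2 := hg.continuous_deriv2
  have gg1 : ExpGrowth (deriv g) := ExpGrowth.of_bounded L hg.deriv_le
  have gg2 : ExpGrowth (deriv (deriv g)) := ExpGrowth.of_bounded M hg.deriv2_le
  rcases eq_or_ne m 0 with rfl | hm0
  · refine ⟨fun d y => ∫ z, deriv g (y + z * √d) ∂(gaussianReal 0 1),
      fun d y => ∫ z, deriv (deriv g) (y + z * √d) ∂(gaussianReal 0 1), fun d y => ?_⟩
    simp only [parisiStep, if_true]
    have hT : parisiStep 0 d g = fun y => ∫ z, g (y + z * √d) ∂(gaussianReal 0 1) := by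
      ext y; simp [parisiStep]
    rw [hT]
    refine ⟨hasDerivAt_gaussian_line_space hg.hasDerivAt cg1 hg.expGrowth gg1 _ _,
      hasDerivAt_gaussian_line_space hg.hasDerivAt_deriv cg2 gg1 gg2 _ _,
      continuous_gaussian_avg cg2 gg2 continuous_id continuous_const, ?_, ?_, fun hd => ?_⟩
    · have := norm_integral_le_of_norm_le_const (μ := gaussianReal 0 1)
        (f := fun z => deriv g (y + z * √d)) (Eventually.of_forall fun z => hg.deriv_le _)
      simpa using this
    · have := norm_integral_le_of_norm_le_const (μ := gaussianReal 0 1)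
        (f := fun z => deriv (deriv g) (y + z * √d)) (Eventually.of_forall fun z => hg.deriv2_le _)
      have h2 : |∫ z, deriv (deriv g) (y + z * √d) ∂(gaussianReal 0 1)| ≤ M := by simpa using this
      nlinarith [sq_nonneg L]
    · refine (hasDerivAt_gaussian_line_time hg.hasDerivAt hg.hasDerivAt_deriv cg2 hg.expGrowth
        gg1 gg2 hd y).congr_deriv (by ring)
  · have hmpos : 0 < m := lt_of_le_of_ne hm.1 hm0.symm
    set p : ℝ → ℝ := fun y => Real.exp (m * g y) with hp
    set p1 : ℝ → ℝ := fun y => m * deriv g y * p y with hp1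
    set p2 : ℝ → ℝ := fun y => (m * deriv (deriv g) y + m ^ 2 * deriv g y ^ 2) * p y with hp2
    have ppos : ∀ y, 0 < p y := fun y => Real.exp_pos _
    have cp : Continuous p := by fun_prop
    have cp1 : Continuous p1 := by fun_prop
    have cp2 : Continuous p2 := by fun_prop
    have gp : ExpGrowth p := hg.expGrowth_exp hm.1
    have gp1 : ExpGrowth p1 := (gg1.const_mul m).mul gp
    have gp2 : ExpGrowth p2 := by
      refine ((gg2.const_mul m).add ((gg1.mul gg1).const_mul (m ^ 2))).mul gp |>.mono 1 zero_le_one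
        fun y => le_of_eq ?_
      simp only [hp2, one_mul, pow_two (deriv g y)]
    have dp : ∀ y, HasDerivAt p (p1 y) y := fun y =>
      (((hg.hasDerivAt y).const_mul m).exp).congr_deriv (by simp only [hp1, hp]; ring)
    have dp1 : ∀ y, HasDerivAt p1 (p2 y) y := fun y =>
      (((hg.hasDerivAt_deriv y).const_mul m).mul (dp y)).congr_deriv (by
        simp only [hp1, hp2]; ring)
    let I : (ℝ → ℝ) → ℝ → ℝ → ℝ := fun F d y => ∫ z, F (y + z * √d) ∂(gaussianReal 0 1)
    have Ipos : ∀ d y, 0 < I p d y := fun d y => hg.integral_exp_pos hm.1 y _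
    have b1 : ∀ d y, |I p1 d y| ≤ m * L * I p d y := by
      intro d y
      have h1 := norm_integral_le_of_norm_le (μ := gaussianReal 0 1)
        (f := fun z => p1 (y + z * √d)) (g := fun z => m * L * p (y + z * √d))
        ((integrable_gaussian_line cp gp y _).const_mul _) (Eventually.of_forall fun z => by
          rw [hp1, Real.norm_eq_abs, abs_mul, abs_mul, abs_of_pos hmpos, abs_of_pos (ppos _)]
          have := hg.deriv_le (y + z * √d)
          have := ppos (y + z * √d)
          gcongr)
      rwa [integral_const_mul] at h1
    have b2 : ∀ d y, |I p2 d y| ≤ m * (M + L ^ 2) * I p d y := by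
      intro d y
      have h1 := norm_integral_le_of_norm_le (μ := gaussianReal 0 1)
        (f := fun z => p2 (y + z * √d)) (g := fun z => m * (M + L ^ 2) * p (y + z * √d))
        ((integrable_gaussian_line cp gp y _).const_mul _) (Eventually.of_forall fun z => by
          rw [hp2, Real.norm_eq_abs, abs_mul, abs_of_pos (ppos _)]
          refine mul_le_mul_of_nonneg_right ?_ (ppos _).le
          refine (abs_add_le _ _).trans ?_
          rw [abs_mul, abs_of_pos hmpos,
            abs_of_nonneg (by positivity : 0 ≤ m ^ 2 * deriv g (y + z * √d) ^ 2)]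
          have h3 := hg.deriv2_le (y + z * √d)
          have h4 : deriv g (y + z * √d) ^ 2 ≤ L ^ 2 :=
            sq_le_sq' (neg_le_of_abs_le (hg.deriv_le _)) (le_of_abs_le (hg.deriv_le _))
          have h5 : m ^ 2 * deriv g (y + z * √d) ^ 2 ≤ m * L ^ 2 := by
            have : m ^ 2 ≤ m := by nlinarith [hm.2]
            exact mul_le_mul this h4 (sq_nonneg _) hmpos.le
          nlinarith)
      rwa [integral_const_mul] at h1
    refine ⟨fun d y => I p1 d y / (m * I p d y),
      fun d y => I p2 d y / (m * I p d y) - I p1 d y ^ 2 / (m * I p d y ^ 2), fun d y => ?_⟩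
    have hT : ∀ d, parisiStep m d g = fun y => 1 / m * Real.log (I p d y) := by
      intro d; ext y; simp [parisiStep, hm0, I, hp]
    have hT' : (fun d => parisiStep m d g y) = fun d => 1 / m * Real.log (I p d y) := by
      ext d; rw [hT]
    rw [hT']
    simp only [hT]
    have dI : ∀ y, HasDerivAt (I p d) (I p1 d y) y := fun y =>
      hasDerivAt_gaussian_line_space dp cp1 gp gp1 _ _
    have dI1 : ∀ y, HasDerivAt (I p1 d) (I p2 d y) y := fun y =>
      hasDerivAt_gaussian_line_space dp1 cp2 gp1 gp2 _ _
    have hne := (Ipos d y).ne'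
    have hu1 : |I p1 d y / (m * I p d y)| ≤ L := by
      rw [abs_div, abs_of_pos (mul_pos hmpos (Ipos d y)), div_le_iff₀ (mul_pos hmpos (Ipos d y))]
      linarith [b1 d y]
    refine ⟨?_, ?_, ?_, hu1, ?_, fun hd => ?_⟩
    · refine (((dI y).log hne).const_mul (1 / m)).congr_deriv ?_
      field_simp
    · refine ((dI1 y).div ((dI y).const_mul m)
        (mul_pos hmpos (Ipos d y)).ne').congr_deriv ?_
      field_simp
    · have c0 : Continuous (I p d) := continuous_gaussian_avg cp gp continuous_id continuous_const
      have c1 : Continuous (I p1 d) :=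
        continuous_gaussian_avg cp1 gp1 continuous_id continuous_const
      have c2 : Continuous (I p2 d) :=
        continuous_gaussian_avg cp2 gp2 continuous_id continuous_const
      have hne1 : ∀ y, m * I p d y ≠ 0 := fun y => (mul_pos hmpos (Ipos d y)).ne'
      have hne2 : ∀ y, m * I p d y ^ 2 ≠ 0 := fun y => (mul_pos hmpos (pow_pos (Ipos d y) 2)).ne'
      exact (c2.div (continuous_const.mul c0) hne1).sub
        ((c1.pow 2).div (continuous_const.mul (c0.pow 2)) hne2)
    · have h1 : |I p2 d y / (m * I p d y)| ≤ M + L ^ 2 := by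
        rw [abs_div, abs_of_pos (mul_pos hmpos (Ipos d y)),
          div_le_iff₀ (mul_pos hmpos (Ipos d y))]
        linarith [b2 d y]
      have h2 : I p1 d y ^ 2 / (m * I p d y ^ 2) = m * (I p1 d y / (m * I p d y)) ^ 2 := by
        field_simp
      have h3 : (I p1 d y / (m * I p d y)) ^ 2 ≤ L ^ 2 :=
        sq_le_sq' (neg_le_of_abs_le hu1) (le_of_abs_le hu1)
      have h4 : m * (I p1 d y / (m * I p d y)) ^ 2 ≤ L ^ 2 := by
        nlinarith [hm.2, sq_nonneg (I p1 d y / (m * I p d y))]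
      have h5 : 0 ≤ m * (I p1 d y / (m * I p d y)) ^ 2 := by positivity
      rw [h2]
      rw [_root_.abs_le] at h1 ⊢
      constructor <;> nlinarith
    · have h1 := hasDerivAt_gaussian_line_time dp dp1 cp2 gp gp1 gp2 hd y
      refine ((h1.log hne).const_mul (1 / m)).congr_deriv ?_
      change 1 / m * (1 / 2 * I p2 d y / I p d y) = _
      field_simp
      ring

lemma parisiStep (hg : HasC2Bounds L M g) {m : ℝ} (hm : m ∈ Icc (0 : ℝ) 1) (d : ℝ) :
    HasC2Bounds L (M + 2 * L ^ 2) (parisiStep m d g) := by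
  obtain ⟨u1, u2, hu⟩ := hg.exists_parisiStep_deriv hm
  obtain ⟨h1, h2, h3⟩ := contDiff_two_of_hasDerivAt (fun y => (hu d y).1) (fun y => (hu d y).2.1)
    (hu d 0).2.2.1
  refine ⟨h1, fun y => ?_, fun y => ?_⟩
  · rw [h2]; exact (hu d y).2.2.2.1
  · rw [h3]; exact (hu d y).2.2.2.2.1

lemma continuous_parisiStep (hg : HasC2Bounds L M g) {m : ℝ} (hm : m ∈ Icc (0 : ℝ) 1) :
    Continuous fun p : ℝ × ℝ => SKReplica.parisiStep m p.1 g p.2 := by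
  unfold SKReplica.parisiStep
  have cg := hg.continuous
  split_ifs with h
  · exact continuous_gaussian_avg cg hg.expGrowth continuous_snd
      (Real.continuous_sqrt.comp continuous_fst)
  · refine continuous_const.mul (Continuous.log ?_ fun p => (hg.integral_exp_pos hm.1 _ _).ne')
    exact continuous_gaussian_avg (G := fun y => Real.exp (m * g y)) (by fun_prop)
      (hg.expGrowth_exp hm.1) continuous_snd (Real.continuous_sqrt.comp continuous_fst)

/-- Steps with the same exponent compose by adding their variances. -/
lemma parisiStep_add (hg : HasC2Bounds L M g) {m : ℝ} (hm : m ∈ Icc (0 : ℝ) 1) {s t : ℝ}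
    (hs : 0 ≤ s) (ht : 0 ≤ t) :
    SKReplica.parisiStep m s (SKReplica.parisiStep m t g) = SKReplica.parisiStep m (s + t) g := by
  have cg := hg.continuous
  ext y
  unfold SKReplica.parisiStep
  split_ifs with h
  · exact gaussian_line_semigroup cg hg.expGrowth hs ht y
  · congr 2
    rw [← gaussian_line_semigroup (G := fun y => Real.exp (m * g y)) (by fun_prop)
      (hg.expGrowth_exp hm.1) hs ht y]
    congr 1
    ext z
    rw [← mul_assoc, mul_one_div_cancel h, one_mul, Real.exp_log (hg.integral_exp_pos hm.1 _ _)]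

end HasC2Bounds

lemma parisiStep_zero (m : ℝ) (g : ℝ → ℝ) : parisiStep m 0 g = g := by
  ext y
  unfold parisiStep
  split_ifs with h
  · simp
  · simp [h]

/-- The family `f s`, `s ∈ [a, 1]`, is generated by the Parisi recursion: wherever `x` is constant
on `(s, t]`, the function `f s` is obtained from `f t` by one step. -/
structure IsParisiFlow (β : ℝ) (x : ℝ → ℝ) (a : ℝ) (f : ℝ → ℝ → ℝ) : Prop where
  continuousOn : ContinuousOn (fun p : ℝ × ℝ => f p.1 p.2) (Icc a 1 ×ˢ univ)
  final : ∀ y, f 1 y = Real.log (Real.cosh (β * y))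
  bounds : ∀ s ∈ Icc a 1, ∃ M, HasC2Bounds |β| M (f s)
  step : ∀ s t, a ≤ s → s ≤ t → t ≤ 1 → ∀ m ∈ Icc (0 : ℝ) 1, (∀ r ∈ Ioc s t, x r = m) →
    f s = parisiStep m (t - s) (f t)

lemma hasC2Bounds_log_cosh (β : ℝ) :
    HasC2Bounds |β| (β ^ 2) (fun y => Real.log (Real.cosh (β * y))) := by
  have hc : ∀ y, Real.cosh (β * y) ≠ 0 := fun y => (Real.cosh_pos _).ne'
  have hl : ∀ y, HasDerivAt (fun y => β * y) β y := fun y => by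
    simpa using (hasDerivAt_id y).const_mul β
  have h1 : ∀ y, HasDerivAt (fun y => Real.log (Real.cosh (β * y)))
      (β * (Real.sinh (β * y) / Real.cosh (β * y))) y := fun y =>
    ((hl y).cosh.log (hc y)).congr_deriv (by ring)
  have h2 : ∀ y, HasDerivAt (fun y => β * (Real.sinh (β * y) / Real.cosh (β * y)))
      (β ^ 2 / Real.cosh (β * y) ^ 2) y := fun y =>
    (((hl y).sinh.div (hl y).cosh (hc y)).const_mul β).congr_deriv (by
      have := Real.cosh_sq (β * y)
      field_simp
      linear_combination β ^ 2 * this)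
  obtain ⟨a1, a2, a3⟩ := contDiff_two_of_hasDerivAt h1 h2
    (by fun_prop (disch := intro y; exact pow_ne_zero 2 (hc y)))
  refine ⟨a1, fun y => ?_, fun y => ?_⟩
  · rw [a2, abs_mul, abs_div, abs_of_pos (Real.cosh_pos _)]
    refine mul_le_of_le_one_right (abs_nonneg _) (div_le_one_of_le₀ ?_ (Real.cosh_pos _).le)
    exact abs_le_of_sq_le_sq (by rw [Real.sinh_sq (β * y)]; linarith) (Real.cosh_pos _).le
  · rw [a3, abs_of_nonneg (by positivity)]
    refine div_le_self (sq_nonneg _) ?_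
    nlinarith [Real.one_le_cosh (β * y)]

/-- A flow on `[b, 1]` extends to `[a, 1]` if `x` is constant on `(a, b]`. -/
lemma IsParisiFlow.extend {β : ℝ} {x : ℝ → ℝ} {a b m : ℝ} {f : ℝ → ℝ → ℝ}
    (hf : IsParisiFlow β x b f) (hab : a ≤ b) (hb1 : b ≤ 1) (hm : m ∈ Icc (0 : ℝ) 1)
    (hx : ∀ r ∈ Ioc a b, x r = m) :
    IsParisiFlow β x a (fun s => if b ≤ s then f s else parisiStep m (b - s) (f b)) := by
  obtain ⟨M, hM⟩ := hf.bounds b ⟨le_rfl, hb1⟩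
  refine ⟨?_, fun y => ?_, fun s hs => ?_, fun s t has hst ht μ hμ hxμ => ?_⟩
  · have hset : Icc a 1 ×ˢ (univ : Set ℝ) = Icc a b ×ˢ univ ∪ Icc b 1 ×ˢ univ := by
      rw [← union_prod, Icc_union_Icc_eq_Icc hab hb1]
    rw [hset]
    refine ContinuousOn.union_of_isClosed ?_ ?_ (isClosed_Icc.prod isClosed_univ)
      (isClosed_Icc.prod isClosed_univ)
    · have h1 : Continuous fun p : ℝ × ℝ => parisiStep m (b - p.1) (f b) p.2 :=
        (hM.continuous_parisiStep hm).comp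
          (by fun_prop : Continuous fun p : ℝ × ℝ => (b - p.1, p.2))
      refine h1.continuousOn.congr fun p hp => ?_
      dsimp only
      split_ifs with h
      · have : p.1 = b := le_antisymm hp.1.2 h
        rw [this, sub_self, parisiStep_zero]
      · rfl
    · refine hf.continuousOn.congr fun p hp => ?_
      simp [hp.1.1]
  · simp only [hb1, if_true]
    exact hf.final y
  · split_ifs with h
    · exact hf.bounds s ⟨h, hs.2⟩
    · exact ⟨_, hM.parisiStep hm _⟩
  · split_ifs with h1 h2 h2
    · exact hf.step s t h1 hst ht μ hμ hxμ
    · exact absurd (h1.trans hst) h2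
    · have hsb : s < b := not_le.1 h1
      have hμm : μ = m := by
        rw [← hxμ b ⟨hsb, h2⟩, hx b ⟨has.trans_lt hsb, le_rfl⟩]
      rw [hf.step b t le_rfl h2 ht μ hμ fun r hr => hxμ r ⟨hsb.trans hr.1, hr.2⟩, hμm]
      obtain ⟨M', hM'⟩ := hf.bounds t ⟨h2, ht⟩
      rw [hM'.parisiStep_add hm (by linarith) (by linarith)]
      congr 1
      ring
    · rcases eq_or_lt_of_le hst with rfl | hlt
      · rw [sub_self, parisiStep_zero]
      · have htb : t < b := not_le.1 h2
        have hμm : μ = m := by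
          rw [← hxμ t ⟨hlt, le_rfl⟩, hx t ⟨has.trans_lt hlt, htb.le⟩]
        rw [hμm, hM.parisiStep_add hm (by linarith) (by linarith)]
        congr 1
        ring

lemma exists_isParisiFlow (β : ℝ) {x : ℝ → ℝ} (hx : x ∈ chi 0) : ∃ f, IsParisiFlow β x 0 f := by
  obtain ⟨K, q, m, hq, h0, h1, -, hm, hx⟩ := hx
  have key : ∀ i : Fin (K + 1), ∃ f, IsParisiFlow β x (q i) f := by
    intro i
    induction i using Fin.reverseInduction with
    | last =>
      rw [h1]
      refine ⟨fun _ y => Real.log (Real.cosh (β * y)), ?_, fun _ => rfl,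
        fun s _ => ⟨_, hasC2Bounds_log_cosh β⟩, fun s t hs hst ht μ _ _ => ?_⟩
      · have := (hasC2Bounds_log_cosh β).continuous
        exact (this.comp continuous_snd).continuousOn
      · have : t - s = 0 := by linarith
        rw [this, parisiStep_zero]
    | cast i ih =>
      obtain ⟨f, hf⟩ := ih
      refine ⟨_, hf.extend (hq (Fin.castSucc_le_succ i)) ?_ (hm i) (hx i)⟩
      rw [← h1]
      exact hq (Fin.le_last _)
  simpa [h0] using key 0

/-- An order parameter takes finitely many values, hence is locally constant where it is
continuous. -/
lemma chi_eventually_eq {n : ℝ} {x : ℝ → ℝ} (hx : x ∈ chi n) {s : ℝ} (hs : s ∈ Ioo (0 : ℝ) 1)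
    (hc : ContinuousAt x s) : ∀ᶠ t in 𝓝 s, x t = x s := by
  obtain ⟨K, q, m, -, h0, h1, -, -, hx⟩ := hx
  have hfin : IsClosed (range m \ {x s}) := ((finite_range m).subset sdiff_subset).isClosed
  have h2 : ∀ᶠ t in 𝓝 s, x t ∈ (range m \ {x s})ᶜ :=
    hc.eventually_mem (hfin.isOpen_compl.mem_nhds (by simp))
  filter_upwards [h2, Ioo_mem_nhds hs.1 hs.2] with t ht htI
  obtain ⟨a, ha⟩ := exists_mem_Ioc_of_partition (q := q) (by rw [h0]; exact htI.1) (Fin.last K)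
    (by rw [h1]; exact htI.2.le)
  by_contra hne
  exact ht ⟨⟨a, (hx a t ha).symm⟩, hne⟩

lemma IsParisiFlow.isParisiSolution {β : ℝ} {x : ℝ → ℝ} {f : ℝ → ℝ → ℝ} (hx : x ∈ chi 0)
    (hf : IsParisiFlow β x 0 f) : IsParisiSolution β x f := by
  refine ⟨hf.continuousOn, hf.final, ⟨⟨|β|, abs_nonneg _⟩, fun q hq => ?_⟩, fun q hq _ => ?_,
    fun q hq hc y => ?_⟩
  · obtain ⟨M, hM⟩ := hf.bounds q hq
    exact hM.lipschitz
  · obtain ⟨M, hM⟩ := hf.bounds q (Ioo_subset_Icc_self hq)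
    exact hM.contDiff
  · have hev := (chi_eventually_eq hx hq hc).and (Ioo_mem_nhds hq.1 hq.2)
    obtain ⟨ε, hε, hball⟩ := Metric.eventually_nhds_iff.1 hev
    -- near `q` the function `f s` is one step away from `f t`, for a fixed `t > q`
    set t := q + ε / 2 with ht
    have htb : x t = x q ∧ t ∈ Ioo (0 : ℝ) 1 := hball (by
      rw [ht, Real.dist_eq, add_sub_cancel_left, abs_of_pos (by positivity)]; linarith)
    have hstep : ∀ s ∈ Ioo (q - ε / 2) t, f s = parisiStep (x q) (t - s) (f t) := by
      intro s hs
      have hs0 : x s = x q ∧ s ∈ Ioo (0 : ℝ) 1 := hball (by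
        rw [Real.dist_eq, abs_lt]; constructor <;> linarith [hs.1, hs.2])
      refine hf.step s t hs0.2.1.le hs.2.le htb.2.2.le _
        (chi_mem_Icc hx (Ioo_subset_Ioc_self hq)) fun r hr => (hball ?_).1
      rw [Real.dist_eq, abs_lt]
      constructor <;> linarith [hs.1, hr.1, hr.2]
    obtain ⟨M, hM⟩ := hf.bounds t (Ioo_subset_Icc_self htb.2)
    obtain ⟨u1, u2, hu⟩ := hM.exists_parisiStep_deriv (chi_mem_Icc hx (Ioo_subset_Ioc_self hq))
    obtain ⟨e1, e2, e3⟩ := contDiff_two_of_hasDerivAt (fun y => (hu (t - q) y).1)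
      (fun y => (hu (t - q) y).2.1) (hu (t - q) 0).2.2.1
    have htq : 0 < t - q := by rw [ht]; linarith
    have hfq := hstep q ⟨by linarith, by linarith⟩
    have hd : HasDerivAt (fun s => f s y)
        (-(1 / 2 * u2 (t - q) y + 1 / 2 * x q * u1 (t - q) y ^ 2)) q := by
      have h1 := (hu (t - q) y).2.2.2.2.2 htq
      have h2 : HasDerivAt (fun s => t - s) (-1) q := by
        simpa using (hasDerivAt_id q).const_sub t
      have h3 := (h1.comp q h2).congr_deriv
        (show _ = -(1 / 2 * u2 (t - q) y + 1 / 2 * x q * u1 (t - q) y ^ 2) by ring)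
      refine h3.congr_of_eventuallyEq ?_
      filter_upwards [Ioo_mem_nhds (show q - ε / 2 < q by linarith) (show q < t by linarith)]
        with s hs
      simp [hstep s hs]
    refine ⟨hd.differentiableAt, ?_⟩
    rw [hd.deriv, hfq, e3, e2]
    ring

lemma parisiSolution_spec (β : ℝ) {x : ℝ → ℝ} (hx : x ∈ chi 0) :
    IsParisiSolution β x (parisiSolution β x) := by
  obtain ⟨f, hf⟩ := exists_isParisiFlow β hx
  have h : ∃ f, IsParisiSolution β x f := ⟨f, hf.isParisiSolution hx⟩
  rw [parisiSolution, dif_pos h]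
  exact h.choose_spec

/-- The solution of the Parisi equation is given by the Parisi recursion. -/
lemma parisiSolution_step (β : ℝ) {x : ℝ → ℝ} (hx : x ∈ chi 0) {s t m : ℝ} (hs : 0 ≤ s)
    (hst : s ≤ t) (ht : t ≤ 1) (hm : m ∈ Icc (0 : ℝ) 1) (hxm : ∀ r ∈ Ioc s t, x r = m) :
    parisiSolution β x s = parisiStep m (t - s) (parisiSolution β x t) := by
  obtain ⟨f, hf⟩ := exists_isParisiFlow β hx
  have h : ∀ q ∈ Icc (0 : ℝ) 1, parisiSolution β x q = f q := fun q hq => funext fun y =>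
    (parisiSolution_spec β hx).unique hx (hf.isParisiSolution hx) hq y
  rw [h s ⟨hs, hst.trans ht⟩, h t ⟨hs.trans hst, ht⟩]
  exact hf.step s t hs hst ht m hm hxm

/-! ### Families of pressures and their interpolation -/

/-- The coefficient, `sin θ` or `cos θ`, with which a Gaussian coupling enters at the point `θ` of
the interpolation: switched on or off as `θ` runs from `0` to `π / 2`. -/
def coef (b : Bool) (θ : ℝ) : ℝ := if b then Real.sin θ else Real.cos θ

/-- The derivative of `coef b`. -/
def coefDeriv (b : Bool) (θ : ℝ) : ℝ := if b then Real.cos θ else -Real.sin θ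

/-- The sign `±1` of the rate at which the variance `coef b θ ^ 2` varies. -/
def coefSign (b : Bool) : ℝ := if b then 1 else -1

lemma hasDerivAt_coef (b : Bool) (θ : ℝ) : HasDerivAt (coef b) (coefDeriv b θ) θ := by
  unfold coefDeriv
  cases b
  · have : coef false = Real.cos := by ext; simp [coef]
    simpa [this] using Real.hasDerivAt_cos θ
  · have : coef true = Real.sin := by ext; simp [coef]
    simpa [this] using Real.hasDerivAt_sin θ

lemma continuous_coefDeriv (b : Bool) : Continuous (coefDeriv b) := by
  unfold coefDeriv
  cases b
  · exact Real.continuous_sin.neg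
  · exact Real.continuous_cos

lemma coefDeriv_mul_coef (b : Bool) (θ : ℝ) :
    coefDeriv b θ * coef b θ = coefSign b * (Real.sin θ * Real.cos θ) := by
  cases b <;> (simp [coefDeriv, coef, coefSign]; try ring)

section Interpolation

variable {S : Type*} [Fintype S]

/-- The linear form on `ℝ × ℝ^S` with coefficients `t` and `p`. -/
def linForm (t : ℝ) (p : S → ℝ) : ℝ × (S → ℝ) →L[ℝ] ℝ :=
  t • ContinuousLinearMap.fst ℝ ℝ (S → ℝ) +
    ∑ σ, p σ • (ContinuousLinearMap.proj σ).comp (ContinuousLinearMap.snd ℝ ℝ (S → ℝ))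

/-- The linear form on `ℝ^S` with coefficients `p`. -/
def linForm' (p : S → ℝ) : (S → ℝ) →L[ℝ] ℝ :=
  ∑ σ, p σ • (ContinuousLinearMap.proj σ : (S → ℝ) →L[ℝ] ℝ)

@[simp] lemma linForm_apply (t : ℝ) (p : S → ℝ) (h : ℝ × (S → ℝ)) :
    linForm t p h = t * h.1 + ∑ σ, p σ * h.2 σ := by
  simp [linForm]

@[simp] lemma linForm'_apply (p h : S → ℝ) : linForm' p h = ∑ σ, p σ * h σ := by
  simp [linForm']

lemma norm_linForm_le (t : ℝ) (p : S → ℝ) : ‖linForm t p‖ ≤ |t| + ∑ σ, |p σ| := by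
  refine ContinuousLinearMap.opNorm_le_bound _ (by positivity) fun h => ?_
  rw [linForm_apply, Real.norm_eq_abs, add_mul, Finset.sum_mul]
  refine (abs_add_le _ _).trans (add_le_add ?_ ((Finset.abs_sum_le_sum_abs _ _).trans
    (Finset.sum_le_sum fun σ _ => ?_)))
  · rw [abs_mul]
    gcongr
    exact norm_fst_le h
  · rw [abs_mul]
    gcongr
    exact (norm_le_pi_norm h.2 σ).trans (norm_snd_le h)

lemma norm_linForm'_le (p : S → ℝ) : ‖linForm' p‖ ≤ ∑ σ, |p σ| := by
  refine ContinuousLinearMap.opNorm_le_bound _ (by positivity) fun h => ?_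
  rw [linForm'_apply, Real.norm_eq_abs, Finset.sum_mul]
  refine (Finset.abs_sum_le_sum_abs _ _).trans (Finset.sum_le_sum fun σ _ => ?_)
  rw [abs_mul]
  gcongr
  exact norm_le_pi_norm h σ

/-- A pressure `Φ θ y`, a function of the energies `y σ` of the configurations `σ` that depends on
an interpolation parameter `θ`, together with its derivative `T` in `θ`, its gradient `P` and its
Hessian `H` in `y`. The gradient is a probability vector, the Gibbs average of the system. -/
structure Pressure (S : Type*) [Fintype S] where
  Φ : ℝ → (S → ℝ) → ℝ
  T : ℝ → (S → ℝ) → ℝ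
  P : S → ℝ → (S → ℝ) → ℝ
  H : S → S → ℝ → (S → ℝ) → ℝ
  C : ℝ
  hasFDerivAt : ∀ p : ℝ × (S → ℝ),
    HasFDerivAt (fun p : ℝ × (S → ℝ) => Φ p.1 p.2) (linForm (T p.1 p.2) fun σ => P σ p.1 p.2) p
  hasFDerivAt_P : ∀ σ θ y, HasFDerivAt (P σ θ) (linForm' fun τ => H σ τ θ y) y
  continuous_T : ∀ θ, Continuous (T θ)
  continuous_H : ∀ σ τ θ, Continuous (H σ τ θ)
  P_nonneg : ∀ σ θ y, 0 ≤ P σ θ y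
  P_sum : ∀ θ y, ∑ σ, P σ θ y = 1
  T_le : ∀ θ y, |T θ y| ≤ C
  H_le : ∀ σ τ θ y, |H σ τ θ y| ≤ C

/-- Bounded continuous functions, unbundled. -/
def BddCont {E : Type*} [TopologicalSpace E] (g : E → ℝ) : Prop :=
  Continuous g ∧ ∃ C, ∀ e, |g e| ≤ C

namespace BddCont

variable {E : Type*} [TopologicalSpace E] {g g' : E → ℝ}

lemma const (c : ℝ) : BddCont (fun _ : E => c) := ⟨continuous_const, |c|, fun _ => le_rfl⟩

lemma add (hg : BddCont g) (hg' : BddCont g') : BddCont fun e => g e + g' e := by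
  obtain ⟨h, C, hC⟩ := hg
  obtain ⟨h', C', hC'⟩ := hg'
  exact ⟨h.add h', C + C', fun e => (abs_add_le _ _).trans (add_le_add (hC e) (hC' e))⟩

lemma mul (hg : BddCont g) (hg' : BddCont g') : BddCont fun e => g e * g' e := by
  obtain ⟨h, C, hC⟩ := hg
  obtain ⟨h', C', hC'⟩ := hg'
  refine ⟨h.mul h', C * C', fun e => ?_⟩
  rw [abs_mul]
  exact mul_le_mul (hC e) (hC' e) (abs_nonneg _) ((abs_nonneg _).trans (hC e))

lemma const_mul (hg : BddCont g) (c : ℝ) : BddCont fun e => c * g e := (const c).mul hg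

lemma sum {ι : Type*} {s : Finset ι} {g : ι → E → ℝ} (hg : ∀ i ∈ s, BddCont (g i)) :
    BddCont fun e => ∑ i ∈ s, g i e := by
  classical
  induction s using Finset.induction_on with
  | empty => simpa using const 0
  | insert a s ha ih =>
    simp only [Finset.sum_insert ha]
    exact (hg a (by simp)).add (ih fun i hi => hg i (by simp [hi]))

end BddCont

namespace Pressure

variable (F : Pressure S)

lemma bddCont_T (θ : ℝ) : BddCont (F.T θ) := ⟨F.continuous_T θ, F.C, F.T_le θ⟩

lemma bddCont_H (σ τ : S) (θ : ℝ) : BddCont (F.H σ τ θ) :=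
  ⟨F.continuous_H σ τ θ, F.C, F.H_le σ τ θ⟩

lemma P_le_one (σ : S) (θ : ℝ) (y : S → ℝ) : F.P σ θ y ≤ 1 := by
  rw [← F.P_sum θ y]
  exact Finset.single_le_sum (f := fun σ => F.P σ θ y) (fun τ _ => F.P_nonneg τ θ y)
    (Finset.mem_univ σ)

lemma bddCont_P (σ : S) (θ : ℝ) : BddCont (F.P σ θ) :=
  ⟨continuous_iff_continuousAt.2 fun y => (F.hasFDerivAt_P σ θ y).continuousAt, 1, fun y => by
    rw [abs_of_nonneg (F.P_nonneg σ θ y)]; exact F.P_le_one σ θ y⟩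

lemma norm_deriv_le (p : ℝ × (S → ℝ)) :
    ‖linForm (F.T p.1 p.2) fun σ => F.P σ p.1 p.2‖ ≤ F.C + 1 := by
  refine (norm_linForm_le _ _).trans (add_le_add (F.T_le _ _) (le_of_eq ?_))
  rw [← F.P_sum p.1 p.2]
  exact Finset.sum_congr rfl fun σ _ => abs_of_nonneg (F.P_nonneg _ _ _)

lemma C_nonneg : 0 ≤ F.C := (abs_nonneg _).trans (F.T_le 0 0)

lemma continuous : Continuous fun p : ℝ × (S → ℝ) => F.Φ p.1 p.2 :=
  continuous_iff_continuousAt.2 fun p => (F.hasFDerivAt p).continuousAt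

lemma continuous_right (θ : ℝ) : Continuous (F.Φ θ) :=
  F.continuous.comp (by fun_prop : Continuous fun y : S → ℝ => (θ, y))

lemma le_linear (p : ℝ × (S → ℝ)) : F.Φ p.1 p.2 ≤ |F.Φ 0 0| + (F.C + 1) * ‖p‖ := by
  have h := convex_univ.norm_image_sub_le_of_norm_hasFDerivWithin_le
    (f := fun p : ℝ × (S → ℝ) => F.Φ p.1 p.2) (fun p _ => (F.hasFDerivAt p).hasFDerivWithinAt)
    (fun p _ => F.norm_deriv_le p) (mem_univ 0) (mem_univ p)
  rw [sub_zero] at h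
  have h1 := (le_abs_self _).trans h
  have h2 := le_abs_self (F.Φ 0 0)
  simp only [Prod.fst_zero, Prod.snd_zero] at h1
  linarith

/-- The unnormalized Gibbs weight `exp (m Φ)`. -/
def weight (m θ : ℝ) (y : S → ℝ) : ℝ := Real.exp (m * F.Φ θ y)

lemma weight_pos (m θ : ℝ) (y : S → ℝ) : 0 < F.weight m θ y := Real.exp_pos _

lemma continuous_weight (m θ : ℝ) : Continuous (F.weight m θ) := by
  have := F.continuous_right θ
  unfold weight
  fun_prop

lemma expGrowth_weight_prod {m : ℝ} (hm : 0 ≤ m) :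
    ExpGrowth fun p : ℝ × (S → ℝ) => F.weight m p.1 p.2 := by
  refine ExpGrowth.exp_of_le (m * |F.Φ 0 0|) (m * (F.C + 1))
    (mul_nonneg hm (by linarith [F.C_nonneg])) fun p => ?_
  have := mul_le_mul_of_nonneg_left (F.le_linear p) hm
  linarith

lemma expGrowth_weight {m : ℝ} (hm : 0 ≤ m) (θ : ℝ) : ExpGrowth (F.weight m θ) := by
  refine ExpGrowth.exp_of_le (m * |F.Φ 0 0| + m * (F.C + 1) * |θ|) (m * (F.C + 1))
    (mul_nonneg hm (by linarith [F.C_nonneg])) fun y => ?_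
  have h1 := mul_le_mul_of_nonneg_left (F.le_linear (θ, y)) hm
  have h2 : ‖(θ, y)‖ ≤ |θ| + ‖y‖ :=
    max_le (le_add_of_nonneg_right (norm_nonneg _)) (le_add_of_nonneg_left (abs_nonneg _))
  have h3 := mul_le_mul_of_nonneg_left h2 (mul_nonneg hm (by linarith [F.C_nonneg] : 0 ≤ F.C + 1))
  dsimp only at h1
  linarith

lemma expGrowth_mul_weight {m : ℝ} (hm : 0 ≤ m) (θ : ℝ) {g : (S → ℝ) → ℝ} (hg : BddCont g) :
    ExpGrowth fun y => g y * F.weight m θ y := by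
  obtain ⟨-, C, hC⟩ := hg
  exact (ExpGrowth.of_bounded C hC).mul (F.expGrowth_weight hm θ)

/-- The Gaussian average of `g exp (m Φ)` along the line through `y` with direction `w`. -/
def avg (m θ : ℝ) (w : S → ℝ) (g : (S → ℝ) → ℝ) (y : S → ℝ) : ℝ :=
  ∫ z, g (y + z • w) * F.weight m θ (y + z • w) ∂(gaussianReal 0 1)

variable {F} {m θ : ℝ} {w : S → ℝ} {g g' : (S → ℝ) → ℝ}

lemma integrable_avg (hm : 0 ≤ m) (hg : BddCont g) (y : S → ℝ) :
    Integrable (fun z : ℝ => g (y + z • w) * F.weight m θ (y + z • w)) (gaussianReal 0 1) :=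
  ((F.expGrowth_mul_weight hm θ hg).comp_line y w).integrable
    ((hg.1.mul (F.continuous_weight m θ)).comp
      (by fun_prop : Continuous fun z : ℝ => y + z • w)).aestronglyMeasurable

lemma avg_add (hm : 0 ≤ m) (hg : BddCont g) (hg' : BddCont g') (y : S → ℝ) :
    F.avg m θ w (fun y => g y + g' y) y = F.avg m θ w g y + F.avg m θ w g' y := by
  unfold avg
  rw [← integral_add (integrable_avg hm hg y) (integrable_avg hm hg' y)]
  simp only [add_mul]

lemma avg_const_mul (c : ℝ) (y : S → ℝ) :
    F.avg m θ w (fun y => c * g y) y = c * F.avg m θ w g y := by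
  unfold avg
  rw [← integral_const_mul]
  simp only [mul_assoc]

lemma avg_sum (hm : 0 ≤ m) {ι : Type*} {s : Finset ι} {g : ι → (S → ℝ) → ℝ}
    (hg : ∀ i ∈ s, BddCont (g i)) (y : S → ℝ) :
    F.avg m θ w (fun y => ∑ i ∈ s, g i y) y = ∑ i ∈ s, F.avg m θ w (g i) y := by
  unfold avg
  rw [← integral_finsetSum s fun i hi => integrable_avg hm (hg i hi) y]
  simp only [Finset.sum_mul]

lemma avg_mono (hm : 0 ≤ m) (hg : BddCont g) (hg' : BddCont g') (h : ∀ y, g y ≤ g' y)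
    (y : S → ℝ) : F.avg m θ w g y ≤ F.avg m θ w g' y :=
  integral_mono (integrable_avg hm hg y) (integrable_avg hm hg' y) fun _ =>
    mul_le_mul_of_nonneg_right (h _) (F.weight_pos _ _ _).le

lemma avg_one_pos (hm : 0 ≤ m) (y : S → ℝ) : 0 < F.avg m θ w (fun _ => 1) y := by
  have h := integrable_avg (F := F) (θ := θ) (w := w) hm (BddCont.const 1) y
  simp only [one_mul] at h
  simp only [avg, one_mul]
  exact integral_exp_pos h

lemma continuous_avg (hm : 0 ≤ m) (hg : BddCont g) : Continuous (F.avg m θ w g) :=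
  continuous_gaussian_avg (hg.1.mul (F.continuous_weight m θ))
    (F.expGrowth_mul_weight hm θ hg) continuous_id continuous_const

lemma hasFDerivAt_weight_right (F : Pressure S) (m θ : ℝ) (y : S → ℝ) :
    HasFDerivAt (F.weight m θ)
      (linForm' fun τ => m * F.P τ θ y * F.weight m θ y) y := by
  have h1 : HasFDerivAt (fun y : S → ℝ => (θ, y))
      (ContinuousLinearMap.inr ℝ ℝ (S → ℝ)) y := hasFDerivAt_prodMk_right θ y
  have h2 := (((F.hasFDerivAt (θ, y)).comp y h1).const_mul m).exp
  refine h2.congr_fderiv ?_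
  ext h
  simp [weight, Finset.mul_sum]
  refine Finset.sum_congr rfl fun σ _ => by ring

/-- The gradient in `y` of a Gaussian average. -/
lemma hasFDerivAt_avg (hm : 0 ≤ m) (hg : BddCont g) {g1 : S → (S → ℝ) → ℝ}
    (hg1 : ∀ τ, BddCont (g1 τ)) (hd : ∀ y, HasFDerivAt g (linForm' fun τ => g1 τ y) y)
    (y : S → ℝ) :
    HasFDerivAt (F.avg m θ w g)
      (linForm' fun τ => F.avg m θ w (fun y => g1 τ y + m * (g y * F.P τ θ y)) y) y := by
  have hbc : ∀ τ, BddCont fun y => g1 τ y + m * (g y * F.P τ θ y) := fun τ =>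
    (hg1 τ).add ((hg.mul (F.bddCont_P τ θ)).const_mul m)
  set G' : (S → ℝ) → (S → ℝ) →L[ℝ] ℝ := fun y =>
    linForm' fun τ => (g1 τ y + m * (g y * F.P τ θ y)) * F.weight m θ y with hG'
  have hG : ∀ y, HasFDerivAt (fun y => g y * F.weight m θ y) (G' y) y := by
    intro y
    refine ((hd y).mul (F.hasFDerivAt_weight_right m θ y)).congr_fderiv ?_
    ext h
    simp only [hG', _root_.add_apply, _root_.smul_apply,
      linForm'_apply, smul_eq_mul, Finset.mul_sum]
    rw [← Finset.sum_add_distrib]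
    exact Finset.sum_congr rfl fun σ _ => by ring
  have hgr : ExpGrowth G' := by
    have h1 : ExpGrowth fun y => ∑ τ, |(g1 τ y + m * (g y * F.P τ θ y)) * F.weight m θ y| :=
      ExpGrowth.sum _ fun τ _ => (F.expGrowth_mul_weight hm θ (hbc τ)).mono 1 zero_le_one
        fun e => by simp
    refine h1.mono 1 zero_le_one fun y => ?_
    rw [one_mul, Real.norm_of_nonneg (Finset.sum_nonneg fun _ _ => abs_nonneg _)]
    exact norm_linForm'_le _
  have hcont : Continuous G' := by
    simp only [hG', linForm']
    exact continuous_finsetSum _ fun τ _ =>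
      ((hbc τ).1.mul (F.continuous_weight m θ)).smul continuous_const
  have h := hasFDerivAt_gaussian_avg hG (F.expGrowth_mul_weight hm θ hg) hgr
    (a := fun y => y) (b := fun _ => w) (a' := fun _ => ContinuousLinearMap.id ℝ (S → ℝ))
    (b' := fun _ => 0) (p0 := y) (Eventually.of_forall fun p => hasFDerivAt_id p)
    (Eventually.of_forall fun p => hasFDerivAt_const w p) continuousAt_const continuousAt_const
    (hcont.comp (by fun_prop : Continuous fun z : ℝ => y + z • w)).aestronglyMeasurable
  refine h.congr_fderiv ?_
  have h2 : ∀ z : ℝ, (G' (y + z • w)).comp (ContinuousLinearMap.id ℝ (S → ℝ) + z • 0)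
      = ∑ τ, ((g1 τ (y + z • w) + m * (g (y + z • w) * F.P τ θ (y + z • w)))
        * F.weight m θ (y + z • w)) • (ContinuousLinearMap.proj τ : (S → ℝ) →L[ℝ] ℝ) := by
    intro z
    simp [hG', linForm']
  simp only [h2]
  rw [integral_finsetSum _ fun τ _ => (integrable_avg hm (hbc τ) y).smul_const _]
  simp only [integral_smul_const]
  rfl

/-- Gaussian integration by parts for the averages. -/
lemma integral_mul_avg (hm : 0 ≤ m) (hg : BddCont g) {g1 : S → (S → ℝ) → ℝ}
    (hg1 : ∀ τ, BddCont (g1 τ)) (hd : ∀ y, HasFDerivAt g (linForm' fun τ => g1 τ y) y)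
    (y : S → ℝ) :
    ∫ z, z * (g (y + z • w) * F.weight m θ (y + z • w)) ∂(gaussianReal 0 1)
      = F.avg m θ w (fun y => ∑ τ, (g1 τ y + m * (g y * F.P τ θ y)) * w τ) y := by
  have hbc : BddCont fun y => ∑ τ, (g1 τ y + m * (g y * F.P τ θ y)) * w τ :=
    BddCont.sum fun τ _ =>
      ((hg1 τ).add ((hg.mul (F.bddCont_P τ θ)).const_mul m)).mul (BddCont.const _)
  refine integral_mul_gaussianReal (F := fun z => g (y + z • w) * F.weight m θ (y + z • w))
    (fun z => ?_) ?_ ((F.expGrowth_mul_weight hm θ hg).comp_line y w)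
    ((F.expGrowth_mul_weight hm θ hbc).comp_line y w)
  · have h1 : HasDerivAt (fun z : ℝ => y + z • w) w z := by
      simpa using ((hasDerivAt_id z).smul_const w).const_add y
    have h2 := ((hd (y + z • w)).mul (F.hasFDerivAt_weight_right m θ _)).comp_hasDerivAt z h1
    refine h2.congr_deriv ?_
    simp only [_root_.add_apply, _root_.smul_apply,
      linForm'_apply, smul_eq_mul, Finset.mul_sum, Finset.sum_mul]
    rw [← Finset.sum_add_distrib]
    exact Finset.sum_congr rfl fun σ _ => by ring
  · exact (hbc.1.mul (F.continuous_weight m θ)).comp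
      (by fun_prop : Continuous fun z : ℝ => y + z • w)

lemma integral_smul_add_smul_add_sum_smul {V : Type*} [NormedAddCommGroup V] [NormedSpace ℝ V]
    [CompleteSpace V] {μ : Measure ℝ} {φ ψ : ℝ → ℝ} {χ : S → ℝ → ℝ} (hφ : Integrable φ μ)
    (hψ : Integrable ψ μ) (hχ : ∀ σ, Integrable (χ σ) μ) (a b : V) (c : S → V) :
    ∫ z, (φ z • a + ψ z • b + ∑ σ, χ σ z • c σ) ∂μ
      = (∫ z, φ z ∂μ) • a + (∫ z, ψ z ∂μ) • b + ∑ σ, (∫ z, χ σ z ∂μ) • c σ := by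
  have h3 : ∀ σ, Integrable (fun z => χ σ z • c σ) μ := fun σ => (hχ σ).smul_const _
  have h12 : Integrable (fun z => φ z • a + ψ z • b) μ :=
    (hφ.smul_const a).add (hψ.smul_const b)
  rw [integral_add h12 (integrable_finsetSum _ fun σ _ => h3 σ),
    integral_add (hφ.smul_const a) (hψ.smul_const b),
    integral_finsetSum _ fun σ _ => h3 σ]
  simp only [integral_smul_const]

/-- The derivative of the normalization in all variables. -/
lemma hasFDerivAt_avg_one (hm : 0 ≤ m) (b : Bool) (v : S → ℝ) (p : ℝ × (S → ℝ)) :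
    HasFDerivAt (fun p : ℝ × (S → ℝ) => F.avg m p.1 (coef b p.1 • v) (fun _ => 1) p.2)
      (linForm (m * F.avg m p.1 (coef b p.1 • v) (fun y => F.T p.1 y +
        coefSign b * (Real.sin p.1 * Real.cos p.1) *
          ∑ σ, ∑ τ, v σ * v τ * (F.H σ τ p.1 y + m * (F.P σ p.1 y * F.P τ p.1 y))) p.2)
        fun σ => m * F.avg m p.1 (coef b p.1 • v) (F.P σ p.1) p.2) p := by
  obtain ⟨θ, y⟩ := p
  set w := coef b θ • v with hw
  set G' : ℝ × (S → ℝ) → ℝ × (S → ℝ) →L[ℝ] ℝ := fun p =>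
    (m * F.weight m p.1 p.2) • linForm (F.T p.1 p.2) (fun σ => F.P σ p.1 p.2) with hG'
  have hG : ∀ p, HasFDerivAt (fun p : ℝ × (S → ℝ) => F.weight m p.1 p.2) (G' p) p := by
    intro p
    refine (((F.hasFDerivAt p).const_mul m).exp).congr_fderiv ?_
    simp only [hG', smul_smul, mul_comm m, weight]
  have hgr : ExpGrowth G' := by
    refine (F.expGrowth_weight_prod hm).mono (m * (F.C + 1))
      (mul_nonneg hm (by linarith [F.C_nonneg])) fun p => ?_
    rw [hG', norm_smul, norm_mul, Real.norm_of_nonneg hm]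
    have := F.norm_deriv_le p
    have h2 : 0 ≤ m * ‖F.weight m p.1 p.2‖ := by positivity
    nlinarith [mul_le_mul_of_nonneg_left this h2]
  have hcont : Continuous fun y : S → ℝ => G' (θ, y) := by
    simp only [hG', linForm]
    refine (continuous_const.mul (F.continuous_weight m θ)).smul (Continuous.add ?_ ?_)
    · exact (F.continuous_T θ).smul continuous_const
    · exact continuous_finsetSum _ fun σ _ => (F.bddCont_P σ θ).1.smul continuous_const
  have h := hasFDerivAt_gaussian_avg (p0 := ((θ, y) : ℝ × (S → ℝ))) hG
    (F.expGrowth_weight_prod hm) hgr (a := fun p => p)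
    (b := fun p => ((0 : ℝ), coef b p.1 • v))
    (a' := fun _ => ContinuousLinearMap.id ℝ (ℝ × (S → ℝ)))
    (b' := fun p => coefDeriv b p.1 • ((ContinuousLinearMap.inr ℝ ℝ (S → ℝ)).comp
      ((ContinuousLinearMap.fst ℝ ℝ (S → ℝ)).smulRight v)))
    (Eventually.of_forall fun p => hasFDerivAt_id p)
    (Eventually.of_forall fun p => ?_) continuousAt_const
    (((continuous_coefDeriv b).comp continuous_fst).smul continuous_const).continuousAt
    (by
      have e : ∀ z : ℝ, ((θ, y) : ℝ × (S → ℝ)) + z • ((0 : ℝ), coef b θ • v)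
          = (θ, y + z • w) := by
        intro z; simp [hw]
      simp only [e]
      exact (hcont.comp (by fun_prop : Continuous fun z : ℝ => y + z • w)).aestronglyMeasurable)
  swap
  · have h1 : HasFDerivAt (fun p : ℝ × (S → ℝ) => coef b p.1)
        (coefDeriv b p.1 • ContinuousLinearMap.fst ℝ ℝ (S → ℝ)) p :=
      (hasDerivAt_coef b p.1).comp_hasFDerivAt p hasFDerivAt_fst
    have h2 := (hasFDerivAt_const (0 : ℝ) p).prodMk (h1.smul_const v)
    refine h2.congr_fderiv ?_
    ext h <;> simp
  have e : ∀ (p : ℝ × (S → ℝ)) (z : ℝ), p + z • ((0 : ℝ), coef b p.1 • v)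
      = (p.1, p.2 + z • (coef b p.1 • v)) := by
    intro p z; ext <;> simp
  simp only [e] at h
  have hfun : (fun p : ℝ × (S → ℝ) => F.avg m p.1 (coef b p.1 • v) (fun _ => 1) p.2)
      = fun p => ∫ z, F.weight m p.1 (p.2 + z • coef b p.1 • v) ∂(gaussianReal 0 1) := by
    ext p; simp [avg]
  rw [hfun]
  refine h.congr_fderiv ?_
  -- the direction derivative of the weight, whose mean against `z` is found by parts
  set g : (S → ℝ) → ℝ := fun y => ∑ σ, v σ * F.P σ θ y with hgdef
  have hgb : BddCont g := BddCont.sum fun σ _ => (F.bddCont_P σ θ).const_mul (v σ)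
  set g1 : S → (S → ℝ) → ℝ := fun τ y => ∑ σ, v σ * F.H σ τ θ y with hg1def
  have hg1b : ∀ τ, BddCont (g1 τ) := fun τ =>
    BddCont.sum fun σ _ => (F.bddCont_H σ τ θ).const_mul (v σ)
  have hgd : ∀ y, HasFDerivAt g (linForm' fun τ => g1 τ y) y := by
    intro y
    refine (HasFDerivAt.fun_sum fun σ _ => (F.hasFDerivAt_P σ θ y).const_mul (v σ)).congr_fderiv ?_
    ext h
    simp only [hg1def, _root_.sum_apply, _root_.smul_apply,
      linForm'_apply, smul_eq_mul, Finset.mul_sum, Finset.sum_mul]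
    rw [Finset.sum_comm]
    exact Finset.sum_congr rfl fun σ _ => Finset.sum_congr rfl fun τ _ => by ring
  have hibp := integral_mul_avg (F := F) (θ := θ) (w := w) hm hgb hg1b hgd y
  have hdec : ∀ z : ℝ, (G' (θ, y + z • w)).comp (ContinuousLinearMap.id ℝ (ℝ × (S → ℝ)) +
      z • coefDeriv b θ • ((ContinuousLinearMap.inr ℝ ℝ (S → ℝ)).comp
      ((ContinuousLinearMap.fst ℝ ℝ (S → ℝ)).smulRight v)))
      = (F.T θ (y + z • w) * F.weight m θ (y + z • w)) •
          (m • ContinuousLinearMap.fst ℝ ℝ (S → ℝ)) +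
        (z * (g (y + z • w) * F.weight m θ (y + z • w))) •
          ((m * coefDeriv b θ) • ContinuousLinearMap.fst ℝ ℝ (S → ℝ)) +
        ∑ σ, (F.P σ θ (y + z • w) * F.weight m θ (y + z • w)) •
          (m • (ContinuousLinearMap.proj σ).comp (ContinuousLinearMap.snd ℝ ℝ (S → ℝ))) := by
    intro z
    refine ContinuousLinearMap.ext fun h => ?_
    simp only [hG', hgdef, ContinuousLinearMap.comp_apply, _root_.add_apply,
      _root_.smul_apply, _root_.sum_apply, linForm_apply, smul_eq_mul,
      ContinuousLinearMap.id_apply, ContinuousLinearMap.inr_apply, Prod.fst_add, Prod.snd_add,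
      Prod.smul_fst, Prod.smul_snd, Pi.add_apply, Pi.smul_apply,
      ContinuousLinearMap.smulRight_apply, ContinuousLinearMap.coe_fst',
      ContinuousLinearMap.coe_snd', ContinuousLinearMap.proj_apply, mul_add,
      Finset.sum_add_distrib, Finset.mul_sum, Finset.sum_mul]
    have e1 : ∀ σ : S, m * F.weight m θ (y + z • w) * (F.P σ θ (y + z • w) * h.2 σ)
        = F.P σ θ (y + z • w) * F.weight m θ (y + z • w) * (m * h.2 σ) := fun σ => by ring
    have e2 : ∀ σ : S, m * F.weight m θ (y + z • w) *
          (F.P σ θ (y + z • w) * (z * (coefDeriv b θ * (h.1 * v σ))))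
        = z * (v σ * F.P σ θ (y + z • w) * F.weight m θ (y + z • w)) *
          (m * coefDeriv b θ * h.1) := fun σ => by ring
    simp only [e1, e2]
    ring
  have i1 := integrable_avg (F := F) (θ := θ) (w := w) hm (F.bddCont_T θ) y
  have i2 : Integrable (fun z : ℝ => z * (g (y + z • w) * F.weight m θ (y + z • w)))
      (gaussianReal 0 1) := by
    refine ExpGrowth.integrable
      (ExpGrowth.id_real.mul ((F.expGrowth_mul_weight hm θ hgb).comp_line y w)) ?_
    exact (continuous_id.mul ((hgb.1.mul (F.continuous_weight m θ)).comp
      (by fun_prop : Continuous fun z : ℝ => y + z • w))).aestronglyMeasurable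
  have i3 := fun σ => integrable_avg (F := F) (θ := θ) (w := w) hm (F.bddCont_P σ θ) y
  refine ((integral_congr_ae (Eventually.of_forall hdec)).trans
    (integral_smul_add_smul_add_sum_smul i1 i2 i3 _ _ _)).trans ?_
  rw [hibp]
  dsimp only
  set Q : (S → ℝ) → ℝ := fun y =>
    ∑ σ, ∑ τ, v σ * v τ * (F.H σ τ θ y + m * (F.P σ θ y * F.P τ θ y)) with hQ
  have hQb : BddCont Q := BddCont.sum fun σ _ => BddCont.sum fun τ _ =>
    ((F.bddCont_H σ τ θ).add
      (((F.bddCont_P σ θ).mul (F.bddCont_P τ θ)).const_mul m)).const_mul _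
  have e1 : (fun y => ∑ τ, (g1 τ y + m * (g y * F.P τ θ y)) * w τ)
      = fun y => coef b θ * Q y := by
    ext y
    simp only [hQ, hg1def, hgdef, hw, Pi.smul_apply, smul_eq_mul, Finset.mul_sum,
      Finset.sum_mul]
    simp only [← Finset.sum_add_distrib, Finset.sum_mul]
    rw [Finset.sum_comm]
    exact Finset.sum_congr rfl fun σ _ => Finset.sum_congr rfl fun τ _ => by ring
  have e2 : F.avg m θ w (fun y => F.T θ y +
      coefSign b * (Real.sin θ * Real.cos θ) * Q y) y
      = F.avg m θ w (F.T θ) y +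
        coefSign b * (Real.sin θ * Real.cos θ) * F.avg m θ w Q y := by
    rw [avg_add hm (F.bddCont_T θ) (hQb.const_mul _), avg_const_mul]
  rw [e1, avg_const_mul]
  trans linForm (m * (F.avg m θ w (F.T θ) y + coefDeriv b θ * coef b θ * F.avg m θ w Q y))
    fun σ => m * F.avg m θ w (F.P σ θ) y
  · refine ContinuousLinearMap.ext fun h => ?_
    simp only [linForm_apply, _root_.add_apply,
      _root_.smul_apply, _root_.sum_apply, smul_eq_mul,
      ContinuousLinearMap.comp_apply, ContinuousLinearMap.coe_fst',
      ContinuousLinearMap.coe_snd', ContinuousLinearMap.proj_apply]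
    change F.avg m θ w (F.T θ) y * (m * h.1) +
        coef b θ * F.avg m θ w Q y * (m * coefDeriv b θ * h.1) +
        ∑ σ, F.avg m θ w (F.P σ θ) y * (m * h.2 σ) = _
    have e3 : ∀ σ, F.avg m θ w (F.P σ θ) y * (m * h.2 σ)
        = m * F.avg m θ w (F.P σ θ) y * h.2 σ := fun σ => by ring
    simp only [e3]
    ring
  · rw [coefDeriv_mul_coef, ← e2]

end Pressure

end Interpolation

/-! ### Gaussian steps and the differential inequality -/

section Interpolation

variable {S : Type*} [Fintype S]

namespace Pressure

variable {F : Pressure S} {m θ : ℝ} {w : S → ℝ} {g g' : (S → ℝ) → ℝ}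

variable (F m θ w g) in
/-- The expectation of `g` under the Gaussian measure tilted by the weight `exp (m Φ)`. -/
def tilt (y : S → ℝ) : ℝ := F.avg m θ w g y / F.avg m θ w (fun _ => 1) y

lemma tilt_add (hm : 0 ≤ m) (hg : BddCont g) (hg' : BddCont g') (y : S → ℝ) :
    F.tilt m θ w (fun y => g y + g' y) y = F.tilt m θ w g y + F.tilt m θ w g' y := by
  rw [tilt, avg_add hm hg hg', add_div]
  rfl

lemma tilt_const_mul (c : ℝ) (y : S → ℝ) :
    F.tilt m θ w (fun y => c * g y) y = c * F.tilt m θ w g y := by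
  rw [tilt, avg_const_mul, mul_div_assoc]
  rfl

lemma tilt_sum (hm : 0 ≤ m) {ι : Type*} {s : Finset ι} {g : ι → (S → ℝ) → ℝ}
    (hg : ∀ i ∈ s, BddCont (g i)) (y : S → ℝ) :
    F.tilt m θ w (fun y => ∑ i ∈ s, g i y) y = ∑ i ∈ s, F.tilt m θ w (g i) y := by
  rw [tilt, avg_sum hm hg, Finset.sum_div]
  rfl

lemma tilt_const (hm : 0 ≤ m) (c : ℝ) (y : S → ℝ) : F.tilt m θ w (fun _ => c) y = c := by
  have h := tilt_const_mul (F := F) (m := m) (θ := θ) (w := w) (g := fun _ => 1) c y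
  simp only [mul_one] at h
  rw [h, tilt, div_self (avg_one_pos hm y).ne', mul_one]

lemma tilt_mono (hm : 0 ≤ m) (hg : BddCont g) (hg' : BddCont g') (h : ∀ y, g y ≤ g' y)
    (y : S → ℝ) : F.tilt m θ w g y ≤ F.tilt m θ w g' y :=
  div_le_div_of_nonneg_right (avg_mono hm hg hg' h y) (avg_one_pos hm y).le

lemma tilt_le (hm : 0 ≤ m) (hg : BddCont g) {B : ℝ} (h : ∀ y, g y ≤ B) (y : S → ℝ) :
    F.tilt m θ w g y ≤ B :=
  (tilt_mono hm hg (BddCont.const B) h y).trans_eq (tilt_const hm B y)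

lemma le_tilt (hm : 0 ≤ m) (hg : BddCont g) {B : ℝ} (h : ∀ y, B ≤ g y) (y : S → ℝ) :
    B ≤ F.tilt m θ w g y :=
  (tilt_const hm B y).symm.trans_le (tilt_mono hm (BddCont.const B) hg h y)

lemma abs_tilt_le (hm : 0 ≤ m) (hg : BddCont g) {B : ℝ} (h : ∀ y, |g y| ≤ B) (y : S → ℝ) :
    |F.tilt m θ w g y| ≤ B :=
  abs_le.2 ⟨le_tilt hm hg (fun y => neg_le_of_abs_le (h y)) y,
    tilt_le hm hg (fun y => le_of_abs_le (h y)) y⟩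

lemma continuous_tilt (hm : 0 ≤ m) (hg : BddCont g) : Continuous (F.tilt m θ w g) :=
  (continuous_avg hm hg).div (continuous_avg hm (BddCont.const 1))
    fun y => (avg_one_pos hm y).ne'

variable (F) in
/-- The second derivative `∂_σ ∂_τ exp (m Φ)`, divided by `m exp (m Φ)`. -/
def hess (m : ℝ) (σ τ : S) (θ : ℝ) (y : S → ℝ) : ℝ :=
  F.H σ τ θ y + m * (F.P σ θ y * F.P τ θ y)

lemma bddCont_hess (m : ℝ) (σ τ : S) (θ : ℝ) : BddCont (F.hess m σ τ θ) :=
  (F.bddCont_H σ τ θ).add (((F.bddCont_P σ θ).mul (F.bddCont_P τ θ)).const_mul m)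

lemma abs_hess_le (hm : 0 ≤ m) (σ τ : S) (y : S → ℝ) : |F.hess m σ τ θ y| ≤ F.C + m := by
  refine (abs_add_le _ _).trans (add_le_add (F.H_le _ _ _ _) ?_)
  have h1 := F.P_nonneg σ θ y
  have h2 := F.P_nonneg τ θ y
  rw [abs_of_nonneg (by positivity)]
  exact mul_le_of_le_one_right hm (mul_le_one₀ (F.P_le_one _ _ _) h2 (F.P_le_one _ _ _))

lemma bddCont_rate (m : ℝ) (b : Bool) (v : S → ℝ) (θ : ℝ) :
    BddCont fun y => F.T θ y + coefSign b * (Real.sin θ * Real.cos θ) *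
      ∑ σ, ∑ τ, v σ * v τ * F.hess m σ τ θ y :=
  (F.bddCont_T θ).add ((BddCont.sum fun σ _ => BddCont.sum fun τ _ =>
    (F.bddCont_hess m σ τ θ).const_mul _).const_mul _)

lemma hasFDerivAt_tilt_P (hm : 0 ≤ m) (σ : S) (y : S → ℝ) :
    HasFDerivAt (F.tilt m θ w (F.P σ θ)) (linForm' fun τ =>
      F.tilt m θ w (F.hess m σ τ θ) y -
        m * (F.tilt m θ w (F.P σ θ) y * F.tilt m θ w (F.P τ θ) y)) y := by
  have h1 : HasFDerivAt (F.avg m θ w (F.P σ θ))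
      (linForm' fun τ => F.avg m θ w (F.hess m σ τ θ) y) y :=
    hasFDerivAt_avg hm (F.bddCont_P σ θ) (fun τ => F.bddCont_H σ τ θ)
      (fun y => F.hasFDerivAt_P σ θ y) y
  have h2 := hasFDerivAt_avg (F := F) (θ := θ) (w := w) (g := fun _ => 1) (g1 := fun _ _ => 0) hm
    (BddCont.const 1) (fun _ => BddCont.const 0)
    (fun y => (hasFDerivAt_const (1 : ℝ) y).congr_fderiv (by ext; simp)) y
  have hne := (avg_one_pos (F := F) (θ := θ) (w := w) hm y).ne'
  have h3 := h1.mul ((hasDerivAt_inv hne).comp_hasFDerivAt y h2)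
  have h4 : F.tilt m θ w (F.P σ θ)
      = fun y => F.avg m θ w (F.P σ θ) y * (F.avg m θ w (fun _ => 1) y)⁻¹ := by
    ext y; rw [tilt, div_eq_mul_inv]
  rw [h4]
  refine h3.congr_fderiv ?_
  refine ContinuousLinearMap.ext fun h => ?_
  simp only [zero_add, one_mul, avg_const_mul, _root_.add_apply, _root_.smul_apply,
    linForm'_apply, smul_eq_mul, Finset.mul_sum]
  rw [← Finset.sum_add_distrib]
  refine Finset.sum_congr rfl fun τ _ => ?_
  simp only [tilt, Function.comp]
  field_simp
  ring

/-- Averaging a pressure over a Gaussian energy `coef b θ · z · v`: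
`(θ, y) ↦ m⁻¹ log E exp (m Φ(θ, y + coef b θ · z · v))`. -/
def step (F : Pressure S) (m : ℝ) (hm : 0 < m) (b : Bool) (v : S → ℝ) : Pressure S where
  Φ θ y := 1 / m * Real.log (F.avg m θ (coef b θ • v) (fun _ => 1) y)
  T θ := F.tilt m θ (coef b θ • v) fun y => F.T θ y +
    coefSign b * (Real.sin θ * Real.cos θ) * ∑ σ, ∑ τ, v σ * v τ * F.hess m σ τ θ y
  P σ θ := F.tilt m θ (coef b θ • v) (F.P σ θ)
  H σ τ θ y := F.tilt m θ (coef b θ • v) (F.hess m σ τ θ) y -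
    m * (F.tilt m θ (coef b θ • v) (F.P σ θ) y * F.tilt m θ (coef b θ • v) (F.P τ θ) y)
  C := F.C + 2 * m + (∑ σ, ∑ τ, |v σ * v τ|) * (F.C + m)
  hasFDerivAt p := by
    have hne := (avg_one_pos (F := F) (θ := p.1) (w := coef b p.1 • v) hm.le p.2).ne'
    refine (((hasFDerivAt_avg_one hm.le b v p).log hne).const_mul (1 / m)).congr_fderiv ?_
    have e : ∀ X t : ℝ, 1 / m * ((F.avg m p.1 (coef b p.1 • v) (fun _ => 1) p.2)⁻¹ * (m * X * t))
        = X / F.avg m p.1 (coef b p.1 • v) (fun _ => 1) p.2 * t := fun X t => by field_simp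
    refine ContinuousLinearMap.ext fun h => ?_
    simp only [_root_.smul_apply, linForm_apply, smul_eq_mul, mul_add (F.avg _ _ _ _ _)⁻¹,
      mul_add (1 / m), Finset.mul_sum, e]
    rfl
  hasFDerivAt_P σ θ y := hasFDerivAt_tilt_P hm.le σ y
  continuous_T θ := continuous_tilt hm.le (bddCont_rate m b v θ)
  continuous_H σ τ θ := (continuous_tilt hm.le (bddCont_hess m σ τ θ)).sub
    (continuous_const.mul ((continuous_tilt hm.le (F.bddCont_P σ θ)).mul
      (continuous_tilt hm.le (F.bddCont_P τ θ))))
  P_nonneg σ θ y := le_tilt hm.le (F.bddCont_P σ θ) (F.P_nonneg σ θ) y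
  P_sum θ y := by
    rw [← tilt_sum hm.le fun σ _ => F.bddCont_P σ θ]
    simp only [F.P_sum]
    exact tilt_const hm.le 1 y
  T_le θ y := by
    refine abs_tilt_le hm.le (bddCont_rate m b v θ) (fun y => ?_) y
    have h1 : |coefSign b * (Real.sin θ * Real.cos θ)| ≤ 1 := by
      rw [abs_mul, abs_mul]
      have h2 : |coefSign b| = 1 := by cases b <;> simp [coefSign]
      rw [h2, one_mul]
      exact mul_le_one₀ (Real.abs_sin_le_one θ) (abs_nonneg _) (Real.abs_cos_le_one θ)
    have h3 : |∑ σ, ∑ τ, v σ * v τ * F.hess m σ τ θ y|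
        ≤ (∑ σ, ∑ τ, |v σ * v τ|) * (F.C + m) := by
      rw [Finset.sum_mul]
      refine (Finset.abs_sum_le_sum_abs _ _).trans (Finset.sum_le_sum fun σ _ => ?_)
      rw [Finset.sum_mul]
      refine (Finset.abs_sum_le_sum_abs _ _).trans (Finset.sum_le_sum fun τ _ => ?_)
      rw [abs_mul]
      exact mul_le_mul_of_nonneg_left (abs_hess_le hm.le _ _ _) (abs_nonneg _)
    have h4 := F.T_le θ y
    refine (abs_add_le _ _).trans ?_
    rw [abs_mul]
    have h5 := mul_le_mul h1 h3 (abs_nonneg _) zero_le_one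
    linarith
  H_le σ τ θ y := by
    have h1 := abs_tilt_le (F := F) (θ := θ) (w := coef b θ • v) hm.le (F.bddCont_hess m σ τ θ)
      (fun y => abs_hess_le hm.le σ τ y) y
    have h2 : ∀ σ, |F.tilt m θ (coef b θ • v) (F.P σ θ) y| ≤ 1 := fun σ =>
      abs_tilt_le hm.le (F.bddCont_P σ θ)
        (fun y => by rw [abs_of_nonneg (F.P_nonneg σ θ y)]; exact F.P_le_one σ θ y) y
    have h3 : |m * (F.tilt m θ (coef b θ • v) (F.P σ θ) y *
        F.tilt m θ (coef b θ • v) (F.P τ θ) y)| ≤ m := by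
      rw [abs_mul, abs_mul, abs_of_pos hm]
      exact mul_le_of_le_one_right hm.le (mul_le_one₀ (h2 σ) (abs_nonneg _) (h2 τ))
    have h4 : 0 ≤ (∑ σ, ∑ τ, |v σ * v τ|) * (F.C + m) :=
      mul_nonneg (Finset.sum_nonneg fun _ _ => Finset.sum_nonneg fun _ _ => abs_nonneg _)
        (by linarith [F.C_nonneg])
    refine (abs_sub _ _).trans ?_
    linarith

/-- The differential inequality propagated along the interpolation. Here `D` is half the rate, in
units of `sin θ cos θ`, at which the covariance of the Gaussian energies averaged outside of `F`
grows, and `m` is the exponent of the next average outside of `F`. -/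
def RateBound (F : Pressure S) (D : S → S → ℝ) (m B : ℝ) : Prop :=
  ∀ θ ∈ Icc 0 (Real.pi / 2), ∀ y, F.T θ y + Real.sin θ * Real.cos θ *
    ∑ σ, ∑ τ, D σ τ * F.hess m σ τ θ y ≤ Real.sin θ * Real.cos θ * B

lemma sin_mul_cos_nonneg {θ : ℝ} (hθ : θ ∈ Icc 0 (Real.pi / 2)) :
    0 ≤ Real.sin θ * Real.cos θ :=
  mul_nonneg (Real.sin_nonneg_of_nonneg_of_le_pi hθ.1 (by linarith [hθ.2, Real.pi_pos]))
    (Real.cos_nonneg_of_neg_pi_div_two_le_of_le (by linarith [hθ.1, Real.pi_pos]) hθ.2)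

/-- Averaging over one more Gaussian energy moves its covariance `± v vᵀ` from the outside to the
inside. -/
lemma RateBound.step {D : S → S → ℝ} {B : ℝ} (hm : 0 < m) (b : Bool) (v : S → ℝ)
    (h : F.RateBound (fun σ τ => D σ τ + coefSign b * (v σ * v τ)) m B) :
    (F.step m hm b v).RateBound D m B := by
  intro θ hθ y
  have e1 : ∀ σ τ, (F.step m hm b v).hess m σ τ θ y
      = F.tilt m θ (coef b θ • v) (F.hess m σ τ θ) y := by
    intro σ τ
    simp only [hess, Pressure.step]
    exact sub_add_cancel _ _
  have hQ : BddCont fun y => ∑ σ, ∑ τ, D σ τ * F.hess m σ τ θ y :=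
    BddCont.sum fun σ _ => BddCont.sum fun τ _ => (F.bddCont_hess m σ τ θ).const_mul _
  have e2 : ∑ σ, ∑ τ, D σ τ * (F.step m hm b v).hess m σ τ θ y
      = F.tilt m θ (coef b θ • v) (fun y => ∑ σ, ∑ τ, D σ τ * F.hess m σ τ θ y) y := by
    rw [tilt_sum hm.le fun σ _ => BddCont.sum fun τ _ => (F.bddCont_hess m σ τ θ).const_mul _]
    refine Finset.sum_congr rfl fun σ _ => ?_
    rw [tilt_sum hm.le fun τ _ => (F.bddCont_hess m σ τ θ).const_mul _]
    refine Finset.sum_congr rfl fun τ _ => ?_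
    rw [e1, tilt_const_mul]
  rw [e2, ← tilt_const_mul]
  change F.tilt m θ (coef b θ • v) _ y + _ ≤ _
  rw [← tilt_add hm.le (bddCont_rate m b v θ) (hQ.const_mul _)]
  refine tilt_le hm.le ((bddCont_rate m b v θ).add (hQ.const_mul _)) (fun y => ?_) y
  refine le_of_eq_of_le ?_ (h θ hθ y)
  simp only [add_mul, Finset.sum_add_distrib, mul_add]
  have e3 : ∑ σ, ∑ τ, coefSign b * (v σ * v τ) * F.hess m σ τ θ y
      = coefSign b * ∑ σ, ∑ τ, v σ * v τ * F.hess m σ τ θ y := by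
    simp only [Finset.mul_sum, mul_assoc]
  rw [e3]
  ring

/-- Lowering the outer exponent costs the quadratic form of `D` at the gradient, which is a
probability vector. -/
lemma RateBound.weaken {D : S → S → ℝ} {B m₀ e : ℝ} (h : F.RateBound D m B) (hm : m₀ ≤ m)
    (hD : ∀ σ τ, e ≤ D σ τ) : F.RateBound D m₀ (B - (m - m₀) * e) := by
  intro θ hθ y
  have h1 := h θ hθ y
  have h2 : ∑ σ, ∑ τ, D σ τ * F.hess m₀ σ τ θ y = ∑ σ, ∑ τ, D σ τ * F.hess m σ τ θ y
      - (m - m₀) * ∑ σ, ∑ τ, D σ τ * (F.P σ θ y * F.P τ θ y) := by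
    simp only [Finset.mul_sum, ← Finset.sum_sub_distrib, hess]
    exact Finset.sum_congr rfl fun σ _ => Finset.sum_congr rfl fun τ _ => by ring
  have h3 : e ≤ ∑ σ, ∑ τ, D σ τ * (F.P σ θ y * F.P τ θ y) := by
    calc e = ∑ σ, ∑ τ, e * (F.P σ θ y * F.P τ θ y) := by
          simp only [← Finset.mul_sum, F.P_sum, mul_one]
      _ ≤ _ := Finset.sum_le_sum fun σ _ => Finset.sum_le_sum fun τ _ =>
          mul_le_mul_of_nonneg_right (hD σ τ) (mul_nonneg (F.P_nonneg _ _ _) (F.P_nonneg _ _ _))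
  have h4 := mul_le_mul_of_nonneg_left
    (mul_le_mul_of_nonneg_left h3 (sub_nonneg.2 hm)) (sin_mul_cos_nonneg hθ)
  rw [h2]
  linarith

lemma RateBound.mono {D : S → S → ℝ} {B B' : ℝ} (h : F.RateBound D m B) (hB : B ≤ B') :
    F.RateBound D m B' := fun θ hθ y =>
  (h θ hθ y).trans (mul_le_mul_of_nonneg_left hB (sin_mul_cos_nonneg hθ))

/-- The conclusion of the interpolation: the rate bound with nothing left outside is integrated
from `θ = 0` to `θ = π / 2`. -/
lemma RateBound.le {B : ℝ} (h : F.RateBound (fun _ _ => 0) m B) (y : S → ℝ) :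
    F.Φ (Real.pi / 2) y ≤ F.Φ 0 y + B / 2 := by
  have hd : ∀ θ, HasDerivAt (fun θ => F.Φ θ y - B / 2 * Real.sin θ ^ 2)
      (F.T θ y - Real.sin θ * Real.cos θ * B) θ := by
    intro θ
    have h1 : HasDerivAt (fun θ => F.Φ θ y) (F.T θ y) θ := by
      have := (F.hasFDerivAt (θ, y)).comp_hasDerivAt θ
        ((hasDerivAt_id θ).prodMk (hasDerivAt_const θ y))
      refine this.congr_deriv ?_
      simp
    have h2 := ((Real.hasDerivAt_sin θ).pow 2).const_mul (B / 2)
    refine (h1.sub h2).congr_deriv ?_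
    simp
    ring
  have hanti : AntitoneOn (fun θ => F.Φ θ y - B / 2 * Real.sin θ ^ 2) (Icc 0 (Real.pi / 2)) := by
    refine antitoneOn_of_deriv_nonpos (convex_Icc _ _)
      (fun θ _ => (hd θ).continuousAt.continuousWithinAt)
      (fun θ _ => (hd θ).differentiableAt.differentiableWithinAt) fun θ hθ => ?_
    rw [interior_Icc] at hθ
    rw [(hd θ).deriv]
    have := h θ (Ioo_subset_Icc_self hθ) y
    simp only [zero_mul, Finset.sum_const_zero, mul_zero, add_zero] at this
    linarith
  have hpi : (0 : ℝ) ≤ Real.pi / 2 := by positivity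
  have := hanti ⟨le_rfl, hpi⟩ ⟨hpi, le_rfl⟩ hpi
  simp only [Real.sin_pi_div_two, Real.sin_zero] at this
  linarith

section Gibbs

variable (S)

lemma hasFDerivAt_sum_exp (y : S → ℝ) :
    HasFDerivAt (fun y : S → ℝ => ∑ σ, Real.exp (y σ)) (linForm' fun σ => Real.exp (y σ)) y := by
  refine (HasFDerivAt.fun_sum fun σ _ => ((hasFDerivAt_apply σ y).exp)).congr_fderiv ?_
  rfl

variable [Nonempty S]

lemma sum_exp_pos (y : S → ℝ) : 0 < ∑ σ, Real.exp (y σ) :=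
  Finset.sum_pos (fun _ _ => Real.exp_pos _) Finset.univ_nonempty

open Classical in
/-- The pressure `log ∑ exp (y σ)` of the Gibbs measure itself. -/
def gibbs : Pressure S where
  Φ _ y := Real.log (∑ σ, Real.exp (y σ))
  T _ _ := 0
  P σ _ y := Real.exp (y σ) / ∑ τ, Real.exp (y τ)
  H σ τ _ y := (if σ = τ then Real.exp (y σ) / ∑ τ, Real.exp (y τ) else 0) -
    Real.exp (y σ) / (∑ τ, Real.exp (y τ)) * (Real.exp (y τ) / ∑ τ, Real.exp (y τ))
  C := 2
  hasFDerivAt p := by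
    refine (((hasFDerivAt_sum_exp S p.2).comp p hasFDerivAt_snd).log
      (sum_exp_pos S p.2).ne').congr_fderiv ?_
    refine ContinuousLinearMap.ext fun h => ?_
    simp only [_root_.smul_apply, linForm_apply, ContinuousLinearMap.comp_apply, linForm'_apply,
      smul_eq_mul, Finset.mul_sum, ContinuousLinearMap.coe_snd', zero_mul, zero_add]
    refine Finset.sum_congr rfl fun σ _ => ?_
    simp only [Function.comp]
    ring
  hasFDerivAt_P σ θ y := by
    have h1 := ((hasFDerivAt_apply (𝕜 := ℝ) σ y).exp).mul
      ((hasDerivAt_inv (sum_exp_pos S y).ne').comp_hasFDerivAt y (hasFDerivAt_sum_exp S y))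
    have h2 : (fun y : S → ℝ => Real.exp (y σ) / ∑ τ, Real.exp (y τ))
        = fun y => Real.exp (y σ) * (∑ τ, Real.exp (y τ))⁻¹ := by
      ext y; rw [div_eq_mul_inv]
    rw [h2]
    refine h1.congr_fderiv ?_
    refine ContinuousLinearMap.ext fun h => ?_
    have hne := (sum_exp_pos S y).ne'
    simp only [_root_.smul_apply, _root_.add_apply, ContinuousLinearMap.proj_apply,
      linForm'_apply, smul_eq_mul, Finset.mul_sum, sub_mul, Finset.sum_sub_distrib, ite_mul,
      zero_mul, Finset.sum_ite_eq, Finset.mem_univ, if_true, Function.comp]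
    rw [add_comm, sub_eq_add_neg, ← Finset.sum_neg_distrib]
    congr 1
    · ring
    · refine Finset.sum_congr rfl fun τ _ => ?_
      field_simp
  continuous_T _ := continuous_const
  continuous_H σ τ _ := by
    have hne : ∀ y : S → ℝ, ∑ τ, Real.exp (y τ) ≠ 0 := fun y => (sum_exp_pos S y).ne'
    split_ifs <;> fun_prop (disch := exact hne _)
  P_nonneg σ _ y := div_nonneg (Real.exp_pos _).le (sum_exp_pos S y).le
  P_sum _ y := by
    rw [← Finset.sum_div, div_self (sum_exp_pos S y).ne']
  T_le _ _ := by simp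
  H_le σ τ _ y := by
    have h1 : ∀ σ, Real.exp (y σ) / ∑ τ, Real.exp (y τ) ∈ Icc (0 : ℝ) 1 := fun σ =>
      ⟨div_nonneg (Real.exp_pos _).le (sum_exp_pos S y).le,
        (div_le_one (sum_exp_pos S y)).2 (Finset.single_le_sum
          (f := fun σ => Real.exp (y σ)) (fun _ _ => (Real.exp_pos _).le) (Finset.mem_univ σ))⟩
    have h2 := h1 σ
    have h3 := h1 τ
    have h4 : Real.exp (y σ) / (∑ τ, Real.exp (y τ)) * (Real.exp (y τ) / ∑ τ, Real.exp (y τ))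
      ∈ Icc (0 : ℝ) 1 := ⟨mul_nonneg h2.1 h3.1, mul_le_one₀ h2.2 h3.1 h3.2⟩
    rw [abs_le]
    split_ifs
    · constructor <;> linarith [h2.1, h2.2, h4.1, h4.2]
    · constructor <;> linarith [h4.1, h4.2]

variable {S}

open Classical in
lemma gibbs_rateBound {D : S → S → ℝ} {d e : ℝ} (hm : m ≤ 1) (hd : ∀ σ, D σ σ ≤ d)
    (he : ∀ σ τ, e ≤ D σ τ) : (gibbs S).RateBound D m (d - (1 - m) * e) := by
  refine RateBound.weaken (m := 1) ?_ hm he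
  intro θ hθ y
  have h1 : ∀ σ τ, D σ τ * (gibbs S).hess 1 σ τ θ y
      = if σ = τ then D σ τ * (gibbs S).P σ θ y else 0 := by
    intro σ τ
    simp only [hess, gibbs]
    split_ifs <;> ring
  have h2 : ∑ σ, ∑ τ, D σ τ * (gibbs S).hess 1 σ τ θ y ≤ d := by
    simp only [h1, Finset.sum_ite_eq, Finset.mem_univ, if_true]
    calc _ ≤ ∑ σ, d * (gibbs S).P σ θ y := Finset.sum_le_sum fun σ _ =>
          mul_le_mul_of_nonneg_right (hd σ) ((gibbs S).P_nonneg σ θ y)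
      _ = d := by rw [← Finset.mul_sum, (gibbs S).P_sum, mul_one]
  have h3 : (gibbs S).T θ y = 0 := rfl
  rw [h3, zero_add]
  exact mul_le_mul_of_nonneg_left h2 (sin_mul_cos_nonneg hθ)

end Gibbs

end Pressure

end Interpolation

/-! ### Averages over independent Gaussian couplings -/

namespace Pressure

variable {S : Type*} [Fintype S] {F : Pressure S} {m θ : ℝ}

lemma exp_mul_step (hm : 0 < m) (b : Bool) (v : S → ℝ) (y : S → ℝ) :
    Real.exp (m * (F.step m hm b v).Φ θ y) =
      ∫ z, Real.exp (m * F.Φ θ (y + z • (coef b θ • v))) ∂(gaussianReal 0 1) := by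
  have h := avg_one_pos (F := F) (θ := θ) (w := coef b θ • v) hm.le y
  change Real.exp (m * (1 / m * Real.log _)) = _
  rw [← mul_assoc, mul_one_div_cancel hm.ne', one_mul, Real.exp_log h]
  simp [avg, weight]

lemma step_of_coef_eq_zero (hm : 0 < m) {b : Bool} (v : S → ℝ) (h : coef b θ = 0) (y : S → ℝ) :
    (F.step m hm b v).Φ θ y = F.Φ θ y := by
  have h1 := exp_mul_step (F := F) (θ := θ) hm b v y
  simp only [h, zero_smul, smul_zero, add_zero, integral_const, probReal_univ, one_smul] at h1
  exact mul_left_cancel₀ hm.ne' (Real.exp_injective h1)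

variable {ι : Type*}

/-- Averaging a pressure over independent Gaussian energies in the directions `v i`, `i ∈ l`. -/
def block (F : Pressure S) (m : ℝ) (hm : 0 < m) (b : Bool) (v : ι → S → ℝ) (l : List ι) :
    Pressure S :=
  l.foldr (fun i G => G.step m hm b (v i)) F

lemma block_of_coef_eq_zero (hm : 0 < m) {b : Bool} (v : ι → S → ℝ) (l : List ι)
    (h : coef b θ = 0) (y : S → ℝ) : (F.block m hm b v l).Φ θ y = F.Φ θ y := by
  induction l with
  | nil => rfl
  | cons i l ih => exact (step_of_coef_eq_zero hm (v i) h y).trans ih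

lemma RateBound.block {D : S → S → ℝ} {B : ℝ} (hm : 0 < m) (b : Bool) (v : ι → S → ℝ)
    (l : List ι)
    (h : F.RateBound (fun σ τ => D σ τ + coefSign b * (l.map fun i => v i σ * v i τ).sum) m B) :
    (F.block m hm b v l).RateBound D m B := by
  induction l generalizing D with
  | nil => simpa [Pressure.block] using h
  | cons i l ih =>
    refine RateBound.step hm b (v i) (ih ?_)
    simpa only [List.map_cons, List.sum_cons, mul_add, add_assoc] using h

lemma RateBound.block_univ [Fintype ι] {D : S → S → ℝ} {B : ℝ} (hm : 0 < m) (b : Bool)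
    (v : ι → S → ℝ)
    (h : F.RateBound (fun σ τ => D σ τ + coefSign b * ∑ i, v i σ * v i τ) m B) :
    (F.block m hm b v Finset.univ.toList).RateBound D m B :=
  RateBound.block hm b v _ (by simpa only [Finset.sum_map_toList] using h)

/-- Where the couplings are fully switched on, the iterated one-dimensional averages are an average
over the product Gaussian measure. -/
lemma exp_mul_block_univ [Fintype ι] (hm : 0 < m) {b : Bool} (v : ι → S → ℝ)
    (h : coef b θ = 1) (y : S → ℝ) :
    Real.exp (m * (F.block m hm b v Finset.univ.toList).Φ θ y) =
      ∫ J : ι → ℝ, Real.exp (m * F.Φ θ (y + ∑ i, J i • v i))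
        ∂(Measure.pi fun _ => gaussianReal 0 1) := by
  classical
  have hFc := F.continuous_right θ
  set f : (ι → ℝ) → ENNReal := fun J =>
    ENNReal.ofReal (Real.exp (m * F.Φ θ (y + ∑ i, J i • v i))) with hf
  have hcont : Continuous fun J : ι → ℝ => Real.exp (m * F.Φ θ (y + ∑ i, J i • v i)) := by
    fun_prop
  have hfm : Measurable f := hcont.measurable.ennreal_ofReal
  have key : ∀ l : List ι, l.Nodup → ∀ J : ι → ℝ,
      (∫⋯∫⁻_l.toFinset, f ∂fun _ => gaussianReal 0 1) J = ENNReal.ofReal (Real.exp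
        (m * (F.block m hm b v l).Φ θ (y + ∑ i ∈ (l.toFinset)ᶜ, J i • v i))) := by
    intro l hl
    induction l with
    | nil =>
      intro J
      simp [hf, block]
    | cons i l ih =>
      intro J
      have hil : i ∉ l.toFinset := by simpa using (List.nodup_cons.1 hl).1
      rw [List.toFinset_cons, lmarginal_insert f hfm hil]
      simp only [ih (List.nodup_cons.1 hl).2]
      have hsum : ∀ z, ∑ j ∈ (l.toFinset)ᶜ, Function.update J i z j • v j
          = z • v i + ∑ j ∈ (insert i l.toFinset)ᶜ, J j • v j := by
        intro z
        rw [Finset.compl_insert, ← Finset.add_sum_erase _ _ (Finset.mem_compl.2 hil),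
          Function.update_self]
        congr 1
        refine Finset.sum_congr rfl fun j hj => ?_
        rw [Function.update_of_ne (Finset.ne_of_mem_erase hj)]
      set y' := y + ∑ j ∈ (insert i l.toFinset)ᶜ, J j • v j with hy'
      have e1 : ∀ z, y + ∑ j ∈ (l.toFinset)ᶜ, Function.update J i z j • v j
          = y' + z • (coef b θ • v i) := by
        intro z
        rw [hsum, h, one_smul, hy']
        abel
      simp only [e1]
      have h3 : (F.block m hm b v (i :: l)) = (F.block m hm b v l).step m hm b (v i) := rfl
      rw [h3, exp_mul_step, ofReal_integral_eq_lintegral_ofReal]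
      · have := integrable_avg (F := F.block m hm b v l) (θ := θ) (w := coef b θ • v i) hm.le
          (BddCont.const 1) y'
        simpa [weight] using this
      · exact Eventually.of_forall fun z => (Real.exp_pos _).le
  have h0 := key Finset.univ.toList (Finset.nodup_toList _) 0
  rw [Finset.toList_toFinset, ← lintegral_eq_lmarginal_univ] at h0
  rw [integral_eq_lintegral_of_nonneg_ae (Eventually.of_forall fun J => (Real.exp_pos _).le)
    hcont.aestronglyMeasurable]
  change _ = (∫⁻ J, f J ∂_).toReal
  rw [h0]
  simp [Real.exp_nonneg]

end Pressure

/-! ### The Sherrington-Kirkpatrick energies -/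

lemma spin_mul_self (s : ℤˣ) : spin s * spin s = 1 := by
  unfold spin
  rcases Int.units_eq_one_or s with rfl | rfl <;> norm_num

/-- The energy `β N^{-1/2} σ_i σ_j` multiplying the coupling of a pair of sites, for spins `s σ i`
read off from a configuration `σ` of a possibly larger system. -/
def pairEnergy {S : Type*} {N : ℕ} (β : ℝ) (s : S → Fin N → ℤˣ) (p : Pair N) (σ : S) : ℝ :=
  β * (1 / √N) * (spin (s σ p.1.1) * spin (s σ p.1.2))

/-- The energy `β ∑ y_i σ_i` of independent spins in fields `y_i`. -/
def fieldEnergy {S : Type*} {N : ℕ} (β : ℝ) (s : S → Fin N → ℤˣ) (y : Fin N → ℝ) (σ : S) : ℝ :=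
  ∑ i, β * y i * spin (s σ i)

lemma neg_mul_hamiltonian {N : ℕ} (β h : ℝ) (J : Pair N → ℝ) :
    (fun σ => -β * hamiltonian N h J σ)
      = fieldEnergy β (fun σ => σ) (fun _ => h) + ∑ p, J p • pairEnergy β (fun σ => σ) p := by
  ext σ
  simp only [hamiltonian, fieldEnergy, pairEnergy, Pi.add_apply, Finset.sum_apply, Pi.smul_apply,
    smul_eq_mul]
  have e1 : ∑ p : Pair N, J p * (β * (1 / √N) * (spin (σ p.1.1) * spin (σ p.1.2)))
      = β * (1 / √N) * ∑ p : Pair N, J p * spin (σ p.1.1) * spin (σ p.1.2) := by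
    rw [Finset.mul_sum]
    exact Finset.sum_congr rfl fun p _ => by ring
  have e2 : ∑ i, β * h * spin (σ i) = β * h * ∑ i, spin (σ i) := by rw [Finset.mul_sum]
  rw [e1, e2]
  ring

lemma partitionFunction_eq {N : ℕ} (β h : ℝ) (J : Pair N → ℝ) :
    partitionFunction N β h J = ∑ σ : Fin N → ℤˣ, Real.exp
      ((fieldEnergy β (fun σ : Fin N → ℤˣ => σ) (fun _ => h)
        + ∑ p, J p • pairEnergy β (fun σ : Fin N → ℤˣ => σ) p : (Fin N → ℤˣ) → ℝ) σ) := by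
  rw [← neg_mul_hamiltonian]
  rfl

lemma partitionFunction_pos {N : ℕ} (β h : ℝ) (J : Pair N → ℝ) : 0 < partitionFunction N β h J :=
  Finset.sum_pos (fun _ _ => Real.exp_pos _) Finset.univ_nonempty

lemma rpow_partitionFunction {N : ℕ} (n β h : ℝ) (J : Pair N → ℝ) :
    partitionFunction N β h J ^ n
      = Real.exp (n * Real.log (partitionFunction N β h J)) := by
  rw [Real.rpow_def_of_pos (partitionFunction_pos β h J), mul_comm]

lemma sum_pair {N : ℕ} (a : Fin N → ℝ) :
    ∑ p : Pair N, a p.1.1 * a p.1.2 = ((∑ i, a i) ^ 2 - ∑ i, a i ^ 2) / 2 := by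
  have h1 : ∑ p : Pair N, a p.1.1 * a p.1.2
      = ∑ i, ∑ j, if i < j then a i * a j else 0 := by
    rw [← Fintype.sum_prod_type', ← Finset.sum_filter]
    exact (Finset.sum_subtype (p := fun p : Fin N × Fin N => p.1 < p.2) _ (by simp)
      (fun p => a p.1 * a p.2)).symm
  have h2 : ∑ i, ∑ j, (if j < i then a i * a j else 0)
      = ∑ i, ∑ j, if i < j then a i * a j else 0 := by
    rw [Finset.sum_comm]
    exact Finset.sum_congr rfl fun i _ => Finset.sum_congr rfl fun j _ => by rw [mul_comm]
  have h3 : (∑ i, a i) ^ 2 = (∑ i, ∑ j, if i < j then a i * a j else 0)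
      + (∑ i, ∑ j, if j < i then a i * a j else 0) + ∑ i, a i ^ 2 := by
    rw [sq, Finset.sum_mul_sum]
    have h4 : ∀ i, a i ^ 2 = ∑ j, if i = j then a i * a j else 0 := by
      intro i; simp [sq]
    simp only [h4, ← Finset.sum_add_distrib]
    refine Finset.sum_congr rfl fun i _ => Finset.sum_congr rfl fun j _ => ?_
    rcases lt_trichotomy i j with h | h | h
    · simp [h, h.not_gt, h.ne]
    · simp [h]
    · simp [h, h.not_gt, h.ne']
  rw [h1]
  linarith

/-- The covariance of the Sherrington-Kirkpatrick energies. -/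
lemma sum_pairEnergy_mul {S : Type*} {N : ℕ} (hN : N ≠ 0) (β : ℝ) (s : S → Fin N → ℤˣ)
    (σ τ : S) :
    ∑ p, pairEnergy β s p σ * pairEnergy β s p τ
      = β ^ 2 * ((∑ i, spin (s σ i) * spin (s τ i)) ^ 2 / (2 * N) - 1 / 2) := by
  have h1 := sum_pair fun i => spin (s σ i) * spin (s τ i)
  have h2 : ∑ i, (spin (s σ i) * spin (s τ i)) ^ 2 = (N : ℝ) := by
    have : ∀ i, (spin (s σ i) * spin (s τ i)) ^ 2 = 1 := fun i => by
      rw [mul_pow, sq, sq, spin_mul_self, spin_mul_self, mul_one]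
    simp [this]
  have h3 : ∑ p, pairEnergy β s p σ * pairEnergy β s p τ = β ^ 2 * (1 / N) *
      ∑ p : Pair N, spin (s σ p.1.1) * spin (s τ p.1.1)
        * (spin (s σ p.1.2) * spin (s τ p.1.2)) := by
    rw [Finset.mul_sum]
    refine Finset.sum_congr rfl fun p _ => ?_
    have h4 : (1 / √(N : ℝ)) * (1 / √(N : ℝ)) = 1 / N := by
      rw [div_mul_div_comm, Real.mul_self_sqrt (by positivity), one_mul]
    rw [← h4, pairEnergy, pairEnergy]
    ring
  rw [h3, h1, h2]
  have : (N : ℝ) ≠ 0 := by exact_mod_cast hN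
  field_simp

/-- A moment of the partition function as an average of a pressure. -/
lemma exp_mul_block_gibbs {N : ℕ} {n : ℝ} (hn : 0 < n) {b : Bool} {θ : ℝ} (hb : coef b θ = 1)
    {F : Pressure (Fin N → ℤˣ)}
    (hF : ∀ y, F.Φ θ y = Real.log (∑ σ, Real.exp (y σ))) (β h : ℝ) :
    Real.exp (n * (F.block n hn b (pairEnergy β fun σ => σ) Finset.univ.toList).Φ θ
      (fieldEnergy β (fun σ => σ) fun _ => h))
      = ∫ J, partitionFunction N β h J ^ n ∂(disorder N) := by
  rw [Pressure.exp_mul_block_univ hn _ hb]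
  refine integral_congr_ae (Eventually.of_forall fun J => ?_)
  simp only [hF]
  rw [rpow_partitionFunction, partitionFunction_eq]

/-! ### Superadditivity of the moments -/

/-- The moment `E[Z_N ^ n]`. -/
def moment (N : ℕ) (n β h : ℝ) : ℝ := ∫ J, partitionFunction N β h J ^ n ∂(disorder N)

lemma moment_pos (N : ℕ) {n : ℝ} (hn : 0 < n) (β h : ℝ) : 0 < moment N n β h := by
  rw [moment, ← exp_mul_block_gibbs (b := true) (θ := Real.pi / 2)
    (F := Pressure.gibbs (Fin N → ℤˣ)) hn (by simp [coef]) (fun _ => rfl)]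
  exact Real.exp_pos _

/-- The overlap `∑ σ_i τ_i` of two configurations, not divided by the number of sites. -/
def overlap {N : ℕ} (σ τ : Fin N → ℤˣ) : ℝ := ∑ i, spin (σ i) * spin (τ i)

lemma overlap_self {N : ℕ} (σ : Fin N → ℤˣ) : overlap σ σ = N := by
  simp [overlap, spin_mul_self]

lemma sum_exp_append {N₁ N₂ : ℕ} (f : (Fin N₁ → ℤˣ) → ℝ) (g : (Fin N₂ → ℤˣ) → ℝ) :
    ∑ σ : Fin (N₁ + N₂) → ℤˣ, Real.exp (f (fun i => σ (Fin.castAdd N₂ i))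
      + g fun i => σ (Fin.natAdd N₁ i))
      = (∑ σ, Real.exp (f σ)) * ∑ σ, Real.exp (g σ) := by
  rw [← (Fin.appendEquiv N₁ N₂).sum_comp, Fintype.sum_prod_type, Finset.sum_mul_sum]
  refine Finset.sum_congr rfl fun σ _ => Finset.sum_congr rfl fun τ _ => ?_
  rw [← Real.exp_add]
  simp [Fin.appendEquiv]

/-- Splitting a system into two independent parts lowers its moments of order `n ≤ 1`. The couplings
of the whole system are switched off while those of the parts are switched on. -/
lemma moment_mul_le {N₁ N₂ : ℕ} (h₁ : N₁ ≠ 0) (h₂ : N₂ ≠ 0) {n : ℝ} (hn : n ∈ Ioc (0 : ℝ) 1)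
    (β h : ℝ) : moment N₁ n β h * moment N₂ n β h ≤ moment (N₁ + N₂) n β h := by
  set s₁ : (Fin (N₁ + N₂) → ℤˣ) → Fin N₁ → ℤˣ := fun σ i => σ (Fin.castAdd N₂ i) with hs₁
  set s₂ : (Fin (N₁ + N₂) → ℤˣ) → Fin N₂ → ℤˣ := fun σ i => σ (Fin.natAdd N₁ i) with hs₂
  set s : (Fin (N₁ + N₂) → ℤˣ) → Fin (N₁ + N₂) → ℤˣ := fun σ => σ with hs
  set F₂ := (Pressure.gibbs (Fin (N₁ + N₂) → ℤˣ)).block n hn.1 true (pairEnergy β s₂)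
    Finset.univ.toList with hF₂
  set F₁ := F₂.block n hn.1 true (pairEnergy β s₁) Finset.univ.toList with hF₁
  set F := F₁.block n hn.1 false (pairEnergy β s) Finset.univ.toList with hF
  have p₁ : (0 : ℝ) < N₁ := by positivity
  have p₂ : (0 : ℝ) < N₂ := by positivity
  have hcast : ((N₁ + N₂ : ℕ) : ℝ) = N₁ + N₂ := by push_cast; rfl
  have hN : N₁ + N₂ ≠ 0 := by omega
  have hD : ∀ σ τ : Fin (N₁ + N₂) → ℤˣ,
      0 + coefSign false * ∑ p, pairEnergy β s p σ * pairEnergy β s p τ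
        + coefSign true * ∑ p, pairEnergy β s₁ p σ * pairEnergy β s₁ p τ
        + coefSign true * ∑ p, pairEnergy β s₂ p σ * pairEnergy β s₂ p τ
      = β ^ 2 / 2 * (overlap (s₁ σ) (s₁ τ) ^ 2 / N₁ + overlap (s₂ σ) (s₂ τ) ^ 2 / N₂
        - (overlap (s₁ σ) (s₁ τ) + overlap (s₂ σ) (s₂ τ)) ^ 2 / (N₁ + N₂)) - β ^ 2 / 2 := by
    intro σ τ
    have e : ∑ i, spin (s σ i) * spin (s τ i)
        = overlap (s₁ σ) (s₁ τ) + overlap (s₂ σ) (s₂ τ) := by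
      simp only [overlap, Fin.sum_univ_add, hs, hs₁, hs₂]
    rw [sum_pairEnergy_mul hN, sum_pairEnergy_mul h₁, sum_pairEnergy_mul h₂, e, hcast]
    simp only [coefSign, overlap, if_true, Bool.false_eq_true, if_false]
    field_simp
    ring
  -- the rate is `-β² / 2` on the diagonal and at least that elsewhere
  have hrate : F.RateBound (fun _ _ => 0) n (-(β ^ 2 / 2) - (1 - n) * (-(β ^ 2 / 2))) := by
    refine Pressure.RateBound.block_univ _ _ _ (Pressure.RateBound.block_univ _ _ _
      (Pressure.RateBound.block_univ _ _ _ (Pressure.gibbs_rateBound hn.2 (fun σ => ?_)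
        fun σ τ => ?_)))
    · rw [hD, overlap_self, overlap_self]
      refine le_of_eq ?_
      field_simp
      ring
    · rw [hD]
      -- convexity of the square
      have : (overlap (s₁ σ) (s₁ τ) + overlap (s₂ σ) (s₂ τ)) ^ 2 / ((N₁ : ℝ) + N₂)
          ≤ overlap (s₁ σ) (s₁ τ) ^ 2 / N₁ + overlap (s₂ σ) (s₂ τ) ^ 2 / N₂ := by
        have e : ∀ a b : ℝ, a ^ 2 / N₁ + b ^ 2 / N₂ - (a + b) ^ 2 / ((N₁ : ℝ) + N₂)
            = (N₂ * a - N₁ * b) ^ 2 / (N₁ * N₂ * (N₁ + N₂)) := fun a b => by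
          field_simp
          ring
        rw [← sub_nonneg, e]
        positivity
      have h0 : 0 ≤ β ^ 2 / 2 := by positivity
      nlinarith
  have hle := hrate.le (fieldEnergy β s fun _ => h)
  have hle' : F.Φ (Real.pi / 2) (fieldEnergy β s fun _ => h)
      ≤ F.Φ 0 (fieldEnergy β s fun _ => h) := by
    have : 0 ≤ n * β ^ 2 := mul_nonneg hn.1.le (sq_nonneg _)
    linarith
  have hexp := Real.exp_le_exp.2 (mul_le_mul_of_nonneg_left hle' hn.1.le)
  have e0 : Real.exp (n * F.Φ 0 (fieldEnergy β s fun _ => h)) = moment (N₁ + N₂) n β h := by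
    refine exp_mul_block_gibbs hn.1 (by simp [coef]) (fun y => ?_) β h
    rw [hF₁, Pressure.block_of_coef_eq_zero _ _ _ (by simp [coef]), hF₂,
      Pressure.block_of_coef_eq_zero _ _ _ (by simp [coef])]
    rfl
  have e1 : Real.exp (n * F.Φ (Real.pi / 2) (fieldEnergy β s fun _ => h))
      = moment N₁ n β h * moment N₂ n β h := by
    rw [hF, Pressure.block_of_coef_eq_zero _ _ _ (by simp [coef]), hF₁,
      Pressure.exp_mul_block_univ _ _ (by simp [coef])]
    simp only [hF₂, Pressure.exp_mul_block_univ hn.1 (pairEnergy β s₂)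
      (show coef true (Real.pi / 2) = 1 by simp [coef])]
    rw [moment, moment, disorder, disorder, ← integral_mul_const]
    refine integral_congr_ae (Eventually.of_forall fun J₁ => ?_)
    dsimp only
    rw [← integral_const_mul]
    refine integral_congr_ae (Eventually.of_forall fun J₂ => ?_)
    dsimp only
    rw [rpow_partitionFunction, rpow_partitionFunction, ← Real.exp_add, ← mul_add,
      ← Real.log_mul (partitionFunction_pos β h J₁).ne' (partitionFunction_pos β h J₂).ne',
      partitionFunction_eq, partitionFunction_eq, ← sum_exp_append]
    congr 2
    change Real.log _ = _
    congr 1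
    refine Finset.sum_congr rfl fun σ _ => ?_
    congr 1
    simp only [Pi.add_apply, Finset.sum_apply, Pi.smul_apply, fieldEnergy, Fin.sum_univ_add,
      pairEnergy, hs, hs₁, hs₂]
    ring
  rwa [e0, e1] at hexp

/-! ### Replica symmetry breaking bound -/

/-- The energy `β c σ_i` of a field of strength `c` at the site `i`. -/
def siteEnergy {N : ℕ} (β c : ℝ) (i : Fin N) (σ : Fin N → ℤˣ) : ℝ := β * c * spin (σ i)

lemma sum_siteEnergy_mul {N : ℕ} (β c : ℝ) (σ τ : Fin N → ℤˣ) :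
    ∑ i, siteEnergy β c i σ * siteEnergy β c i τ = β ^ 2 * c ^ 2 * overlap σ τ := by
  rw [overlap, Finset.mul_sum]
  refine Finset.sum_congr rfl fun i _ => ?_
  rw [siteEnergy, siteEnergy]
  ring

lemma fieldEnergy_add_siteEnergy {N : ℕ} (β c : ℝ) (y J : Fin N → ℝ) :
    fieldEnergy β (fun σ : Fin N → ℤˣ => σ) y + ∑ i, J i • siteEnergy β c i
      = fieldEnergy β (fun σ : Fin N → ℤˣ => σ) fun i => y i + J i * c := by
  ext σ
  simp only [fieldEnergy, siteEnergy, Pi.add_apply, Finset.sum_apply, Pi.smul_apply, smul_eq_mul,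
    ← Finset.sum_add_distrib]
  exact Finset.sum_congr rfl fun i _ => by ring

lemma sum_exp_fieldEnergy {N : ℕ} (β : ℝ) (y : Fin N → ℝ) :
    ∑ σ : Fin N → ℤˣ, Real.exp (fieldEnergy β (fun σ => σ) y σ)
      = ∏ i, (2 * Real.cosh (β * y i)) := by
  have h : ∀ t : ℝ, ∑ s : ℤˣ, Real.exp (t * spin s) = 2 * Real.cosh t := by
    intro t
    have : (Finset.univ : Finset ℤˣ) = {1, -1} := by decide
    rw [this, Finset.sum_pair (by decide), Real.cosh_eq]
    simp [spin]
    ring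
  simp only [← h, fieldEnergy, Real.exp_sum]
  rw [Finset.prod_univ_sum, Fintype.piFinset_univ]

lemma log_sum_exp_fieldEnergy {N : ℕ} (β : ℝ) (y : Fin N → ℝ) :
    Real.log (∑ σ : Fin N → ℤˣ, Real.exp (fieldEnergy β (fun σ => σ) y σ))
      = N * Real.log 2 + ∑ i, Real.log (Real.cosh (β * y i)) := by
  have hc : ∀ i, Real.cosh (β * y i) ≠ 0 := fun i => (Real.cosh_pos _).ne'
  rw [sum_exp_fieldEnergy, Real.log_prod fun i _ => mul_ne_zero two_ne_zero (hc i)]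
  simp only [Real.log_mul two_ne_zero (hc _), Finset.sum_add_distrib, Finset.sum_const,
    Finset.card_univ, Fintype.card_fin, nsmul_eq_mul]

lemma exp_mul_parisiStep {m d L M : ℝ} (hm : 0 < m) {g : ℝ → ℝ} (hg : HasC2Bounds L M g) (y : ℝ) :
    Real.exp (m * parisiStep m d g y)
      = ∫ z, Real.exp (m * g (y + z * √d)) ∂(gaussianReal 0 1) := by
  rw [parisiStep, if_neg hm.ne', ← mul_assoc, mul_one_div_cancel hm.ne', one_mul,
    Real.exp_log (hg.integral_exp_pos hm.le y _)]

/-- Averaging over independent Gaussian fields acts on a decoupled pressure by the Parisi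
recursion at each site. -/
lemma block_siteEnergy {N : ℕ} {β m A L M : ℝ} (hm : 0 < m) {F : Pressure (Fin N → ℤˣ)}
    {g : ℝ → ℝ} (hg : HasC2Bounds L M g) {θ : ℝ} {b : Bool} (hb : coef b θ = 1)
    (hF : ∀ y, F.Φ θ (fieldEnergy β (fun σ => σ) y) = A + ∑ i, g (y i)) (d : ℝ) (y : Fin N → ℝ) :
    (F.block m hm b (siteEnergy β √d) Finset.univ.toList).Φ θ (fieldEnergy β (fun σ => σ) y)
      = A + ∑ i, parisiStep m d g (y i) := by
  refine mul_left_cancel₀ hm.ne' (Real.exp_injective ?_)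
  rw [Pressure.exp_mul_block_univ hm _ hb]
  simp only [fieldEnergy_add_siteEnergy, hF, mul_add m, Finset.mul_sum, Real.exp_add, Real.exp_sum]
  rw [integral_const_mul,
    integral_fintype_prod_eq_prod (f := fun i z => Real.exp (m * g (y i + z * √d)))]
  simp only [exp_mul_parisiStep hm hg]

/-- The regularity of the Parisi solution. -/
lemma parisiSolution_hasC2Bounds (β : ℝ) {x : ℝ → ℝ} (hx : x ∈ chi 0) {q : ℝ}
    (hq : q ∈ Icc (0 : ℝ) 1) : ∃ M, HasC2Bounds |β| M (parisiSolution β x q) := by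
  obtain ⟨f, hf⟩ := exists_isParisiFlow β hx
  have h : parisiSolution β x q = f q := funext fun y =>
    (parisiSolution_spec β hx).unique hx (hf.isParisiSolution hx) hq y
  rw [h]
  exact hf.bounds q hq

/-- Half the rate, in units of `sin θ cos θ`, at which the covariance outside of the level `q` of
the interpolating pressure grows: the covariance of the coupling energies, less that of fields of
variance `q` at each site. -/
def guerraRate {N : ℕ} (β q : ℝ) (σ τ : Fin N → ℤˣ) : ℝ :=
  β ^ 2 * (overlap σ τ ^ 2 / (2 * N) - 1 / 2 - q * overlap σ τ)

/-- Completing the square. -/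
lemma le_guerraRate {N : ℕ} (hN : N ≠ 0) (β q : ℝ) (σ τ : Fin N → ℤˣ) :
    -(β ^ 2 * (1 + N * q ^ 2) / 2) ≤ guerraRate β q σ τ := by
  have p : (0 : ℝ) < N := by positivity
  have h : guerraRate β q σ τ - -(β ^ 2 * (1 + N * q ^ 2) / 2)
      = β ^ 2 / (2 * N) * (overlap σ τ - N * q) ^ 2 := by
    rw [guerraRate]
    field_simp
    ring
  have : 0 ≤ β ^ 2 / (2 * N) * (overlap σ τ - N * q) ^ 2 := by positivity
  linarith

lemma intervalIntegrable_mul_chi {n : ℝ} {x : ℝ → ℝ} (hn : 0 ≤ n) (hx : x ∈ chi n) {a b : ℝ}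
    (ha : a ∈ Icc (0 : ℝ) 1) (hb : b ∈ Icc (0 : ℝ) 1) :
    IntervalIntegrable (fun s => s * x s) volume a b :=
  (chi_intervalIntegrable hn hx ha hb).continuousOn_mul continuousOn_id

lemma integral_mul_of_eqOn {x : ℝ → ℝ} {a b m : ℝ} (hab : a ≤ b) (h : ∀ s ∈ Ioc a b, x s = m) :
    ∫ s in a..b, s * x s = m * (b ^ 2 - a ^ 2) / 2 := by
  have : ∫ s in a..b, s * x s = ∫ s in a..b, s * m := by
    rw [intervalIntegral.integral_of_le hab, intervalIntegral.integral_of_le hab]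
    exact setIntegral_congr_fun measurableSet_Ioc fun s hs => by simp only [h s hs]
  rw [this, intervalIntegral.integral_mul_const, integral_id]
  ring

/-- Guerra's interpolating pressure at the level `q i`: it decouples at `θ = 0` into the Parisi
recursion at each site, and the field energies are switched off at `θ = π / 2`. The rate bound holds
for every exponent `μ` of the next average that is at most the exponents of the levels inside. -/
lemma exists_guerra_pressure {N : ℕ} (hN : N ≠ 0) (β : ℝ) {n : ℝ} (hn : 0 < n) {x : ℝ → ℝ}
    (hxn : x ∈ chi n) {K : ℕ} {q : Fin (K + 1) → ℝ} {m : Fin K → ℝ} (hq : Monotone q)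
    (h0 : q 0 = 0) (h1 : q (Fin.last K) = 1) (hmm : Monotone m) (hm : ∀ a, m a ∈ Icc n 1)
    (hx : ∀ a : Fin K, ∀ s ∈ Ioc (q a.castSucc) (q a.succ), x s = m a) (i : Fin (K + 1)) :
    ∃ F : Pressure (Fin N → ℤˣ),
      (∀ y, F.Φ 0 (fieldEnergy β (fun σ => σ) y)
        = N * Real.log 2 + ∑ j, parisiSolution β x (q i) (y j)) ∧
      (∀ y, F.Φ (Real.pi / 2) y = Real.log (∑ σ, Real.exp (y σ))) ∧
      ∀ μ ≤ 1, (∀ b : Fin K, i ≤ b.castSucc → μ ≤ m b) →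
        F.RateBound (guerraRate β (q i)) μ
          (-β ^ 2 * (μ * (1 + N * q i ^ 2) / 2 + N * ∫ s in q i..1, s * x s)) := by
  have hx0 : x ∈ chi 0 := chi_mono hn.le hxn
  have hqm : ∀ i, q i ∈ Icc (0 : ℝ) 1 := fun i =>
    ⟨h0 ▸ hq (Fin.zero_le i), h1 ▸ hq (Fin.le_last i)⟩
  have p : (0 : ℝ) < N := by positivity
  induction i using Fin.reverseInduction with
  | last =>
    refine ⟨Pressure.gibbs _, fun y => ?_, fun y => rfl, fun μ hμ _ => ?_⟩
    · rw [h1]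
      simp only [(parisiSolution_spec β hx0).final]
      exact log_sum_exp_fieldEnergy β y
    · rw [h1]
      refine (Pressure.gibbs_rateBound (d := β ^ 2 * (-N / 2 - 1 / 2)) hμ (fun σ => ?_)
        (le_guerraRate hN β 1)).mono ?_
      · rw [guerraRate, overlap_self]
        refine le_of_eq ?_
        field_simp
        ring
      · rw [intervalIntegral.integral_same]
        refine le_of_eq ?_
        ring
  | cast i ih =>
    obtain ⟨F, hF0, hF1, hFr⟩ := ih
    have hmi : 0 < m i := hn.trans_le (hm i).1
    have hle : q i.castSucc ≤ q i.succ := hq (Fin.castSucc_le_succ i)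
    refine ⟨F.block (m i) hmi false (siteEnergy β √(q i.succ - q i.castSucc)) Finset.univ.toList,
      fun y => ?_, fun y => ?_, fun μ hμ hμm => ?_⟩
    · obtain ⟨M, hM⟩ := parisiSolution_hasC2Bounds β hx0 (hqm i.succ)
      rw [block_siteEnergy hmi hM (by simp [coef]) hF0,
        parisiSolution_step β hx0 (hqm i.castSucc).1 hle (hqm i.succ).2
          ⟨hmi.le, (hm i).2⟩ (hx i)]
    · rw [Pressure.block_of_coef_eq_zero _ _ _ (by simp [coef]), hF1]
    · have hr := hFr (m i) (hm i).2 fun b hb => hmm (by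
        rw [Fin.le_def] at hb ⊢
        simp only [Fin.val_succ, Fin.val_castSucc] at hb
        omega)
      have hD : guerraRate β (q i.succ) = fun σ τ : Fin N → ℤˣ =>
          guerraRate β (q i.castSucc) σ τ
          + coefSign false * ∑ j, siteEnergy β √(q i.succ - q i.castSucc) j σ
            * siteEnergy β √(q i.succ - q i.castSucc) j τ := by
        ext σ τ
        rw [sum_siteEnergy_mul, Real.sq_sqrt (sub_nonneg.2 hle), guerraRate, guerraRate]
        simp only [coefSign, Bool.false_eq_true, if_false]
        ring
      rw [hD] at hr
      have hr' := Pressure.RateBound.block_univ hmi false _ hr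
      refine (hr'.weaken (hμm i le_rfl) (le_guerraRate hN β _)).mono (le_of_eq ?_)
      have hint : ∫ s in q i.castSucc..1, s * x s
          = m i * (q i.succ ^ 2 - q i.castSucc ^ 2) / 2 + ∫ s in q i.succ..1, s * x s := by
        rw [← integral_mul_of_eqOn hle (hx i), intervalIntegral.integral_add_adjacent_intervals]
        · exact intervalIntegrable_mul_chi hn.le hxn (hqm _) (hqm _)
        · exact intervalIntegrable_mul_chi hn.le hxn (hqm _) ⟨zero_le_one, le_rfl⟩
      rw [hint]
      ring

/-- Guerra's bound in finite volume. -/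
lemma phiN_le_alphaP {N : ℕ} (hN : N ≠ 0) (β h : ℝ) {n : ℝ} (hn : n ∈ Ioc (0 : ℝ) 1) {x : ℝ → ℝ}
    (hxn : x ∈ chi n) : phiN N n β h ≤ alphaP n β h x := by
  obtain ⟨K, q, m, hq, h0, h1, hmm, hm, hx⟩ := id hxn
  obtain ⟨F, hF0, hF1, hFr⟩ := exists_guerra_pressure hN β hn.1 hxn hq h0 h1 hmm hm hx 0
  have p : (0 : ℝ) < N := by positivity
  set G := F.block n hn.1 true (pairEnergy β fun σ => σ) Finset.univ.toList with hG
  have hr : G.RateBound (fun _ _ => 0) n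
      (-β ^ 2 * (n * (1 + N * q 0 ^ 2) / 2 + N * ∫ s in q 0..1, s * x s)) := by
    refine Pressure.RateBound.block_univ hn.1 true _ ?_
    convert hFr n hn.2 (fun b _ => (hm b).1) using 3 with σ τ
    rw [sum_pairEnergy_mul hN, guerraRate, h0, overlap]
    simp [coefSign]
  have hle := hr.le (fieldEnergy β (fun σ => σ) fun _ => h)
  have e1 : n * G.Φ (Real.pi / 2) (fieldEnergy β (fun σ => σ) fun _ => h)
      = Real.log (moment N n β h) := by
    rw [moment, ← exp_mul_block_gibbs (b := true) hn.1 (by simp [coef]) hF1, Real.log_exp]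
  have e0 : G.Φ 0 (fieldEnergy β (fun σ => σ) fun _ => h)
      = N * Real.log 2 + N * parisiSolution β x 0 h := by
    rw [hG, Pressure.block_of_coef_eq_zero _ _ _ (by simp [coef]), hF0, h0]
    simp
  have e2 : phiN N n β h = 1 / N * G.Φ (Real.pi / 2) (fieldEnergy β (fun σ => σ) fun _ => h) := by
    have := hn.1.ne'
    change 1 / (N * n) * Real.log (moment N n β h) = _
    rw [← e1]
    field_simp
  rw [h0, e0] at hle
  have h2 := mul_le_mul_of_nonneg_left hle (by positivity : (0 : ℝ) ≤ 1 / N)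
  rw [e2, alphaP]
  refine h2.trans ?_
  have e3 : 1 / (N : ℝ) * (N * Real.log 2 + N * parisiSolution β x 0 h +
      -β ^ 2 * (n * (1 + N * (0 : ℝ) ^ 2) / 2 + N * ∫ s in (0 : ℝ)..1, s * x s) / 2)
      = Real.log 2 + parisiSolution β x 0 h - β ^ 2 / 2 * (∫ s in (0 : ℝ)..1, s * x s)
        - n * β ^ 2 / (4 * N) := by
    field_simp
    ring
  rw [e3]
  have h3 : 0 ≤ n * β ^ 2 / (4 * N) := div_nonneg (mul_nonneg hn.1.le (sq_nonneg _)) (by positivity)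
  have h4 : 0 ≤ n * β ^ 2 / 4 := div_nonneg (mul_nonneg hn.1.le (sq_nonneg _)) (by norm_num)
  linarith

/-! ### The thermodynamic limit and the limit of zero replicas -/

instance (N : ℕ) : IsProbabilityMeasure (disorder N) := by
  unfold disorder
  infer_instance

lemma moment_zero_left (n β h : ℝ) : moment 0 n β h = 1 := by
  have : ∀ J, partitionFunction 0 β h J = 1 := fun J => by
    simp [partitionFunction, hamiltonian]
  simp [moment, this]

lemma subadditive_log_moment {n : ℝ} (hn : n ∈ Ioc (0 : ℝ) 1) (β h : ℝ) :
    Subadditive fun N => -(1 / n * Real.log (moment N n β h)) := by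
  intro N₁ N₂
  rcases eq_or_ne N₁ 0 with rfl | h₁
  · simp [moment_zero_left]
  rcases eq_or_ne N₂ 0 with rfl | h₂
  · simp [moment_zero_left]
  have h3 := Real.log_le_log (mul_pos (moment_pos N₁ hn.1 β h) (moment_pos N₂ hn.1 β h))
    (moment_mul_le h₁ h₂ hn β h)
  rw [Real.log_mul (moment_pos N₁ hn.1 β h).ne' (moment_pos N₂ hn.1 β h).ne'] at h3
  have h4 := mul_le_mul_of_nonneg_left h3 (one_div_nonneg.2 hn.1.le)
  dsimp only
  linarith

lemma neg_log_moment_div (N : ℕ) (n β h : ℝ) :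
    -(1 / n * Real.log (moment N n β h)) / N = -phiN N n β h := by
  rw [phiN, ← moment, one_div_mul_eq_div, one_div_mul_eq_div, neg_div, div_div, mul_comm n]

/-- The thermodynamic limit exists by Fekete's lemma, and lies above the finite-volume values. -/
lemma exists_tendsto_phiN {n : ℝ} (hn : n ∈ Ioc (0 : ℝ) 1) (β h : ℝ) :
    ∃ l, Tendsto (fun N : ℕ => phiN N n β h) atTop (𝓝 l) ∧ ∀ N ≠ 0, phiN N n β h ≤ l := by
  have hsub := subadditive_log_moment hn β h
  have hbdd : BddBelow (range fun N : ℕ => -(1 / n * Real.log (moment N n β h)) / N) := by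
    refine ⟨min 0 (-alphaP n β h fun _ => 1), ?_⟩
    rintro _ ⟨N, rfl⟩
    rcases eq_or_ne N 0 with rfl | hN
    · simp
    · dsimp only
      rw [neg_log_moment_div]
      exact (min_le_right _ _).trans (neg_le_neg (phiN_le_alphaP hN β h hn (one_mem_chi hn.2)))
  refine ⟨-hsub.lim, ?_, fun N hN => ?_⟩
  · have := (hsub.tendsto_lim hbdd).neg
    simpa only [neg_log_moment_div, neg_neg] using this
  · have := hsub.lim_le_div hbdd hN
    rw [neg_log_moment_div] at this
    linarith

lemma integrable_rpow_partitionFunction (N : ℕ) {n : ℝ} (hn : 0 < n) (β h : ℝ) :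
    Integrable (fun J => partitionFunction N β h J ^ n) (disorder N) :=
  Integrable.of_integral_ne_zero (moment_pos N hn β h).ne'

/-- Jensen's inequality: the `L^n` norms of the partition function increase with `n`. -/
lemma phiN_mono (N : ℕ) {n n' : ℝ} (hn : 0 < n) (hnn' : n ≤ n') (β h : ℝ) :
    phiN N n β h ≤ phiN N n' β h := by
  have hp : 1 ≤ n' / n := (one_le_div hn).2 hnn'
  have e : ∀ J, (partitionFunction N β h J ^ n) ^ (n' / n) = partitionFunction N β h J ^ n' := by
    intro J
    rw [← Real.rpow_mul (partitionFunction_pos β h J).le, mul_div_cancel₀ _ hn.ne']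
  have h1 := (convexOn_rpow hp).map_integral_le
    (f := fun J => partitionFunction N β h J ^ n) (μ := disorder N)
    (Real.continuous_rpow_const (by linarith)).continuousOn isClosed_Ici
    (Eventually.of_forall fun J => (Real.rpow_pos_of_pos (partitionFunction_pos β h J) n).le)
    (integrable_rpow_partitionFunction N hn β h)
    (by simpa only [Function.comp_def, e]
      using integrable_rpow_partitionFunction N (hn.trans_le hnn') β h)
  simp only [e] at h1
  have h2 := Real.log_le_log (Real.rpow_pos_of_pos (moment_pos N hn β h) _) h1
  rw [Real.log_rpow (moment_pos N hn β h)] at h2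
  have h3 := mul_le_mul_of_nonneg_left h2
    (mul_nonneg (Nat.cast_nonneg N) (hn.trans_le hnn').le |> one_div_nonneg.2)
  refine le_of_eq_of_le ?_ h3
  have hn' := (hn.trans_le hnn').ne'
  change 1 / (N * n) * Real.log (moment N n β h) = _
  rcases eq_or_ne N 0 with rfl | hN
  · simp
  · field_simp

/-- A single spin sees no disorder. -/
lemma phiN_one {n : ℝ} (hn : 0 < n) (β h : ℝ) :
    phiN 1 n β h = Real.log (partitionFunction 1 β h 0) := by
  have : IsEmpty (Pair 1) := ⟨fun p => p.2.ne (Subsingleton.elim _ _)⟩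
  have e : ∀ J, partitionFunction 1 β h J = partitionFunction 1 β h 0 := fun J => by
    rw [Subsingleton.elim J 0]
  rw [phiN]
  simp only [fun J => e J, integral_const, probReal_univ, one_smul,
    Real.log_rpow (partitionFunction_pos β h _)]
  field_simp
  simp

/-! ### Continuity of the Parisi functional -/

/-- The Parisi functional is Lipschitz for the `L¹` distance of order parameters. -/
lemma exists_abs_alphaP_sub_le (β h : ℝ) {x : ℝ → ℝ} (hx : x ∈ chi 0) :
    ∃ C, ∀ n x', x' ∈ chi 0 → |alphaP n β h x' - alphaP 0 β h x|
      ≤ |n| * β ^ 2 / 4 + C * ∫ q in (0 : ℝ)..1, |x' q - x q| := by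
  have hI0 : (0 : ℝ) ∈ Icc (0 : ℝ) 1 := ⟨le_rfl, zero_le_one⟩
  have hI1 : (1 : ℝ) ∈ Icc (0 : ℝ) 1 := ⟨zero_le_one, le_rfl⟩
  have hf := parisiSolution_spec β hx
  obtain ⟨C, -, hC⟩ := hf.abs_deriv_le
  refine ⟨C ^ 2 / 2 + β ^ 2 / 2, fun n x' hx' => ?_⟩
  have h1 := hf.sub_le hx hC (parisiSolution_spec β hx') hx' hI0 h
  rw [abs_sub_comm] at h1
  simp only [fun s => abs_sub_comm (x s) (x' s)] at h1
  have hi := intervalIntegrable_mul_chi le_rfl hx hI0 hI1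
  have hi' := intervalIntegrable_mul_chi le_rfl hx' hI0 hI1
  have h2 : |(∫ q in (0 : ℝ)..1, q * x' q) - ∫ q in (0 : ℝ)..1, q * x q|
      ≤ ∫ q in (0 : ℝ)..1, |x' q - x q| := by
    rw [← intervalIntegral.integral_sub hi' hi]
    refine (intervalIntegral.abs_integral_le_integral_abs zero_le_one).trans ?_
    refine intervalIntegral.integral_mono_on zero_le_one (hi'.sub hi).abs
      ((chi_intervalIntegrable le_rfl hx' hI0 hI1).sub
        (chi_intervalIntegrable le_rfl hx hI0 hI1)).abs fun q hq => ?_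
    rw [← mul_sub, abs_mul, abs_of_nonneg hq.1]
    exact mul_le_of_le_one_left (abs_nonneg _) hq.2
  have e : alphaP n β h x' - alphaP 0 β h x = n * β ^ 2 / 4
      + (parisiSolution β x' 0 h - parisiSolution β x 0 h)
      + -(β ^ 2 / 2) * ((∫ q in (0 : ℝ)..1, q * x' q) - ∫ q in (0 : ℝ)..1, q * x q) := by
    rw [alphaP, alphaP]
    ring
  rw [e]
  refine (abs_add_three _ _ _).trans ?_
  have h3 : |n * β ^ 2 / 4| = |n| * β ^ 2 / 4 := by
    rw [abs_div, abs_mul, abs_of_nonneg (sq_nonneg β), abs_of_pos (by norm_num : (0 : ℝ) < 4)]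
  rw [h3, abs_mul, abs_neg, abs_of_nonneg (by positivity : 0 ≤ β ^ 2 / 2)]
  have h4 := mul_le_mul_of_nonneg_left h2 (by positivity : 0 ≤ β ^ 2 / 2)
  linarith

lemma tendsto_alphaP (β h : ℝ) {x : ℝ → ℝ} (hx : x ∈ chi 0) {xn : ℝ → ℝ → ℝ}
    (hxn : ∀ n ∈ Ioc (0 : ℝ) 1, xn n ∈ chi n)
    (hlim : Tendsto (fun n => ∫ q in (0 : ℝ)..1, |xn n q - x q|) (𝓝[>] 0) (𝓝 0)) :
    Tendsto (fun n => alphaP n β h (xn n)) (𝓝[>] 0) (𝓝 (alphaP 0 β h x)) := by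
  obtain ⟨C, hC⟩ := exists_abs_alphaP_sub_le β h hx
  rw [tendsto_iff_dist_tendsto_zero]
  have hn : Tendsto (fun n : ℝ => |n| * β ^ 2 / 4) (𝓝[>] 0) (𝓝 0) := by
    have : Continuous fun n : ℝ => |n| * β ^ 2 / 4 := by fun_prop
    simpa using (this.tendsto 0).mono_left nhdsWithin_le_nhds
  refine squeeze_zero' (Eventually.of_forall fun n => dist_nonneg) ?_
    (by simpa using hn.add (hlim.const_mul C))
  filter_upwards [Ioc_mem_nhdsGT zero_lt_one] with n hn'
  rw [Real.dist_eq]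
  exact hC n _ (chi_mono hn'.1.le (hxn n hn'))

lemma bddBelow_alphaP (β h : ℝ) {n : ℝ} (hn : 0 ≤ n) : BddBelow (alphaP n β h '' chi n) := by
  refine ⟨-(β ^ 2 / 2), ?_⟩
  rintro _ ⟨x, hx, rfl⟩
  have hx0 : x ∈ chi 0 := chi_mono hn hx
  have h1 := (parisiSolution_spec β hx0).nonneg hx0 ⟨le_rfl, zero_le_one⟩ h
  have h2 : ∫ q in (0 : ℝ)..1, q * x q ≤ 1 := by
    have := intervalIntegral.norm_integral_le_of_norm_le_const (a := (0 : ℝ)) (b := 1) (C := 1)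
      (f := fun q => q * x q) fun q hq => ?_
    · simpa using (le_abs_self _).trans this
    · rw [uIoc_of_le zero_le_one] at hq
      have hxq := chi_mem_Icc hx0 hq
      rw [Real.norm_eq_abs, abs_mul, abs_of_pos hq.1, abs_of_nonneg hxq.1]
      exact mul_le_one₀ hq.2 hxq.1 hxq.2
  have h3 := Real.log_pos one_lt_two
  have h4 : 0 ≤ n * β ^ 2 / 4 := by positivity
  have h5 := mul_le_mul_of_nonneg_left h2 (by positivity : 0 ≤ β ^ 2 / 2)
  rw [alphaP]
  linarith

lemma infAlphaP_zero_le (β h : ℝ) {n : ℝ} (hn : n ∈ Ioc (0 : ℝ) 1) :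
    infAlphaP 0 β h ≤ infAlphaP n β h := by
  refine le_csInf ⟨_, mem_image_of_mem _ (one_mem_chi hn.2)⟩ ?_
  rintro _ ⟨x, hx, rfl⟩
  refine (csInf_le (bddBelow_alphaP β h le_rfl)
    (mem_image_of_mem _ (chi_mono hn.1.le hx))).trans ?_
  have : 0 ≤ n * β ^ 2 / 4 := div_nonneg (mul_nonneg hn.1.le (sq_nonneg _)) (by norm_num)
  rw [alphaP, alphaP]
  linarith

lemma integral_abs_max_sub_le {n : ℝ} (hn : 0 ≤ n) {x : ℝ → ℝ} (hx : x ∈ chi 0) :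
    ∫ q in (0 : ℝ)..1, |max (x q) n - x q| ≤ n := by
  have := intervalIntegral.norm_integral_le_of_norm_le_const (a := (0 : ℝ)) (b := 1) (C := n)
    (f := fun q => |max (x q) n - x q|) fun q hq => ?_
  · simpa using (le_abs_self _).trans this
  · rw [uIoc_of_le zero_le_one] at hq
    have hxq := (chi_mem_Icc hx hq).1
    rw [Real.norm_eq_abs, abs_abs, abs_of_nonneg (sub_nonneg.2 (le_max_left _ _))]
    rcases le_total (x q) n with h | h
    · rw [max_eq_right h]
      linarith
    · rw [max_eq_left h]
      linarith

/-- Near-minimizers `x` of the Parisi functional are approximated by `max x n ∈ χ_n`. -/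
lemma tendsto_infAlphaP (β h : ℝ) :
    Tendsto (fun n => infAlphaP n β h) (𝓝[>] 0) (𝓝 (infAlphaP 0 β h)) := by
  rw [tendsto_order]
  refine ⟨fun a ha => ?_, fun a ha => ?_⟩
  · filter_upwards [Ioc_mem_nhdsGT zero_lt_one] with n hn
    exact ha.trans_le (infAlphaP_zero_le β h hn)
  · obtain ⟨_, ⟨x, hx, rfl⟩, hxa⟩ := exists_lt_of_csInf_lt
      ⟨_, mem_image_of_mem _ (one_mem_chi zero_le_one)⟩ ha
    have hid : Tendsto (fun n : ℝ => n) (𝓝[>] 0) (𝓝 0) := nhdsWithin_le_nhds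
    have hlim : Tendsto (fun n => ∫ q in (0 : ℝ)..1, |max (x q) n - x q|) (𝓝[>] 0) (𝓝 0) := by
      refine squeeze_zero' (Eventually.of_forall fun n =>
        intervalIntegral.integral_nonneg zero_le_one fun q _ => abs_nonneg _) ?_ hid
      filter_upwards [self_mem_nhdsWithin] with n hn
      exact integral_abs_max_sub_le (le_of_lt hn) hx
    have h1 := tendsto_alphaP β h hx (xn := fun n q => max (x q) n)
      (fun n hn => max_mem_chi hn.2 hx) hlim
    filter_upwards [Ioc_mem_nhdsGT zero_lt_one, h1.eventually_lt_const hxa] with n hn hna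
    exact (csInf_le (bddBelow_alphaP β h hn.1.le)
      (mem_image_of_mem _ (max_mem_chi hn.2 hx))).trans_lt hna

end SKReplica

end

theorem mainTheorem6 (β h : ℝ) :
    -- the Parisi equation has exactly one solution, so that the functional is well defined,
    -- and the infima are taken over nonempty sets that are bounded below
    (∀ x ∈ SKReplica.chi 0,
      SKReplica.IsParisiSolution β x (SKReplica.parisiSolution β x) ∧
      ∀ f, SKReplica.IsParisiSolution β x f →
        ∀ q ∈ Icc (0 : ℝ) 1, ∀ y, f q y = SKReplica.parisiSolution β x q y) ∧
    (∀ n ∈ Icc (0 : ℝ) 1, (SKReplica.chi n).Nonempty ∧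
      BddBelow (SKReplica.alphaP n β h '' SKReplica.chi n)) ∧
    -- the thermodynamic limit and its bounds
    (∃ φ : ℝ → ℝ,
      (∀ n ∈ Ioc (0 : ℝ) 1,
        Tendsto (fun N : ℕ => SKReplica.phiN N n β h) atTop (𝓝 (φ n)) ∧
        (∀ x ∈ SKReplica.chi n, φ n ≤ SKReplica.alphaP n β h x) ∧
        φ n ≤ SKReplica.infAlphaP n β h) ∧
      -- the limit of zero replicas
      ∃ φ₀ : ℝ, Tendsto φ (𝓝[>] 0) (𝓝 φ₀) ∧ φ₀ ≤ SKReplica.infAlphaP 0 β h) ∧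
    Tendsto (fun n => SKReplica.infAlphaP n β h) (𝓝[>] 0) (𝓝 (SKReplica.infAlphaP 0 β h)) ∧
    -- convergence of the functional along families of order parameters
    (∀ x ∈ SKReplica.chi 0, ∀ xn : ℝ → ℝ → ℝ, (∀ n ∈ Ioc (0 : ℝ) 1, xn n ∈ SKReplica.chi n) →
      Tendsto (fun n => ∫ q in (0 : ℝ)..1, |xn n q - x q|) (𝓝[>] 0) (𝓝 0) →
      Tendsto (fun n => SKReplica.alphaP n β h (xn n)) (𝓝[>] 0)
        (𝓝 (SKReplica.alphaP 0 β h x))) := by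
  refine ⟨fun x hx => ⟨SKReplica.parisiSolution_spec β hx, fun f hf q hq y =>
      hf.unique hx (SKReplica.parisiSolution_spec β hx) hq y⟩,
    fun n hn => ⟨⟨_, SKReplica.one_mem_chi hn.2⟩, SKReplica.bddBelow_alphaP β h hn.1⟩, ?_,
    SKReplica.tendsto_infAlphaP β h,
    fun x hx xn hxn hlim => SKReplica.tendsto_alphaP β h hx hxn hlim⟩
  have hex : ∀ n : ℝ, ∃ l, n ∈ Ioc (0 : ℝ) 1 →
      Tendsto (fun N : ℕ => SKReplica.phiN N n β h) atTop (𝓝 l) ∧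
        ∀ N ≠ 0, SKReplica.phiN N n β h ≤ l := fun n => by
    by_cases hn : n ∈ Ioc (0 : ℝ) 1
    · obtain ⟨l, hl⟩ := SKReplica.exists_tendsto_phiN hn β h
      exact ⟨l, fun _ => hl⟩
    · exact ⟨0, fun hn' => absurd hn' hn⟩
  choose φ hφ using hex
  have hle : ∀ n ∈ Ioc (0 : ℝ) 1, ∀ x ∈ SKReplica.chi n, φ n ≤ SKReplica.alphaP n β h x :=
    fun n hn x hx => le_of_tendsto (hφ n hn).1 <| by
      filter_upwards [eventually_ne_atTop 0] with N hN
      exact SKReplica.phiN_le_alphaP hN β h hn hx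
  have hinf : ∀ n ∈ Ioc (0 : ℝ) 1, φ n ≤ SKReplica.infAlphaP n β h := fun n hn => by
    refine le_csInf ⟨_, mem_image_of_mem _ (SKReplica.one_mem_chi hn.2)⟩ ?_
    rintro _ ⟨x, hx, rfl⟩
    exact hle n hn x hx
  have hmono : MonotoneOn φ (Ioo 0 1) := fun n hn n' hn' hnn' =>
    le_of_tendsto_of_tendsto' (hφ n (Ioo_subset_Ioc_self hn)).1 (hφ n' (Ioo_subset_Ioc_self hn')).1
      fun N => SKReplica.phiN_mono N hn.1 hnn' β h
  have hbdd : BddBelow (φ '' Ioo 0 1) := by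
    refine ⟨Real.log (SKReplica.partitionFunction 1 β h 0), ?_⟩
    rintro _ ⟨n, hn, rfl⟩
    rw [← SKReplica.phiN_one hn.1 β h]
    exact (hφ n (Ioo_subset_Ioc_self hn)).2 1 one_ne_zero
  have hlim := hmono.tendsto_nhdsWithin_Ioo_right (nonempty_Ioo.2 zero_lt_one) hbdd
  refine ⟨φ, fun n hn => ⟨(hφ n hn).1, hle n hn, hinf n hn⟩, _, hlim, ?_⟩
  refine le_of_tendsto_of_tendsto hlim (SKReplica.tendsto_infAlphaP β h) ?_
  filter_upwards [Ioc_mem_nhdsGT zero_lt_one] with n hn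
  exact hinf n hn
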